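/- Let $K$ be a field. A superadditive category over $K$ is a small $K$-linear category $\mathcal A$ (no finite products are assumed) whose morphism spaces carry decompositions $\mathcal A(X,Y)=\mathcal A(X,Y)_0\oplus\mathcal A(X,Y)_1$ such that composition is even; composites are written from left to right, so $\alpha\beta$ is first $\alpha$ and then $\beta$, and $|\alpha|\in\mathbb Z/2$ is the parity of a homogeneous morphism. A superspace is a $\mathbb Z/2$-graded $K$-vector space; isomorphisms of superspaces are even. **Graded Morita equivalence.** A graded $\mathcal A$-module is a $K$-linear functor $M$ from $\mathcal A$ to superspaces such that morphisms of parity $i$ act by linear maps of parity $i$. Let $\operatorname{Gr}\mathcal A$ be the $K$-linear category of graded $\mathcal A$-modules and even natural transformations, and let $\pi$ be the parity change on it, $(\pi M)(X)_i=M(X)_{i+1}$ with unchanged action, so that $\pi\pi=\mathrm{id}$. A $K$-linear functor $F:\operatorname{Gr}\mathcal A\to\operatorname{Gr}\mathcal B$ is even if it commutes with $\pi$, i.e. if there is a natural isomorphism $F\pi\cong\pi F$ compatible with the identifications $\pi\pi=\mathrm{id}$. The categories $\mathcal A$ and $\mathcal B$ are graded Morita equivalent if there are even $K$-linear functors $F:\operatorname{Gr}\mathcal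 A\to\operatorname{Gr}\mathcal B$ and $G:\operatorname{Gr}\mathcal B\to\operatorname{Gr}\mathcal A$ with $GF\cong\mathrm{Id}$ and $FG\cong\mathrm{Id}$. **Homology.** For $n\ge 0$ let $$C_n(\mathcal A)=\bigoplus_{(Z_0,\dots,Z_n)}\mathcal A(Z_n,Z_0)\otimes\mathcal A(Z_0,Z_1)\otimes\cdots\otimes\mathcal A(Z_{n-1},Z_n),$$ the sum being over all $(n+1)$-tuples of objects. On homogeneous elements $(a_0,\dots,a_n)=a_0\otimes\cdots\otimes a_n$ put $$d^i(a_0,\dots,a_n)=(a_0,\dots,a_ia_{i+1},\dots,a_n)\ (0\le i<n),\qquad d^n(a_0,\dots,a_n)=(-1)^{|a_n|(|a_0|+\cdots+|a_{n-1}|)}(a_na_0,a_1,\dots,a_{n-1}),$$ $$\partial_n=\sum_{i=0}^n(-1)^id^i,\qquad \bar\partial_n=\sum_{i=0}^{n-1}(-1)^id^i\qquad (n\ge1),$$ $$t_n(a_0,\dots,a_n)=(-1)^{n+|a_n|(|a_0|+\cdots+|a_{n-1}|)}(a_n,a_0,\dots,a_{n-1}),\qquad N_n=1+t_n+\cdots+t_n^n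 .$$ The Hochschild homology $HH_n(\mathcal A)=HH_n(\mathcal A,\mathcal A)$ is the $n$-th homology of $(C_*(\mathcal A),\partial)$. The cyclic bicomplex is $CC_{p,q}=C_q(\mathcal A)$, $p,q\ge0$, with vertical differential $CC_{p,q}\to CC_{p,q-1}$ equal to $\partial_q$ for $p$ even and $-\bar\partial_q$ for $p$ odd, and horizontal differential $CC_{p,q}\to CC_{p-1,q}$ equal to $1-t_q$ for $p$ odd and $N_q$ for $p\ge 2$ even. The cyclic homology $HC_n(\mathcal A)$ is the $n$-th homology of its total complex, and the cyclic cohomology $HC^n(\mathcal A)$ is the $n$-th cohomology of the $K$-linear dual of that total complex. **Hochschild cohomology.** $HH^n(\mathcal A)=HH^n(\mathcal A,\mathcal A)$ is the $n$-th cohomology of $$C^n(\mathcal A)=\prod_{(Z_0,\dots,Z_n)}\operatorname{Hom}_K\bigl(\mathcal A(Z_0,Z_1)\otimes\cdots\otimes\mathcal A(Z_{n-1},Z_n),\ \mathcal A(Z_0,Z_n)\bigr)$$ with, for homogeneous $\varphi$ and $a_1,\dots,a_{n+1}$, $$(\partial\varphi)(a_1,\dots,a_{n+1})=(-1)^{|a_1||\varphi|}a_1\varphi(a_2,\dots,a_{n+1})+\sum_{i=1}^{n}(-1)^i\varphi(a_1,\dots,a_ia_{i+1},\dots,a_{n+1})+(-1)^{n+1}\varphi(a_1,\dots,a_n)a_{n+1}.$$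 (Here the homogeneous cochains of parity $p$ are the families that raise parity by $p$.) All these (co)homology groups are superspaces with the induced gradings. **Theorem.** If $\mathcal A$ and $\mathcal B$ are graded Morita equivalent superadditive categories over $K$, then for every $n\ge0$ there are isomorphisms of superspaces $$HH_n(\mathcal A)\cong HH_n(\mathcal B),\qquad HH^n(\mathcal A)\cong HH^n(\mathcal B),\qquad HC_n(\mathcal A)\cong HC_n(\mathcal B),\qquad HC^n(\mathcal A)\cong HC^n(\mathcal B).$$ -/

import Mathlib

open CategoryTheory
open scoped TensorProduct DirectSum

set_option linter.unusedSectionVars false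

universe u

namespace SuperHochschild

/-! ## Superadditive categories -/

/-- A superadditive category over `K`: a `K`-linear category whose morphism spaces carry a
decomposition `C(X, Y) = C(X, Y)₀ ⊕ C(X, Y)₁` for which composition is even. -/
class SuperCategory (K : Type u) [Field K] (C : Type u) [Category.{u} C] [Preadditive C]
    [Linear K C] where
  /-- `deg X Y i` is the space `C(X, Y)ᵢ` of morphisms of parity `i` (including `0`). -/
  deg : ∀ X Y : C, ZMod 2 → Submodule K (X ⟶ Y)
  isCompl : ∀ X Y : C, IsCompl (deg X Y 0) (deg X Y 1)
  comp_mem : ∀ {X Y Z : C} {i j : ZMod 2} {f : X ⟶ Y} {g : Y ⟶ Z},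
    f ∈ deg X Y i → g ∈ deg Y Z j → f ≫ g ∈ deg X Z (i + j)

/-! ## Graded modules, the parity change and even functors -/

section Modules

variable (K : Type u) [Field K] (C : Type u) [Category.{u} C] [Preadditive C] [Linear K C]
  [SuperCategory K C]

/-- A graded (left) module over `C`: a graded functor from `C` to superspaces. A morphism of
parity `i` acts by a linear map of parity `i`. -/
structure GrMod where
  obj : C → Type u
  [addCommGroup : ∀ X, AddCommGroup (obj X)]
  [module : ∀ X, Module K (obj X)]
  gr : ∀ X, ZMod 2 → Submodule K (obj X)
  isCompl : ∀ X, IsCompl (gr X 0) (gr X 1)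
  act : ∀ {X Y : C}, (X ⟶ Y) →ₗ[K] obj X →ₗ[K] obj Y
  act_id : ∀ (X : C) (m : obj X), act (𝟙 X) m = m
  act_comp : ∀ {X Y Z : C} (f : X ⟶ Y) (g : Y ⟶ Z) (m : obj X), act (f ≫ g) m = act g (act f m)
  act_mem : ∀ {X Y : C} {i j : ZMod 2} {f : X ⟶ Y} {m : obj X},
    f ∈ SuperCategory.deg (K := K) X Y i → m ∈ gr X j → act f m ∈ gr Y (i + j)

attribute [instance] GrMod.addCommGroup GrMod.module

variable {K C}

/-- The space of even natural transformations between two graded modules. -/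
def GrMod.evenHom (M N : GrMod K C) : Submodule K (∀ X, M.obj X →ₗ[K] N.obj X) where
  carrier := {η | (∀ (X Y : C) (f : X ⟶ Y) (m : M.obj X), η Y (M.act f m) = N.act f (η X m)) ∧
    ∀ (X : C) (i : ZMod 2) (m : M.obj X), m ∈ M.gr X i → η X m ∈ N.gr X i}
  add_mem' := by
    rintro η θ ⟨h₁, h₂⟩ ⟨h₃, h₄⟩
    refine ⟨fun X Y f m => ?_, fun X i m hm => ?_⟩
    · simp [h₁, h₃]
    · exact add_mem (h₂ X i m hm) (h₄ X i m hm)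
  zero_mem' := by
    refine ⟨fun X Y f m => ?_, fun X i m hm => ?_⟩
    · simp
    · exact zero_mem _
  smul_mem' := by
    rintro c η ⟨h₁, h₂⟩
    refine ⟨fun X Y f m => ?_, fun X i m hm => ?_⟩
    · simp [h₁]
    · exact Submodule.smul_mem _ c (h₂ X i m hm)

/-- The category `Gr C` of graded modules and even natural transformations. -/
instance : Category.{u} (GrMod K C) where
  Hom M N := ↥(GrMod.evenHom M N)
  id M := ⟨fun _ => LinearMap.id, fun _ _ _ _ => rfl, fun _ _ _ hm => hm⟩
  comp η θ := ⟨fun X => (θ.1 X).comp (η.1 X),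
    fun X Y f m => by simp [η.2.1 X Y f m, θ.2.1 X Y f],
    fun X i m hm => θ.2.2 X i _ (η.2.2 X i m hm)⟩

instance : Preadditive (GrMod K C) where
  homGroup M N := inferInstanceAs (AddCommGroup ↥(GrMod.evenHom M N))
  add_comp _ _ _ η η' θ := Subtype.ext (funext fun X => LinearMap.ext fun m =>
    map_add (θ.1 X) (η.1 X m) (η'.1 X m))
  comp_add _ _ _ _ _ _ := rfl

instance : Linear K (GrMod K C) where
  homModule M N := inferInstanceAs (Module K ↥(GrMod.evenHom M N))
  smul_comp _ _ _ c η θ := Subtype.ext (funext fun X => LinearMap.ext fun m =>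
    map_smul (θ.1 X) c (η.1 X m))
  comp_smul _ _ _ _ _ _ := rfl

variable (K C) in
/-- The parity change `π` on graded modules: `(πM)(X)ᵢ = M(X)ᵢ₊₁`, with the same action. -/
def parity : GrMod K C ⥤ GrMod K C where
  obj M :=
    { obj := M.obj
      gr := fun X i => M.gr X (i + 1)
      isCompl := fun X => (M.isCompl X).symm
      act := M.act
      act_id := M.act_id
      act_comp := M.act_comp
      act_mem := fun {_ _ i j _ _} hf hm => (add_assoc i j 1).symm ▸ M.act_mem hf hm }
  map η := ⟨η.1, η.2.1, fun X i m hm => η.2.2 X (i + 1) m hm⟩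

variable (K C) in
/-- The identification `ππM = M`, given by the identity maps. -/
def parityParity : parity K C ⋙ parity K C ≅ 𝟭 (GrMod K C) :=
  NatIso.ofComponents fun M =>
    { hom := ⟨fun _ => LinearMap.id, fun _ _ _ _ => rfl, fun X i m hm => by
        have h : i + 1 + 1 = i := by rw [add_assoc]; exact add_zero i
        have hm' : m ∈ M.gr X (i + 1 + 1) := hm
        rw [h] at hm'; exact hm'⟩
      inv := ⟨fun _ => LinearMap.id, fun _ _ _ _ => rfl, fun X i m hm => by
        have h : i + 1 + 1 = i := by rw [add_assoc]; exact add_zero i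
        show m ∈ M.gr X (i + 1 + 1)
        rw [h]; exact hm⟩ }

end Modules

section EvenFunctors

variable (K : Type u) [Field K]
  (C : Type u) [Category.{u} C] [Preadditive C] [Linear K C] [SuperCategory K C]
  (D : Type u) [Category.{u} D] [Preadditive D] [Linear K D] [SuperCategory K D]

variable {K C D} in
/-- A `K`-linear functor between categories of graded modules is even if it commutes with the
parity change: there are natural isomorphisms `F(πM) ≅ π(F M)` compatible with `ππ = id`. -/
def IsEven (F : GrMod K C ⥤ GrMod K D) : Prop :=
  ∃ e : parity K C ⋙ F ≅ F ⋙ parity K D, ∀ M : GrMod K C,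
    e.hom.app ((parity K C).obj M) ≫ (parity K D).map (e.hom.app M) ≫
      (parityParity K D).hom.app (F.obj M) = F.map ((parityParity K C).hom.app M)

/-- `C` and `D` are graded Morita equivalent if there are mutually quasi-inverse even `K`-linear
functors between their categories of graded modules. -/
def GradedMoritaEquivalent : Prop :=
  ∃ (F : GrMod K C ⥤ GrMod K D) (G : GrMod K D ⥤ GrMod K C),
    F.Additive ∧ F.Linear K ∧ IsEven F ∧ G.Additive ∧ G.Linear K ∧ IsEven G ∧
      Nonempty (F ⋙ G ≅ 𝟭 (GrMod K C)) ∧ Nonempty (G ⋙ F ≅ 𝟭 (GrMod K D))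

end EvenFunctors

/-! ## Nerves and the structure maps on them -/

section Nerve

variable {C : Type u} [Category.{u} C]

/-- The composite `Z x ⟶ Z y` of the morphisms `a i : Z i ⟶ Z (i + 1)` with `x ≤ i < y`. -/
noncomputable def pathHom {n : ℕ} (Z : Fin (n + 1) → C)
    (a : ∀ i : Fin n, Z i.castSucc ⟶ Z i.succ) {x y : Fin (n + 1)} (h : x ≤ y) : Z x ⟶ Z y :=
  (ComposableArrows.mkOfObjOfMapSucc Z a).map (homOfLE h)

theorem pathHom_self {n : ℕ} (Z : Fin (n + 1) → C)
    (a : ∀ i : Fin n, Z i.castSucc ⟶ Z i.succ) {x : Fin (n + 1)} (h : x ≤ x) :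
    pathHom Z a h = 𝟙 (Z x) :=
  (ComposableArrows.mkOfObjOfMapSucc Z a).map_id x

theorem pathHom_trans {n : ℕ} (Z : Fin (n + 1) → C)
    (a : ∀ i : Fin n, Z i.castSucc ⟶ Z i.succ) {x y z : Fin (n + 1)} (h : x ≤ y) (h' : y ≤ z) :
    pathHom Z a (h.trans h') = pathHom Z a h ≫ pathHom Z a h' :=
  (ComposableArrows.mkOfObjOfMapSucc Z a).map_comp (homOfLE h) (homOfLE h')

theorem pathHom_succ {n : ℕ} (Z : Fin (n + 1) → C)
    (a : ∀ i : Fin n, Z i.castSucc ⟶ Z i.succ) (i : Fin n) (h : i.castSucc ≤ i.succ) :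
    pathHom Z a h = a i :=
  ComposableArrows.mkOfObjOfMapSucc_map_succ Z a i.1 i.2

theorem pathHom_congr {n : ℕ} (Z : Fin (n + 1) → C)
    (a a' : ∀ i : Fin n, Z i.castSucc ⟶ Z i.succ) {x y : Fin (n + 1)} (h : x ≤ y)
    (haa : ∀ i : Fin n, x ≤ i.castSucc → i.succ ≤ y → a i = a' i) :
    pathHom Z a h = pathHom Z a' h := by
  induction y using Fin.induction with
  | zero =>
    obtain rfl : x = 0 := le_antisymm h (Fin.zero_le x)
    rw [pathHom_self, pathHom_self]
  | succ y ih =>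
    rcases h.eq_or_lt with rfl | hlt
    · rw [pathHom_self, pathHom_self]
    · have hx : x ≤ y.castSucc := Fin.le_castSucc_iff.2 hlt
      have hy : y.castSucc ≤ y.succ := Fin.castSucc_lt_succ.le
      rw [pathHom_trans Z a hx hy, pathHom_trans Z a' hx hy,
        ih hx fun i h₁ h₂ => haa i h₁ (h₂.trans hy), pathHom_succ, pathHom_succ,
        haa y hx le_rfl]

theorem pathHom_update {n : ℕ} (Z : Fin (n + 1) → C)
    (a : ∀ i : Fin n, Z i.castSucc ⟶ Z i.succ) {x y : Fin (n + 1)} (h : x ≤ y) (k : Fin n)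
    (hx : x ≤ k.castSucc) (hy : k.succ ≤ y) (v : Z k.castSucc ⟶ Z k.succ) :
    pathHom Z (Function.update a k v) h = pathHom Z a hx ≫ v ≫ pathHom Z a hy := by
  have hk : k.castSucc ≤ k.succ := Fin.castSucc_lt_succ.le
  have e₁ : pathHom Z (Function.update a k v) hx = pathHom Z a hx :=
    pathHom_congr Z _ _ hx fun i _ h₂ => Function.update_of_ne (by
      rintro rfl; exact absurd h₂ (not_le.2 Fin.castSucc_lt_succ)) _ _
  have e₂ : pathHom Z (Function.update a k v) hy = pathHom Z a hy :=
    pathHom_congr Z _ _ hy fun i h₁ _ => Function.update_of_ne (by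
      rintro rfl; exact absurd h₁ (not_le.2 Fin.castSucc_lt_succ)) _ _
  rw [pathHom_trans Z _ hx (hk.trans hy), pathHom_trans Z _ hk hy, e₁, e₂, pathHom_succ,
    Function.update_self]

variable (K : Type u) [Field K] [Preadditive C] [Linear K C]

/-- The `K`-nerve `C(Z₀, Z₁) ⊗ C(Z₁, Z₂) ⊗ ⋯ ⊗ C(Zₙ₋₁, Zₙ)` of a tuple `(Z₀, …, Zₙ)`. -/
abbrev Nerve {n : ℕ} (Z : Fin (n + 1) → C) : Type u :=
  ⨂[K] i : Fin n, (Z i.castSucc ⟶ Z i.succ)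

/-- A function of a dependent tuple that is linear in each variable is multilinear. -/
def mkMultilinear {n : ℕ} {V : Fin n → Type u} [∀ i, AddCommGroup (V i)] [∀ i, Module K (V i)]
    {W : Type u} [AddCommGroup W] [Module K W] (f : (∀ i, V i) → W)
    (hf : ∀ (a : ∀ i, V i) (k : Fin n), ∃ L : V k →ₗ[K] W, ∀ v, f (Function.update a k v) = L v) :
    MultilinearMap K V W where
  toFun := f
  map_update_add' {inst} a k v w := by
    obtain rfl : inst = fun i j => instDecidableEqFin n i j := Subsingleton.elim _ _
    obtain ⟨L, hL⟩ := hf a k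
    rw [hL, hL, hL, map_add]
  map_update_smul' {inst} a k c v := by
    obtain rfl : inst = fun i j => instDecidableEqFin n i j := Subsingleton.elim _ _
    obtain ⟨L, hL⟩ := hf a k
    rw [hL, hL, map_smul]

/-! ### Operations on strings of morphisms -/

/-- The tuple `(Z₁, …, Zₙ₊₁)`. -/
def tailObj {n : ℕ} (Z : Fin (n + 2) → C) : Fin (n + 1) → C :=
  fun j => Z j.succ

/-- The string `(a₁, …, aₙ)` obtained from `(a₀, …, aₙ)`. -/
def tailArrow {n : ℕ} {Z : Fin (n + 2) → C} (a : ∀ i : Fin (n + 1), Z i.castSucc ⟶ Z i.succ) :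
    ∀ j : Fin n, tailObj Z j.castSucc ⟶ tailObj Z j.succ :=
  fun j => a j.succ

/-- The tuple `(Z₀, …, Zₙ)` obtained from `(Z₀, …, Zₙ₊₁)`. -/
def initObj {n : ℕ} (Z : Fin (n + 2) → C) : Fin (n + 1) → C :=
  fun j => Z j.castSucc

/-- The string `(a₀, …, aₙ₋₁)` obtained from `(a₀, …, aₙ)`. -/
def initArrow {n : ℕ} {Z : Fin (n + 2) → C} (a : ∀ i : Fin (n + 1), Z i.castSucc ⟶ Z i.succ) :
    ∀ j : Fin n, initObj Z j.castSucc ⟶ initObj Z j.succ :=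
  fun j => a j.castSucc

/-- The tuple `(Zₙ₊₁, Z₀, …, Zₙ)`. -/
def rotObj {n : ℕ} (Z : Fin (n + 2) → C) : Fin (n + 2) → C :=
  Fin.cons (Z (Fin.last (n + 1))) (initObj Z)

/-- The string `(m, a₀, …, aₙ₋₁)` along the tuple `(Zₙ₊₁, Z₀, …, Zₙ)`, for `m : Zₙ₊₁ ⟶ Z₀`. -/
def rotArrow {n : ℕ} {Z : Fin (n + 2) → C} (m : Z (Fin.last (n + 1)) ⟶ Z 0)
    (a : ∀ i : Fin (n + 1), Z i.castSucc ⟶ Z i.succ) :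
    ∀ j : Fin (n + 1), rotObj Z j.castSucc ⟶ rotObj Z j.succ :=
  Fin.cases m (initArrow a)

/-- The composite `m a₀ : Zₙ₊₁ ⟶ Z₁` of `m : Zₙ₊₁ ⟶ Z₀` and `a₀ : Z₀ ⟶ Z₁`. -/
def tailHead {n : ℕ} {Z : Fin (n + 2) → C} (m : Z (Fin.last (n + 1)) ⟶ Z 0)
    (a : ∀ i : Fin (n + 1), Z i.castSucc ⟶ Z i.succ) :
    tailObj Z (Fin.last n) ⟶ tailObj Z 0 :=
  (m ≫ a 0 : Z (Fin.last (n + 1)) ⟶ Z 1)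

/-- The first morphism `a₀ : Z₀ ⟶ Z₁` of a string. -/
def firstArrow {n : ℕ} {Z : Fin (n + 2) → C} (a : ∀ i : Fin (n + 1), Z i.castSucc ⟶ Z i.succ) :
    Z 0 ⟶ tailObj Z 0 :=
  a 0

/-- The last morphism `aₙ : Zₙ ⟶ Zₙ₊₁` of a string. -/
def lastArrow {n : ℕ} {Z : Fin (n + 2) → C} (a : ∀ i : Fin (n + 1), Z i.castSucc ⟶ Z i.succ) :
    initObj Z (Fin.last n) ⟶ Z (Fin.last (n + 1)) :=
  a (Fin.last n)

/-- The last morphism `aₙ : Zₙ ⟶ Zₙ₊₁` of a string, as the morphism from the last object to the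
first object of the tuple `(Zₙ₊₁, Z₀, …, Zₙ)`. -/
def rotHead {n : ℕ} {Z : Fin (n + 2) → C} (a : ∀ i : Fin (n + 1), Z i.castSucc ⟶ Z i.succ) :
    rotObj Z (Fin.last (n + 1)) ⟶ rotObj Z 0 :=
  a (Fin.last n)

theorem tailArrow_update_zero {n : ℕ} {Z : Fin (n + 2) → C}
    (a : ∀ i : Fin (n + 1), Z i.castSucc ⟶ Z i.succ) (v) :
    tailArrow (Function.update a 0 v) = tailArrow a :=
  funext fun j => Function.update_of_ne (Fin.succ_ne_zero j) v a

theorem tailArrow_update_succ {n : ℕ} {Z : Fin (n + 2) → C}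
    (a : ∀ i : Fin (n + 1), Z i.castSucc ⟶ Z i.succ) (k : Fin n)
    (v : tailObj Z k.castSucc ⟶ tailObj Z k.succ) :
    tailArrow (Function.update a k.succ v) = Function.update (tailArrow a) k v := by
  funext j
  by_cases hj : j = k
  · subst hj
    rw [Function.update_self]
    exact Function.update_self j.succ v a
  · rw [Function.update_of_ne hj]
    exact Function.update_of_ne (fun h => hj (Fin.succ_injective _ h)) v a

theorem initArrow_update_last {n : ℕ} {Z : Fin (n + 2) → C}
    (a : ∀ i : Fin (n + 1), Z i.castSucc ⟶ Z i.succ) (v) :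
    initArrow (Function.update a (Fin.last n) v) = initArrow a := by
  funext j
  have h := Function.update_of_ne (Fin.castSucc_lt_last j).ne v a
  exact h

theorem initArrow_update_castSucc {n : ℕ} {Z : Fin (n + 2) → C}
    (a : ∀ i : Fin (n + 1), Z i.castSucc ⟶ Z i.succ) (k : Fin n)
    (v : initObj Z k.castSucc ⟶ initObj Z k.succ) :
    initArrow (Function.update a k.castSucc v) = Function.update (initArrow a) k v := by
  funext j
  by_cases hj : j = k
  · subst hj
    rw [Function.update_self]
    exact Function.update_self j.castSucc v a
  · rw [Function.update_of_ne hj]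
    exact Function.update_of_ne (fun h => hj (Fin.castSucc_injective _ h)) v a

theorem firstArrow_update_zero {n : ℕ} {Z : Fin (n + 2) → C}
    (a : ∀ i : Fin (n + 1), Z i.castSucc ⟶ Z i.succ) (v) :
    firstArrow (Function.update a 0 v) = v := by
  have h := Function.update_self 0 v a
  exact h

theorem lastArrow_update_last {n : ℕ} {Z : Fin (n + 2) → C}
    (a : ∀ i : Fin (n + 1), Z i.castSucc ⟶ Z i.succ) (v) :
    lastArrow (Function.update a (Fin.last n) v) = v := by
  have h := Function.update_self (Fin.last n) v a
  exact h

theorem lastArrow_update_castSucc {n : ℕ} {Z : Fin (n + 2) → C}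
    (a : ∀ i : Fin (n + 1), Z i.castSucc ⟶ Z i.succ) (k : Fin n) (v) :
    lastArrow (Function.update a k.castSucc v) = lastArrow a := by
  have h := Function.update_of_ne (Fin.castSucc_lt_last k).ne' v a
  exact h

theorem rotArrow_update_last {n : ℕ} {Z : Fin (n + 2) → C} (m : Z (Fin.last (n + 1)) ⟶ Z 0)
    (a : ∀ i : Fin (n + 1), Z i.castSucc ⟶ Z i.succ) (v) :
    rotArrow m (Function.update a (Fin.last n) v) = rotArrow m a := by
  funext j
  cases j using Fin.cases with
  | zero => rfl
  | succ j => exact congrFun (initArrow_update_last a v) j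

theorem rotArrow_update_castSucc {n : ℕ} {Z : Fin (n + 2) → C} (m : Z (Fin.last (n + 1)) ⟶ Z 0)
    (a : ∀ i : Fin (n + 1), Z i.castSucc ⟶ Z i.succ) (k : Fin n)
    (v : rotObj Z k.succ.castSucc ⟶ rotObj Z k.succ.succ) :
    rotArrow m (Function.update a k.castSucc v) = Function.update (rotArrow m a) k.succ v := by
  funext j
  cases j using Fin.cases with
  | zero => rw [Function.update_of_ne (Fin.succ_ne_zero k).symm]; rfl
  | succ j =>
    have h : rotArrow m (Function.update a k.castSucc v) j.succ =
        Function.update (initArrow a) k v j := congrFun (initArrow_update_castSucc a k v) j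
    rw [h]
    by_cases hj : j = k
    · subst hj
      rw [Function.update_self]
      exact Function.update_self j _ _
    · rw [Function.update_of_ne (fun h => hj (Fin.succ_injective _ h))]
      exact Function.update_of_ne hj _ _

theorem rotArrow_eq_update {n : ℕ} {Z : Fin (n + 2) → C} (m' : Z (Fin.last (n + 1)) ⟶ Z 0)
    (a : ∀ i : Fin (n + 1), Z i.castSucc ⟶ Z i.succ)
    (m : rotObj Z (Fin.castSucc 0) ⟶ rotObj Z (Fin.succ 0)) :
    rotArrow m a = Function.update (rotArrow m' a) 0 m := by
  funext j
  cases j using Fin.cases with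
  | zero => rw [Function.update_self]; rfl
  | succ j => rw [Function.update_of_ne (Fin.succ_ne_zero j)]; rfl

theorem val_succAbove {n : ℕ} (p : Fin (n + 1)) (j : Fin n) :
    (p.succAbove j).val = if j.val < p.val then j.val else j.val + 1 := by
  rw [Fin.succAbove]
  split_ifs <;> simp_all [Fin.lt_def]

theorem val_predAbove {n : ℕ} (i : Fin n) (k : Fin (n + 1)) :
    (i.predAbove k).val = if i.val < k.val then k.val - 1 else k.val := by
  have h : i.castSucc < k ↔ i.val < k.val := Iff.rfl
  rw [Fin.predAbove]
  split_ifs <;> simp_all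

/-- The tuple `(Z₀, …, Zₙ₊₁)` with the inner vertex `Zᵢ₊₁` omitted. -/
def mergeObj {n : ℕ} (Z : Fin (n + 2) → C) (i : Fin n) : Fin (n + 1) → C :=
  fun j => Z (i.castSucc.succ.succAbove j)

/-- The string `(a₀, …, aᵢ aᵢ₊₁, …, aₙ)`, obtained by composing at the inner vertex `Zᵢ₊₁`. -/
noncomputable def mergeArrow {n : ℕ} {Z : Fin (n + 2) → C} (i : Fin n)
    (a : ∀ j : Fin (n + 1), Z j.castSucc ⟶ Z j.succ) :
    ∀ j : Fin n, mergeObj Z i j.castSucc ⟶ mergeObj Z i j.succ :=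
  fun j => pathHom Z a ((Fin.strictMono_succAbove i.castSucc.succ).monotone
    (Fin.castSucc_lt_succ (i := j)).le)

theorem mergeArrow_update {n : ℕ} {Z : Fin (n + 2) → C} (i : Fin n)
    (a : ∀ j : Fin (n + 1), Z j.castSucc ⟶ Z j.succ) (k : Fin (n + 1)) :
    ∃ (l : Fin n)
      (L : (Z k.castSucc ⟶ Z k.succ) →ₗ[K] (mergeObj Z i l.castSucc ⟶ mergeObj Z i l.succ)),
      ∀ v, mergeArrow i (Function.update a k v) = Function.update (mergeArrow i a) l (L v) := by
  have h₁ := val_succAbove i.castSucc.succ (i.predAbove k).castSucc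
  have h₂ := val_succAbove i.castSucc.succ (i.predAbove k).succ
  have h₃ := val_predAbove i k
  simp only [Fin.val_castSucc, Fin.val_succ] at h₁ h₂
  have hx : i.castSucc.succ.succAbove (i.predAbove k).castSucc ≤ k.castSucc := by
    rw [Fin.le_def, Fin.val_castSucc, h₁, h₃]
    split_ifs <;> omega
  have hy : k.succ ≤ i.castSucc.succ.succAbove (i.predAbove k).succ := by
    rw [Fin.le_def, Fin.val_succ, h₂, h₃]
    split_ifs <;> omega
  refine ⟨i.predAbove k, (Linear.leftComp K _ (pathHom Z a hx)).comp
    (Linear.rightComp K _ (pathHom Z a hy)), fun v => funext fun j => ?_⟩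
  by_cases hj : j = i.predAbove k
  · subst hj
    rw [Function.update_self]
    exact pathHom_update Z a _ k hx hy v
  · rw [Function.update_of_ne hj]
    refine pathHom_congr Z _ _ _ fun l hl hl' => Function.update_of_ne ?_ _ _
    rintro rfl
    apply hj
    rw [Fin.le_def, val_succAbove] at hl hl'
    simp only [Fin.val_castSucc, Fin.val_succ] at hl hl'
    rw [Fin.ext_iff, h₃]
    split_ifs at hl hl' ⊢ <;> omega

theorem mergeObj_zero {n : ℕ} (Z : Fin (n + 2) → C) (i : Fin n) : mergeObj Z i 0 = Z 0 := by
  have h : i.castSucc.succ.succAbove 0 = 0 := Fin.ext (by rw [val_succAbove]; simp)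
  rw [mergeObj, h]

theorem mergeObj_last {n : ℕ} (Z : Fin (n + 2) → C) (i : Fin n) :
    mergeObj Z i (Fin.last n) = Z (Fin.last (n + 1)) := by
  have h : i.castSucc.succ.succAbove (Fin.last n) = Fin.last (n + 1) :=
    Fin.ext (by
      have := i.2
      rw [val_succAbove]
      simp only [Fin.val_last, Fin.val_succ, Fin.val_castSucc]
      split_ifs <;> omega)
  rw [mergeObj, h]

end Nerve

/-! ## Parity projections and signs -/

section Signs

variable (K : Type u) [Field K] {C : Type u} [Category.{u} C] [Preadditive C] [Linear K C]
  [SuperCategory K C]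

theorem isCompl_deg (X Y : C) (q : ZMod 2) :
    IsCompl (SuperCategory.deg (K := K) X Y q) (SuperCategory.deg X Y (q + 1)) := by
  have h := SuperCategory.isCompl (K := K) X Y
  fin_cases q
  · exact h
  · exact h.symm

/-- The projection `f ↦ f_q` of a morphism onto its component of parity `q`. -/
noncomputable def proj (q : ZMod 2) (X Y : C) : (X ⟶ Y) →ₗ[K] (X ⟶ Y) :=
  Submodule.projection _ _ (isCompl_deg K X Y q)

/-- The sign operator `f ↦ (-1)^{q|f|} f`. -/
noncomputable def signMap (q : ZMod 2) (X Y : C) : (X ⟶ Y) →ₗ[K] (X ⟶ Y) :=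
  proj K 0 X Y + ((-1 : K) ^ q.val) • proj K 1 X Y

end Signs

/-! ## Subquotients -/

/-- The quotient `Z / (B ∩ Z)` of submodules of a module. -/
abbrev Subquotient {K : Type u} [Field K] {V : Type u} [AddCommGroup V] [Module K V]
    (Z B : Submodule K V) : Type u :=
  ↥Z ⧸ B.submoduleOf Z

/-! ## Hochschild homology -/

section Homology

variable (K : Type u) [Field K] (C : Type u) [Category.{u} C] [Preadditive C] [Linear K C]
  [SuperCategory K C]

/-- The Hochschild chains of degree `n` with coefficients in the standard bimodule: the direct sum
over tuples `(Z₀, …, Zₙ)` of `C(Zₙ, Z₀) ⊗ C(Z₀, Z₁) ⊗ ⋯ ⊗ C(Zₙ₋₁, Zₙ)`. -/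
abbrev Chain (n : ℕ) : Type u :=
  ⨁ Z : Fin (n + 1) → C, (Z (Fin.last n) ⟶ Z 0) ⊗[K] Nerve K Z

open scoped Classical in
/-- The chain `(a₀, a₁, …, aₙ) = a₀ ⊗ a₁ ⊗ ⋯ ⊗ aₙ`, with `a₀` written as `m` and the tuple
`(a₁, …, aₙ)` as `a`. -/
noncomputable def Chain.mk {n : ℕ} (Z : Fin (n + 1) → C) (m : Z (Fin.last n) ⟶ Z 0)
    (a : ∀ i : Fin n, Z i.castSucc ⟶ Z i.succ) : Chain K C n :=
  DirectSum.lof K (Fin (n + 1) → C) (fun Z => (Z (Fin.last n) ⟶ Z 0) ⊗[K] Nerve K Z) Z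
    (m ⊗ₜ[K] PiTensorProduct.tprod K a)

open scoped Classical in
/-- `(a₀, …, aₙ)` as a linear function of `a₀`. -/
noncomputable def Chain.mkHead {n : ℕ} (Z : Fin (n + 1) → C)
    (a : ∀ i : Fin n, Z i.castSucc ⟶ Z i.succ) : (Z (Fin.last n) ⟶ Z 0) →ₗ[K] Chain K C n :=
  DirectSum.lof K (Fin (n + 1) → C) (fun Z => (Z (Fin.last n) ⟶ Z 0) ⊗[K] Nerve K Z) Z ∘ₗ
    (TensorProduct.mk K _ _).flip (PiTensorProduct.tprod K a)

open scoped Classical in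
/-- `(a₀, …, aₙ)` as a linear function of one of `a₁, …, aₙ`. -/
noncomputable def Chain.mkArrow {n : ℕ} (Z : Fin (n + 1) → C) (m : Z (Fin.last n) ⟶ Z 0)
    (a : ∀ i : Fin n, Z i.castSucc ⟶ Z i.succ) (k : Fin n) :
    (Z k.castSucc ⟶ Z k.succ) →ₗ[K] Chain K C n :=
  DirectSum.lof K (Fin (n + 1) → C) (fun Z => (Z (Fin.last n) ⟶ Z 0) ⊗[K] Nerve K Z) Z ∘ₗ
    TensorProduct.mk K _ _ m ∘ₗ (PiTensorProduct.tprod K).toLinearMap a k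

theorem Chain.mkHead_apply {n : ℕ} (Z : Fin (n + 1) → C)
    (a : ∀ i : Fin n, Z i.castSucc ⟶ Z i.succ) (m : Z (Fin.last n) ⟶ Z 0) :
    Chain.mkHead K C Z a m = Chain.mk K C Z m a :=
  rfl

theorem Chain.mkArrow_apply {n : ℕ} (Z : Fin (n + 1) → C) (m : Z (Fin.last n) ⟶ Z 0)
    (a : ∀ i : Fin n, Z i.castSucc ⟶ Z i.succ) (k : Fin n) (v : Z k.castSucc ⟶ Z k.succ) :
    Chain.mkArrow K C Z m a k v = Chain.mk K C Z m (Function.update a k v) :=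
  rfl

open scoped Classical in
/-- The linear map on chains with prescribed values `f Z a₀ (a₁, …, aₙ)` on the `(a₀, …, aₙ)`,
for `f` linear in each variable. -/
noncomputable def Chain.lift {n : ℕ} {W : Type u} [AddCommGroup W] [Module K W]
    (f : ∀ Z : Fin (n + 1) → C, (Z (Fin.last n) ⟶ Z 0) →
      (∀ i : Fin n, Z i.castSucc ⟶ Z i.succ) → W)
    (hm : ∀ Z a, ∃ L : (Z (Fin.last n) ⟶ Z 0) →ₗ[K] W, ∀ m, f Z m a = L m)
    (ha : ∀ Z m a k, ∃ L : (Z (Fin.castSucc k) ⟶ Z k.succ) →ₗ[K] W,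
      ∀ v, f Z m (Function.update a k v) = L v) :
    Chain K C n →ₗ[K] W :=
  DirectSum.toModule K (Fin (n + 1) → C) W fun Z => TensorProduct.lift
    { toFun := fun m => PiTensorProduct.lift (mkMultilinear K (f Z m) (ha Z m))
      map_add' := fun m m' => PiTensorProduct.ext <| MultilinearMap.ext fun a => by
        obtain ⟨L, hL⟩ := hm Z a
        simp only [LinearMap.compMultilinearMap_apply, LinearMap.add_apply,
          PiTensorProduct.lift.tprod]
        change f Z (m + m') a = f Z m a + f Z m' a
        rw [hL, hL, hL, map_add]
      map_smul' := fun c m => PiTensorProduct.ext <| MultilinearMap.ext fun a => by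
        obtain ⟨L, hL⟩ := hm Z a
        simp only [LinearMap.compMultilinearMap_apply, LinearMap.smul_apply, RingHom.id_apply,
          PiTensorProduct.lift.tprod]
        change f Z (c • m) a = c • f Z m a
        rw [hL, hL, map_smul] }

theorem Chain.lift_mk {n : ℕ} {W : Type u} [AddCommGroup W] [Module K W]
    (f : ∀ Z : Fin (n + 1) → C, (Z (Fin.last n) ⟶ Z 0) →
      (∀ i : Fin n, Z i.castSucc ⟶ Z i.succ) → W) (hm) (ha)
    (Z : Fin (n + 1) → C) (m : Z (Fin.last n) ⟶ Z 0) (a : ∀ i : Fin n, Z i.castSucc ⟶ Z i.succ) :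
    Chain.lift K C f hm ha (Chain.mk K C Z m a) = f Z m a := by
  rw [Chain.lift, Chain.mk, DirectSum.toModule_lof, TensorProduct.lift.tmul]
  exact PiTensorProduct.lift.tprod a

/-- The chains of parity `p`: the span of the `a₀ ⊗ ⋯ ⊗ aₙ` with all `aᵢ` homogeneous and
`|a₀| + ⋯ + |aₙ| = p`. -/
def chainPart (n : ℕ) (p : ZMod 2) : Submodule K (Chain K C n) :=
  Submodule.span K {x | ∃ (Z : Fin (n + 1) → C) (m : Z (Fin.last n) ⟶ Z 0)
    (a : ∀ i : Fin n, Z i.castSucc ⟶ Z i.succ) (q : ZMod 2) (ε : Fin n → ZMod 2),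
    m ∈ SuperCategory.deg (K := K) (Z (Fin.last n)) (Z 0) q ∧
    (∀ i, a i ∈ SuperCategory.deg (K := K) (Z i.castSucc) (Z i.succ) (ε i)) ∧
    q + ∑ i, ε i = p ∧ x = Chain.mk K C Z m a}

/-- `d⁰ (a₀, …, aₙ₊₁) = (a₀ a₁, a₂, …, aₙ₊₁)`. -/
noncomputable def faceZero (n : ℕ) : Chain K C (n + 1) →ₗ[K] Chain K C n :=
  Chain.lift K C (fun Z m a => Chain.mk K C (tailObj Z) (tailHead m a) (tailArrow a))
    (fun Z a => ⟨Chain.mkHead K C (tailObj Z) (tailArrow a) ∘ₗ Linear.rightComp K _ (a 0),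
      fun _ => rfl⟩)
    (fun Z m a k => by
      cases k using Fin.cases with
      | zero =>
        exact ⟨Chain.mkHead K C (tailObj Z) (tailArrow a) ∘ₗ Linear.leftComp K _ m, fun v =>
          congrArg₂ (Chain.mk K C (tailObj Z))
            (congrArg (fun b : Z 0 ⟶ Z 1 => m ≫ b) (Function.update_self 0 v a))
            (tailArrow_update_zero a v)⟩
      | succ k =>
        exact ⟨Chain.mkArrow K C (tailObj Z) (tailHead m a) (tailArrow a) k, fun v =>
          congrArg₂ (Chain.mk K C (tailObj Z))
            (congrArg (fun b : Z 0 ⟶ Z 1 => m ≫ b)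
              (Function.update_of_ne (Fin.succ_ne_zero k).symm v a))
            (tailArrow_update_succ a k v)⟩)

/-- `dⁱ⁺¹ (a₀, …, aₙ₊₁) = (a₀, …, aᵢ₊₁ aᵢ₊₂, …, aₙ₊₁)` for `0 ≤ i < n`. -/
noncomputable def faceInner (n : ℕ) (i : Fin n) : Chain K C (n + 1) →ₗ[K] Chain K C n :=
  Chain.lift K C (fun Z m a => Chain.mk K C (mergeObj Z i)
      (eqToHom (mergeObj_last Z i) ≫ m ≫ eqToHom (mergeObj_zero Z i).symm) (mergeArrow i a))
    (fun Z a => ⟨Chain.mkHead K C (mergeObj Z i) (mergeArrow i a) ∘ₗ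
      Linear.leftComp K _ (eqToHom (mergeObj_last Z i)) ∘ₗ
        Linear.rightComp K _ (eqToHom (mergeObj_zero Z i).symm), fun _ => rfl⟩)
    (fun Z m a k => by
      obtain ⟨l, L, hL⟩ := mergeArrow_update K i a k
      exact ⟨Chain.mkArrow K C (mergeObj Z i) _ (mergeArrow i a) l ∘ₗ L, fun v => by
        rw [hL]; rfl⟩)

/-- The rotation
`(a₀, …, aₙ₊₁) ↦ (-1)^{|aₙ₊₁| (|a₀| + ⋯ + |aₙ|)} (aₙ₊₁, a₀, …, aₙ)`,
written as a sum over the parities `q` of the components of `aₙ₊₁`. -/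
noncomputable def rotate (n : ℕ) : Chain K C (n + 1) →ₗ[K] Chain K C (n + 1) :=
  Chain.lift K C (fun Z m a => ∑ q : ZMod 2, Chain.mk K C (rotObj Z)
      (proj K q _ _ (rotHead a))
      (rotArrow (signMap K q _ _ m) fun i => signMap K q _ _ (a i)))
    (fun Z a => by
      refine ⟨∑ q : ZMod 2, Chain.mkArrow K C (rotObj Z) (proj K q _ _ (rotHead a))
        (rotArrow 0 fun i => signMap K q _ _ (a i)) 0 ∘ₗ signMap K q _ _, fun m => ?_⟩
      rw [LinearMap.sum_apply]
      exact Finset.sum_congr rfl fun q _ => congrArg _ (rotArrow_eq_update 0 _ _))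
    (fun Z m a k => by
      have hu : ∀ (q : ZMod 2) (v), (fun i => signMap K q _ _ (Function.update a k v i)) =
          Function.update (fun i => signMap K q _ _ (a i)) k (signMap K q _ _ v) := by
        intro q v
        funext i
        by_cases hi : i = k
        · subst hi; simp only [Function.update_self]
        · simp only [Function.update_of_ne hi]
      cases k using Fin.lastCases with
      | last =>
        refine ⟨∑ q : ZMod 2, Chain.mkHead K C (rotObj Z)
          (rotArrow (signMap K q _ _ m) fun i => signMap K q _ _ (a i)) ∘ₗ proj K q _ _,
          fun v => ?_⟩
        rw [LinearMap.sum_apply]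
        refine Finset.sum_congr rfl fun q _ => ?_
        rw [hu, rotArrow_update_last]
        exact congrArg (fun b => Chain.mk K C (rotObj Z) (proj K q _ _ b) _)
          (lastArrow_update_last a v)
      | cast k =>
        refine ⟨∑ q : ZMod 2, Chain.mkArrow K C (rotObj Z) (proj K q _ _ (rotHead a))
          (rotArrow (signMap K q _ _ m) fun i => signMap K q _ _ (a i)) k.succ ∘ₗ
            signMap K q _ _, fun v => ?_⟩
        rw [LinearMap.sum_apply]
        refine Finset.sum_congr rfl fun q _ => ?_
        rw [hu]
        exact congrArg₂ (Chain.mk K C (rotObj Z))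
          (congrArg (fun b => proj K q _ _ b) (lastArrow_update_castSucc a k v))
          (rotArrow_update_castSucc _ _ k _))

/-- `dⁿ⁺¹ (a₀, …, aₙ₊₁) = (-1)^{|aₙ₊₁| (|a₀| + ⋯ + |aₙ|)} (aₙ₊₁ a₀, a₁, …, aₙ)`. -/
noncomputable def faceLast (n : ℕ) : Chain K C (n + 1) →ₗ[K] Chain K C n :=
  faceZero K C n ∘ₗ rotate K C n

/-- `∂' = ∑_{i=0}^{n} (-1)ⁱ dⁱ` on chains of degree `n + 1` (the last face is left out). -/
noncomputable def barBoundary (n : ℕ) : Chain K C (n + 1) →ₗ[K] Chain K C n :=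
  faceZero K C n + ∑ i : Fin n, ((-1 : K) ^ (i.val + 1)) • faceInner K C n i

/-- The Hochschild boundary `∂ = ∑_{i=0}^{n+1} (-1)ⁱ dⁱ` on chains of degree `n + 1`. -/
noncomputable def boundary (n : ℕ) : Chain K C (n + 1) →ₗ[K] Chain K C n :=
  barBoundary K C n + ((-1 : K) ^ (n + 1)) • faceLast K C n

/-- The Hochschild cycles of degree `n` and parity `p`. -/
noncomputable def cycles (p : ZMod 2) : ∀ n : ℕ, Submodule K (Chain K C n)
  | 0 => chainPart K C 0 p
  | n + 1 => chainPart K C (n + 1) p ⊓ LinearMap.ker (boundary K C n)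

/-- The parity `p` component `HHₙ(C)_p` of the Hochschild homology superspace
`HHₙ(C) = HHₙ(C, C)`. -/
abbrev HochschildHomology (n : ℕ) (p : ZMod 2) : Type u :=
  Subquotient (cycles K C p n) ((chainPart K C (n + 1) p).map (boundary K C n))

/-! ## Cyclic homology and cohomology -/

/-- The cyclic operator
`tₙ (a₀, …, aₙ) = (-1)^{n + |aₙ| (|a₀| + ⋯ + |aₙ₋₁|)} (aₙ, a₀, …, aₙ₋₁)`. -/
noncomputable def cyclicOp : ∀ n : ℕ, Chain K C n →ₗ[K] Chain K C n
  | 0 => LinearMap.id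
  | n + 1 => ((-1 : K) ^ (n + 1)) • rotate K C n

/-- The norm operator `Nₙ = 1 + tₙ + ⋯ + tₙⁿ`. -/
noncomputable def normOp (n : ℕ) : Chain K C n →ₗ[K] Chain K C n :=
  ∑ i ∈ Finset.range (n + 1), (cyclicOp K C n ^ i : Module.End K (Chain K C n))

/-- The vertical differential `CC_{p,q+1} → CC_{p,q}` of the cyclic bicomplex: `∂` in the even
columns and `-∂'` in the odd columns. -/
noncomputable def vertical (p q : ℕ) : Chain K C (q + 1) →ₗ[K] Chain K C q :=
  if Even p then boundary K C q else -barBoundary K C q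

/-- The horizontal differential `CC_{p,q} → CC_{p-1,q}`, `p ≥ 1`, of the cyclic bicomplex: `1 - t`
from the odd columns and `N` from the even columns. -/
noncomputable def horizontal (p q : ℕ) : Chain K C q →ₗ[K] Chain K C q :=
  if Even p then normOp K C q else LinearMap.id - cyclicOp K C q

/-- The total complex `Tot CC(C)ₙ = ⨁_{p+q=n} CC_{p,q}` with `CC_{p,q}` the chains of degree `q`;
the summands are indexed by `q`. -/
abbrev Tot (n : ℕ) : Type u :=
  ∀ q : Fin (n + 1), Chain K C q.val

/-- The elements of parity `p` of the total complex. -/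
def totPart (n : ℕ) (p : ZMod 2) : Submodule K (Tot K C n) :=
  Submodule.pi Set.univ fun q : Fin (n + 1) => chainPart K C q.val p

/-- The differential of the total complex: its component in `CC_{n-q,q}` is the sum of the vertical
differential out of `CC_{n-q,q+1}` and the horizontal one out of `CC_{n+1-q,q}`. -/
noncomputable def totBoundary (n : ℕ) : Tot K C (n + 1) →ₗ[K] Tot K C n :=
  LinearMap.pi fun q : Fin (n + 1) =>
    vertical K C (n - q.val) q.val ∘ₗ
        (LinearMap.proj q.succ : Tot K C (n + 1) →ₗ[K] Chain K C (q.val + 1)) +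
      horizontal K C (n + 1 - q.val) q.val ∘ₗ
        (LinearMap.proj q.castSucc : Tot K C (n + 1) →ₗ[K] Chain K C q.val)

/-- The cycles of degree `n` and parity `p` of the total complex. -/
noncomputable def cyclicCycles (p : ZMod 2) : ∀ n : ℕ, Submodule K (Tot K C n)
  | 0 => totPart K C 0 p
  | n + 1 => totPart K C (n + 1) p ⊓ LinearMap.ker (totBoundary K C n)

/-- The parity `p` component `HCₙ(C)_p` of the cyclic homology superspace `HCₙ(C)`. -/
abbrev CyclicHomology (n : ℕ) (p : ZMod 2) : Type u :=
  Subquotient (cyclicCycles K C p n) ((totPart K C (n + 1) p).map (totBoundary K C n))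

/-- The linear forms of parity `p` on the total complex: those vanishing on elements of parity
`p + 1`, where `K` is even. -/
def cototPart (n : ℕ) (p : ZMod 2) : Submodule K (Module.Dual K (Tot K C n)) :=
  (totPart K C n (p + 1)).dualAnnihilator

/-- The coboundaries of degree `n` and parity `p` of the dual of the total complex. -/
noncomputable def cyclicCoboundaries (p : ZMod 2) :
    ∀ n : ℕ, Submodule K (Module.Dual K (Tot K C n))
  | 0 => ⊥
  | n + 1 => (cototPart K C n p).map (totBoundary K C n).dualMap

/-- The parity `p` component `HCⁿ(C)_p` of the cyclic cohomology superspace `HCⁿ(C)`, the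
cohomology of the `K`-linear dual of the total complex of the cyclic bicomplex. -/
abbrev CyclicCohomology (n : ℕ) (p : ZMod 2) : Type u :=
  Subquotient (cototPart K C n p ⊓ LinearMap.ker (totBoundary K C n).dualMap)
    (cyclicCoboundaries K C p n)

end Homology

/-! ## Hochschild cohomology -/

section Cohomology

variable (K : Type u) [Field K] (C : Type u) [Category.{u} C] [Preadditive C] [Linear K C]
  [SuperCategory K C]

/-- The Hochschild cochains of degree `n` with coefficients in the standard bimodule: the product
over tuples `(Z₀, …, Zₙ)` of `Hom_K (C(Z₀, Z₁) ⊗ ⋯ ⊗ C(Zₙ₋₁, Zₙ), C(Z₀, Zₙ))`. -/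
abbrev Cochain (n : ℕ) : Type u :=
  ∀ Z : Fin (n + 1) → C, Nerve K Z →ₗ[K] (Z 0 ⟶ Z (Fin.last n))

/-- The value `φ(a₁, …, aₙ)` of a cochain. -/
noncomputable def Cochain.eval {n : ℕ} (φ : Cochain K C n) (Z : Fin (n + 1) → C)
    (a : ∀ i : Fin n, Z i.castSucc ⟶ Z i.succ) : Z 0 ⟶ Z (Fin.last n) :=
  φ Z (PiTensorProduct.tprod K a)

/-- The cochains of parity `p`: they send homogeneous `(a₁, …, aₙ)` to elements of parity
`p + |a₁| + ⋯ + |aₙ|`. -/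
def cochainPart (n : ℕ) (p : ZMod 2) : Submodule K (Cochain K C n) where
  carrier := {φ | ∀ (Z : Fin (n + 1) → C) (a : ∀ i : Fin n, Z i.castSucc ⟶ Z i.succ)
    (ε : Fin n → ZMod 2),
    (∀ i, a i ∈ SuperCategory.deg (K := K) (Z i.castSucc) (Z i.succ) (ε i)) →
      Cochain.eval K C φ Z a ∈
        SuperCategory.deg (K := K) (Z 0) (Z (Fin.last n)) (p + ∑ i, ε i)}
  add_mem' hφ hψ Z a ε h := add_mem (hφ Z a ε h) (hψ Z a ε h)
  zero_mem' _ _ _ _ := zero_mem _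
  smul_mem' c _ hφ Z a ε h := Submodule.smul_mem _ c (hφ Z a ε h)

/-- `φ(a₁, …, aₙ)` as a linear function of one of `a₁, …, aₙ`. -/
noncomputable def Cochain.evalArrow {n : ℕ} (φ : Cochain K C n) (Z : Fin (n + 1) → C)
    (a : ∀ i : Fin n, Z i.castSucc ⟶ Z i.succ) (k : Fin n) :
    (Z k.castSucc ⟶ Z k.succ) →ₗ[K] (Z 0 ⟶ Z (Fin.last n)) :=
  φ Z ∘ₗ (PiTensorProduct.tprod K).toLinearMap a k

/-- The linear map from `n`-cochains to `n'`-cochains with prescribed values `f φ Z a`, for `f`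
linear in each variable. -/
noncomputable def Cochain.lift {n n' : ℕ}
    (f : Cochain K C n → ∀ Z : Fin (n' + 1) → C,
      (∀ i : Fin n', Z i.castSucc ⟶ Z i.succ) → (Z 0 ⟶ Z (Fin.last n')))
    (hadd : ∀ φ ψ Z a, f (φ + ψ) Z a = f φ Z a + f ψ Z a)
    (hsmul : ∀ (c : K) φ Z a, f (c • φ) Z a = c • f φ Z a)
    (ha : ∀ φ Z a k, ∃ L : (Z (Fin.castSucc k) ⟶ Z k.succ) →ₗ[K] (Z 0 ⟶ Z (Fin.last n')),
      ∀ v, f φ Z (Function.update a k v) = L v) :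
    Cochain K C n →ₗ[K] Cochain K C n' where
  toFun φ Z := PiTensorProduct.lift (mkMultilinear K (f φ Z) (ha φ Z))
  map_add' φ ψ := funext fun Z => PiTensorProduct.ext <| MultilinearMap.ext fun a => by
    simp only [LinearMap.compMultilinearMap_apply, Pi.add_apply, LinearMap.add_apply,
      PiTensorProduct.lift.tprod]
    exact hadd φ ψ Z a
  map_smul' c φ := funext fun Z => PiTensorProduct.ext <| MultilinearMap.ext fun a => by
    simp only [LinearMap.compMultilinearMap_apply, Pi.smul_apply, LinearMap.smul_apply,
      PiTensorProduct.lift.tprod, RingHom.id_apply]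
    exact hsmul c φ Z a

theorem Cochain.lift_eval {n n' : ℕ}
    (f : Cochain K C n → ∀ Z : Fin (n' + 1) → C,
      (∀ i : Fin n', Z i.castSucc ⟶ Z i.succ) → (Z 0 ⟶ Z (Fin.last n'))) (hadd) (hsmul) (ha)
    (φ : Cochain K C n) (Z : Fin (n' + 1) → C) (a : ∀ i : Fin n', Z i.castSucc ⟶ Z i.succ) :
    Cochain.eval K C (Cochain.lift K C f hadd hsmul ha φ) Z a = f φ Z a :=
  PiTensorProduct.lift.tprod a

/-- `(d⁰φ)(a₁, …, aₙ₊₁) = (-1)^{|a₁| p} a₁ φ(a₂, …, aₙ₊₁)` for cochains `φ` of parity `p`. -/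
noncomputable def cofaceZero (p : ZMod 2) (n : ℕ) : Cochain K C n →ₗ[K] Cochain K C (n + 1) :=
  Cochain.lift K C (fun φ Z a =>
      signMap K p _ _ (firstArrow a) ≫ Cochain.eval K C φ (tailObj Z) (tailArrow a))
    (fun φ ψ Z a => Preadditive.comp_add _ _ _ _ _ _)
    (fun c φ Z a => Linear.comp_smul _ _ _ _ _ _)
    (fun φ Z a k => by
      cases k using Fin.cases with
      | zero =>
        exact ⟨Linear.rightComp K _ (Cochain.eval K C φ (tailObj Z) (tailArrow a)) ∘ₗ
          signMap K p (Z 0) (tailObj Z 0), fun v =>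
            congrArg₂ (fun b c => signMap K p (Z 0) (tailObj Z 0) b ≫
              Cochain.eval K C φ (tailObj Z) c)
              (firstArrow_update_zero a v) (tailArrow_update_zero a v)⟩
      | succ k =>
        exact ⟨Linear.leftComp K _ (signMap K p (Z 0) (tailObj Z 0) (firstArrow a)) ∘ₗ
          Cochain.evalArrow K C φ (tailObj Z) (tailArrow a) k, fun v =>
            congrArg₂ (fun b c => signMap K p (Z 0) (tailObj Z 0) b ≫
              Cochain.eval K C φ (tailObj Z) c)
              (Function.update_of_ne (Fin.succ_ne_zero k).symm v a)
              (tailArrow_update_succ a k v)⟩)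

/-- `(dⁱ⁺¹φ)(a₁, …, aₙ₊₁) = φ(a₁, …, aᵢ₊₁ aᵢ₊₂, …, aₙ₊₁)` for `0 ≤ i < n`. -/
noncomputable def cofaceInner (n : ℕ) (i : Fin n) :
    Cochain K C n →ₗ[K] Cochain K C (n + 1) :=
  Cochain.lift K C (fun φ Z a => eqToHom (mergeObj_zero Z i).symm ≫
      Cochain.eval K C φ (mergeObj Z i) (mergeArrow i a) ≫ eqToHom (mergeObj_last Z i))
    (fun φ ψ Z a => by
      have h : Cochain.eval K C (φ + ψ) (mergeObj Z i) (mergeArrow i a) =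
        Cochain.eval K C φ (mergeObj Z i) (mergeArrow i a) +
          Cochain.eval K C ψ (mergeObj Z i) (mergeArrow i a) := rfl
      rw [h, Preadditive.add_comp, Preadditive.comp_add])
    (fun c φ Z a => by
      have h : Cochain.eval K C (c • φ) (mergeObj Z i) (mergeArrow i a) =
        c • Cochain.eval K C φ (mergeObj Z i) (mergeArrow i a) := rfl
      rw [h, Linear.smul_comp, Linear.comp_smul])
    (fun φ Z a k => by
      obtain ⟨l, L, hL⟩ := mergeArrow_update K i a k
      exact ⟨Linear.leftComp K _ (eqToHom (mergeObj_zero Z i).symm) ∘ₗ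
        Linear.rightComp K _ (eqToHom (mergeObj_last Z i)) ∘ₗ
          Cochain.evalArrow K C φ (mergeObj Z i) (mergeArrow i a) l ∘ₗ L, fun v => by
            rw [hL]; rfl⟩)

/-- `(dⁿ⁺¹φ)(a₁, …, aₙ₊₁) = φ(a₁, …, aₙ) aₙ₊₁`. -/
noncomputable def cofaceLast (n : ℕ) : Cochain K C n →ₗ[K] Cochain K C (n + 1) :=
  Cochain.lift K C (fun φ Z a =>
      Cochain.eval K C φ (initObj Z) (initArrow a) ≫ lastArrow a)
    (fun φ ψ Z a => Preadditive.add_comp _ _ _ _ _ _)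
    (fun c φ Z a => Linear.smul_comp _ _ _ _ _ _)
    (fun φ Z a k => by
      cases k using Fin.lastCases with
      | last =>
        exact ⟨Linear.leftComp K _ (Cochain.eval K C φ (initObj Z) (initArrow a)), fun v =>
          congrArg₂ (fun b (c : initObj Z (Fin.last n) ⟶ Z (Fin.last (n + 1))) =>
            Cochain.eval K C φ (initObj Z) b ≫ c)
            (initArrow_update_last a v) (lastArrow_update_last a v)⟩
      | cast k =>
        exact ⟨Linear.rightComp K _ (lastArrow a) ∘ₗ
          Cochain.evalArrow K C φ (initObj Z) (initArrow a) k, fun v =>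
            congrArg₂ (fun b (c : initObj Z (Fin.last n) ⟶ Z (Fin.last (n + 1))) =>
              Cochain.eval K C φ (initObj Z) b ≫ c)
              (initArrow_update_castSucc a k v)
              (lastArrow_update_castSucc a k v)⟩)

/-- The Hochschild coboundary `∂φ = ∑_{i=0}^{n+1} (-1)ⁱ dⁱφ` on cochains `φ` of degree `n` and
parity `p`. -/
noncomputable def coboundary (p : ZMod 2) (n : ℕ) : Cochain K C n →ₗ[K] Cochain K C (n + 1) :=
  cofaceZero K C p n + ∑ i : Fin n, ((-1 : K) ^ (i.val + 1)) • cofaceInner K C n i +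
    ((-1 : K) ^ (n + 1)) • cofaceLast K C n

/-- The Hochschild coboundaries of degree `n` and parity `p`. -/
noncomputable def coboundaries (p : ZMod 2) : ∀ n : ℕ, Submodule K (Cochain K C n)
  | 0 => ⊥
  | n + 1 => (cochainPart K C n p).map (coboundary K C p n)

/-- The parity `p` component `HHⁿ(C)_p` of the Hochschild cohomology superspace
`HHⁿ(C) = HHⁿ(C, C)`. -/
abbrev HochschildCohomology (n : ℕ) (p : ZMod 2) : Type u :=
  Subquotient (cochainPart K C n p ⊓ LinearMap.ker (coboundary K C p n)) (coboundaries K C p n)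

end Cohomology

end SuperHochschild

/-!
Two graded Morita equivalent categories `C` and `D` embed fully in a common superadditive
category `E`. Its objects are those of `C` and `D`, standing for the graded `D`-modules `F(C(X, -))`
and `D(Y, -)`, and its morphisms are the natural transformations of all parities in the reverse
direction (`GrMod.Family`). By the Yoneda lemma and since `F` is an even equivalence, both inclusions
are fully faithful. Each of them generates `E`: every identity morphism of `E` is a finite sum of
composites `uv` of homogeneous morphisms of equal parity through objects of the image. For this one
divides a representable module by the images of all maps from the other modules; the quotient map
becomes zero under the equivalence, so the quotient is zero and the identity element is a finite
sum of values of such maps (`id_mem_through`, `GradedMoritaEquivalent.exists_fullInclusion`).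

It remains to see that a full inclusion `C → E` with generating image `S` induces isomorphisms. A
choice of factorisations of the identities gives elements `r Z` of `E(Z, S) ⊗ E(S, Z)` that compose
to `1`, and inserting them into strings of morphisms gives a homotopy `Bar.contr` on the bar
complex between the identity and an operator `Bar.retract` with values in strings through `S`
(`Bar.diff_contr`).

* Hochschild homology. Chains are closed strings (`closedEquiv`). The last face closes a string, and
  it does not distinguish between a morphism at the end of a string and at its beginning
  (`Closed.lastFace_rmul`). Since `Bar.contr` commutes with multiplication at both ends, appending
  an identity, contracting and closing up is a homotopy on closed strings (`Closed.bdry_contr_succ`).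
  Hence their complex is acyclic relative to the subcomplex of those through `S`
  (`Closed.relAcyclic_bdry`), and the latter is the Hochschild complex of `C`.
* Cyclic homology. The columns of the cyclic bicomplex are relatively acyclic, the odd ones because
  the bar complex has an explicit contraction by identities; so the total complex is
  (`RelAcyclic.tot`).
* Cyclic cohomology is the linear dual of cyclic homology, `K` being a field
  (`nonempty_cyclicCohomologyEquiv`); this uses that the total complex is a complex, whence the
  cyclic identities between the differentials.
* Hochschild cohomology. Restriction of cochains to `C` is surjective, and a cocycle that vanishes
  on `S` is the coboundary of a cochain that vanishes on `S`, by the dual homotopy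
  (`Cochain.VanishesOn.coboundary_contr`).
-/


namespace SuperHochschild

/-! ### Strings of morphisms -/

section Bar

variable (K : Type u) [Field K] {C : Type u} [Category.{u} C] [Preadditive C] [Linear K C]

/-- The recursion behind `Bar`. -/
noncomputable def barModule : ℕ → C → C → ModuleCat.{u} K
  | 0, X, Y => ModuleCat.of K (X ⟶ Y)
  | n + 1, X, Y => ModuleCat.of K (⨁ Z : C, (X ⟶ Z) ⊗[K] barModule n Z Y)

/-- The space of strings of `n + 1` composable morphisms from `X` to `Y`: the direct sum over
`(Z₁, …, Zₙ)` of `C(X, Z₁) ⊗ C(Z₁, Z₂) ⊗ ⋯ ⊗ C(Zₙ, Y)`, defined by recursion on the first letter. -/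
abbrev Bar (n : ℕ) (X Y : C) : Type u := barModule K n X Y

namespace Bar

/-- A morphism as a string of length one. -/
noncomputable def of {X Y : C} : (X ⟶ Y) ≃ₗ[K] Bar K 0 X Y := LinearEquiv.refl K (X ⟶ Y)

open scoped Classical in
/-- The string `a ⊗ w`. -/
noncomputable def cons {n : ℕ} {X Y Z : C} : (X ⟶ Z) →ₗ[K] Bar K n Z Y →ₗ[K] Bar K (n + 1) X Y :=
  (TensorProduct.mk K (X ⟶ Z) (Bar K n Z Y)).compr₂
    (DirectSum.lof K C (fun Z => (X ⟶ Z) ⊗[K] Bar K n Z Y) Z)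

variable {K}

open scoped Classical in
theorem hom_ext {n : ℕ} {X Y : C} {W : Type*} [AddCommGroup W] [Module K W]
    {f g : Bar K (n + 1) X Y →ₗ[K] W}
    (h : ∀ (Z : C) (a : X ⟶ Z) (w : Bar K n Z Y), f (cons K a w) = g (cons K a w)) : f = g := by
  refine DirectSum.linearMap_ext K (M := fun Z => (X ⟶ Z) ⊗[K] Bar K n Z Y) fun Z => ?_
  exact TensorProduct.ext' fun a w => h Z a w

@[elab_as_elim]
theorem induction_cons {n : ℕ} {X Y : C} {p : Bar K (n + 1) X Y → Prop} (w : Bar K (n + 1) X Y)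
    (cons : ∀ (Z : C) (a : X ⟶ Z) (w : Bar K n Z Y), p (cons K a w))
    (add : ∀ w w', p w → p w' → p (w + w')) : p w := by
  classical
  have hz : p 0 := by simpa using cons X 0 0
  refine DirectSum.induction_on (β := fun Z => (X ⟶ Z) ⊗[K] Bar K n Z Y) w hz (fun Z x => ?_) add
  induction x using TensorProduct.induction_on with
  | zero => rw [map_zero]; exact hz
  | tmul a w => exact cons Z a w
  | add x y hx hy => rw [map_add]; exact add _ _ hx hy

@[elab_as_elim]
theorem induction_of {X Y : C} {p : Bar K 0 X Y → Prop} (w : Bar K 0 X Y)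
    (of : ∀ a : X ⟶ Y, p (of K a)) : p w :=
  of ((Bar.of K).symm w)

open scoped Classical in
/-- The linear map on strings with prescribed values on the `a ⊗ w`. -/
noncomputable def lift {n : ℕ} {X Y : C} {W : Type*} [AddCommGroup W] [Module K W]
    (f : ∀ Z : C, (X ⟶ Z) →ₗ[K] Bar K n Z Y →ₗ[K] W) : Bar K (n + 1) X Y →ₗ[K] W :=
  DirectSum.toModule K C W fun Z => TensorProduct.lift (f Z)

@[simp]
theorem lift_cons {n : ℕ} {X Y Z : C} {W : Type*} [AddCommGroup W] [Module K W]
    (f : ∀ Z : C, (X ⟶ Z) →ₗ[K] Bar K n Z Y →ₗ[K] W) (a : X ⟶ Z) (w : Bar K n Z Y) :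
    lift f (cons K a w) = f Z a w := by
  classical
  refine (DirectSum.toModule_lof K (M := fun Z => (X ⟶ Z) ⊗[K] Bar K n Z Y) Z _).trans ?_
  exact TensorProduct.lift.tmul a w

/-! ### Multiplication at the ends -/

/-- Multiplication `c · (a ⊗ w) = ca ⊗ w` on the left. -/
noncomputable def lmul : ∀ (n : ℕ) {X' X Y : C}, (X' ⟶ X) →ₗ[K] Bar K n X Y →ₗ[K] Bar K n X' Y
  | 0, _, _, _ => (Linear.comp _ _ _ : _ →ₗ[K] _ →ₗ[K] _).compl₁₂ LinearMap.id
      (of K).symm.toLinearMap |>.compr₂ (of K).toLinearMap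
  | n + 1, _, _, _ => LinearMap.mk₂ K
      (fun c => lift fun _ => (cons K).comp (Linear.leftComp K _ c))
      (fun c c' w => by
        induction w using induction_cons with
        | cons Z a w => simp
        | add w w' h h' => rw [map_add, h, h', map_add, map_add]; abel)
      (fun r c w => by
        induction w using induction_cons with
        | cons Z a w => simp
        | add w w' h h' => rw [map_add, h, h', map_add, smul_add])
      (fun c w w' => map_add _ w w')
      (fun r c w => map_smul _ r w)

@[simp]
theorem lmul_of {X' X Y : C} (c : X' ⟶ X) (a : X ⟶ Y) :
    lmul 0 c (of K a) = of K (c ≫ a) := rfl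

@[simp]
theorem lmul_cons {n : ℕ} {X' X Y Z : C} (c : X' ⟶ X) (a : X ⟶ Z) (w : Bar K n Z Y) :
    lmul (n + 1) c (cons K a w) = cons K (c ≫ a) w :=
  lift_cons _ a w

theorem lmul_lmul (n : ℕ) {X'' X' X Y : C} (b : X'' ⟶ X') (c : X' ⟶ X) (w : Bar K n X Y) :
    lmul n b (lmul n c w) = lmul n (b ≫ c) w := by
  cases n with
  | zero =>
    induction w using induction_of; simp
  | succ n =>
    induction w using induction_cons with
    | add w w' h h' => simp only [map_add, h, h']
    | cons Z a w => simp

@[simp]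
theorem lmul_id (n : ℕ) {X Y : C} (w : Bar K n X Y) : lmul n (𝟙 X) w = w := by
  cases n with
  | zero =>
    induction w using induction_of; simp
  | succ n =>
    induction w using induction_cons with
    | add w w' h h' => simp only [map_add, h, h']
    | cons Z a w => simp

/-- Multiplication of the last letter of a string on the right. -/
noncomputable def rmul : ∀ (n : ℕ) {X Y Y' : C}, (Y ⟶ Y') → Bar K n X Y →ₗ[K] Bar K n X Y'
  | 0, _, _, _, c => (of K).toLinearMap ∘ₗ Linear.rightComp K _ c ∘ₗ (of K).symm.toLinearMap
  | n + 1, _, _, _, c => lift fun _ => (cons K).compl₂ (rmul n c)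

@[simp]
theorem rmul_of {X Y Y' : C} (a : X ⟶ Y) (c : Y ⟶ Y') : rmul 0 c (of K a) = of K (a ≫ c) := rfl

@[simp]
theorem rmul_cons {n : ℕ} {X Y Y' Z : C} (a : X ⟶ Z) (w : Bar K n Z Y) (c : Y ⟶ Y') :
    rmul (n + 1) c (cons K a w) = cons K a (rmul n c w) :=
  lift_cons _ a w

@[simp]
theorem rmul_id (n : ℕ) {X Y : C} (w : Bar K n X Y) : rmul n (𝟙 Y) w = w := by
  induction n generalizing X with
  | zero =>
    induction w using induction_of; simp
  | succ n ih =>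
    induction w using induction_cons with
    | add w w' h h' => simp only [map_add, h, h']
    | cons Z a w => simp [ih]

theorem rmul_lmul (n : ℕ) {X' X Y Y' : C} (b : X' ⟶ X) (w : Bar K n X Y) (c : Y ⟶ Y') :
    rmul n c (lmul n b w) = lmul n b (rmul n c w) := by
  cases n with
  | zero =>
    induction w using induction_of; simp
  | succ n =>
    induction w using induction_cons with
    | add w w' h h' => simp only [map_add, h, h']
    | cons Z a w => simp

/-! ### The faces and the differential of the bar complex -/

/-- The face `dᵢ`, which composes the letters `i` and `i + 1`; it is zero if there are no such
letters. -/
noncomputable def face : ∀ (_ n : ℕ) {X Y : C}, Bar K (n + 1) X Y →ₗ[K] Bar K n X Y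
  | 0, n, _, _ => lift fun _ => lmul n
  | _ + 1, 0, _, _ => 0
  | i + 1, n + 1, _, _ => lift fun _ => (cons K).compl₂ (face i n)

@[simp]
theorem face_zero_cons {n : ℕ} {X Y Z : C} (a : X ⟶ Z) (w : Bar K n Z Y) :
    face 0 n (cons K a w) = lmul n a w := by
  rw [face, lift_cons]

@[simp]
theorem face_succ_cons (i : ℕ) {n : ℕ} {X Y Z : C} (a : X ⟶ Z) (w : Bar K (n + 1) Z Y) :
    face (i + 1) (n + 1) (cons K a w) = cons K a (face i n w) :=
  lift_cons _ a w

theorem face_lmul (i n : ℕ) {X' X Y : C} (c : X' ⟶ X) (w : Bar K (n + 1) X Y) :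
    face i n (lmul (n + 1) c w) = lmul n c (face i n w) := by
  induction w using induction_cons with
  | add w w' h h' => simp only [map_add, h, h']
  | cons Z a w =>
    rcases i with _ | i
    · simp [lmul_lmul]
    · rcases n with _ | n
      · simp [face]
      · simp

theorem face_face_zero (i n : ℕ) {X Y : C} (w : Bar K (n + 2) X Y) :
    face i n (face 0 (n + 1) w) = face 0 n (face (i + 1) (n + 1) w) := by
  induction w using induction_cons with
  | add w w' h h' => simp only [map_add, h, h']
  | cons Z a w => simp [face_lmul]

variable (K) in
/-- The differential `∑ᵢ (-1)ⁱ dᵢ` of the bar complex. -/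
noncomputable def diff : ∀ (n : ℕ) (X Y : C), Bar K (n + 1) X Y →ₗ[K] Bar K n X Y
  | n, _, _ => ∑ i ∈ Finset.range (n + 1), ((-1 : K) ^ i) • face i n

theorem diff_zero_cons {X Y Z : C} (a : X ⟶ Z) (w : Bar K 0 Z Y) :
    diff K 0 X Y (cons K a w) = lmul 0 a w := by
  simp [diff]

theorem diff_succ_cons {n : ℕ} {X Y Z : C} (a : X ⟶ Z) (w : Bar K (n + 1) Z Y) :
    diff K (n + 1) X Y (cons K a w) = lmul (n + 1) a w - cons K a (diff K n Z Y w) := by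
  rw [diff, Finset.sum_range_succ']
  simp [diff, LinearMap.sum_apply, pow_succ, map_sum, add_comm, sub_eq_add_neg]

theorem diff_lmul (n : ℕ) {X' X Y : C} (c : X' ⟶ X) (w : Bar K (n + 1) X Y) :
    diff K n X' Y (lmul (n + 1) c w) = lmul n c (diff K n X Y w) := by
  simp [diff, LinearMap.sum_apply, map_sum, face_lmul]

theorem diff_diff (n : ℕ) {X Y : C} (w : Bar K (n + 2) X Y) :
    diff K n X Y (diff K (n + 1) X Y w) = 0 := by
  induction n generalizing X with
  | zero =>
    induction w using induction_cons with
    | add w w' h h' => simp only [map_add, h, h', add_zero]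
    | cons Z a w => simp [diff_succ_cons, diff_lmul, diff_zero_cons]
  | succ n ih =>
    induction w using induction_cons with
    | add w w' h h' => simp only [map_add, h, h', add_zero]
    | cons Z a w => simp [diff_succ_cons, diff_lmul, ih]

/-! ### The last letter of a string -/

/-- The string `w ⊗ c`. -/
noncomputable def snoc : ∀ (n : ℕ) {X Z Y : C},
    Bar K n X Z →ₗ[K] (Z ⟶ Y) →ₗ[K] Bar K (n + 1) X Y
  | 0, _, _, _ => (cons K).compl₁₂ (of K).symm.toLinearMap (of K).toLinearMap
  | n + 1, X, Z, Y => lift fun U =>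
      LinearMap.mk₂ K (fun (a : X ⟶ U) (w : Bar K n U Z) =>
          (cons K a).comp (snoc n w : (Z ⟶ Y) →ₗ[K] Bar K (n + 1) U Y))
        (fun a a' w => by ext; simp) (fun r a w => by ext; simp)
        (fun a w w' => by ext; simp) (fun r a w => by ext; simp)

@[simp]
theorem snoc_of {X Z Y : C} (a : X ⟶ Z) (c : Z ⟶ Y) :
    snoc 0 (of K a) c = cons K a (of K c) := rfl

@[simp]
theorem snoc_cons {n : ℕ} {X U Z Y : C} (a : X ⟶ U) (w : Bar K n U Z) (c : Z ⟶ Y) :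
    snoc (n + 1) (cons K a w) c = cons K a (snoc n w c) := by
  rw [snoc, lift_cons]; rfl

@[elab_as_elim]
theorem induction_snoc {n : ℕ} {X Y : C} {p : Bar K (n + 1) X Y → Prop} (w : Bar K (n + 1) X Y)
    (snoc : ∀ (Z : C) (w : Bar K n X Z) (c : Z ⟶ Y), p (snoc n w c))
    (add : ∀ w w', p w → p w' → p (w + w')) : p w := by
  induction n generalizing X with
  | zero =>
    induction w using induction_cons with
    | add w w' h h' => exact add _ _ h h'
    | cons Z a w => exact snoc Z (of K a) ((of K).symm w)
  | succ n ih =>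
    induction w using induction_cons with
    | add w w' h h' => exact add _ _ h h'
    | cons Z a w =>
      refine ih (p := fun w => p (cons K a w)) w (fun U w c => ?_) fun w w' h h' => ?_
      · rw [← snoc_cons]; exact snoc U _ c
      · rw [map_add]; exact add _ _ h h'

/-- The linear map on strings with prescribed values on the `w ⊗ c`. -/
noncomputable def snocLift : ∀ (n : ℕ) {X Y : C} {W : Type u} [AddCommGroup W] [Module K W],
    (∀ Z : C, Bar K n X Z →ₗ[K] (Z ⟶ Y) →ₗ[K] W) →ₗ[K] Bar K (n + 1) X Y →ₗ[K] W
  | 0, X, Y, W, _, _ =>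
    { toFun := fun g => lift fun Z => (g Z).compl₁₂ (of K).toLinearMap (of K).symm.toLinearMap
      map_add' := fun g g' => hom_ext fun Z a w => by simp
      map_smul' := fun r g => hom_ext fun Z a w => by simp }
  | n + 1, X, Y, W, _, _ =>
    { toFun := fun g => lift fun U =>
        snocLift n ∘ₗ LinearMap.pi fun Z =>
          ((LinearMap.llcomp K (Bar K n U Z) (Bar K (n + 1) X Z) ((Z ⟶ Y) →ₗ[K] W)) (g Z)).comp
            (cons K : (X ⟶ U) →ₗ[K] Bar K n U Z →ₗ[K] Bar K (n + 1) X Z)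
      map_add' := fun g g' => hom_ext fun Z a w => by
        simp only [lift_cons, LinearMap.comp_apply, LinearMap.add_apply]
        rw [← LinearMap.add_apply, ← map_add]
        congr 2
      map_smul' := fun r g => hom_ext fun Z a w => by
        simp only [lift_cons, LinearMap.comp_apply, LinearMap.smul_apply, RingHom.id_apply]
        rw [← LinearMap.smul_apply, ← map_smul]
        congr 2 }

@[simp]
theorem snocLift_snoc (n : ℕ) {X Y Z : C} {W : Type u} [AddCommGroup W] [Module K W]
    (g : ∀ Z : C, Bar K n X Z →ₗ[K] (Z ⟶ Y) →ₗ[K] W) (w : Bar K n X Z) (c : Z ⟶ Y) :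
    snocLift n g (snoc n w c) = g Z w c := by
  induction n generalizing X with
  | zero =>
    induction w using induction_of with | of a => ?_
    rw [snoc_of]
    exact lift_cons _ a _
  | succ n ih =>
    induction w using induction_cons with
    | add w w' h h' => simp only [map_add, LinearMap.add_apply, h, h']
    | cons U a w =>
      rw [snoc_cons]
      refine (lift_cons _ a _).trans ?_
      exact ih _ w

theorem lmul_snoc {n : ℕ} {X' X Y Z : C} (b : X' ⟶ X) (w : Bar K n X Z) (c : Z ⟶ Y) :
    lmul (n + 1) b (snoc n w c) = snoc n (lmul n b w) c := by
  cases n with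
  | zero => induction w using induction_of; simp
  | succ n =>
    induction w using induction_cons with
    | add w w' h h' => simp only [map_add, LinearMap.add_apply, h, h']
    | cons Z a w => simp

theorem rmul_snoc {n : ℕ} {X Y Y' Z : C} (w : Bar K n X Z) (c : Z ⟶ Y) (b : Y ⟶ Y') :
    rmul (n + 1) b (snoc n w c) = snoc n w (c ≫ b) := by
  induction n generalizing X with
  | zero => induction w using induction_of; simp
  | succ n ih =>
    induction w using induction_cons with
    | add w w' h h' => simp only [map_add, LinearMap.add_apply, h, h']
    | cons Z a w => simp [ih]

theorem face_snoc {i n : ℕ} (hi : i ≤ n) {X Y Z : C} (w : Bar K (n + 1) X Z) (c : Z ⟶ Y) :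
    face i (n + 1) (snoc (n + 1) w c) = snoc n (face i n w) c := by
  induction i generalizing n X with
  | zero =>
    induction w using induction_cons with
    | add w w' h h' => simp only [map_add, LinearMap.add_apply, h, h']
    | cons Z a w => simp [lmul_snoc]
  | succ i ih =>
    obtain ⟨n, rfl⟩ : ∃ m, n = m + 1 := ⟨n - 1, by omega⟩
    induction w using induction_cons with
    | add w w' h h' => simp only [map_add, LinearMap.add_apply, h, h']
    | cons Z a w => simp [ih (Nat.le_of_succ_le_succ hi)]

theorem face_last_snoc {n : ℕ} {X Y Z : C} (w : Bar K n X Z) (c : Z ⟶ Y) :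
    face n n (snoc n w c) = rmul n c w := by
  induction n generalizing X with
  | zero => induction w using induction_of; simp
  | succ n ih =>
    induction w using induction_cons with
    | add w w' h h' => simp only [map_add, LinearMap.add_apply, h, h']
    | cons Z a w => simp [ih]

theorem diff_succ_snoc {n : ℕ} {X Y Z : C} (w : Bar K (n + 1) X Z) (c : Z ⟶ Y) :
    diff K (n + 1) X Y (snoc (n + 1) w c) =
      snoc n (diff K n X Z w) c + ((-1 : K) ^ (n + 1)) • rmul (n + 1) c w := by
  rw [diff, Finset.sum_range_succ, LinearMap.add_apply, LinearMap.smul_apply, face_last_snoc]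
  congr 1
  rw [diff, LinearMap.sum_apply, LinearMap.sum_apply, map_sum, LinearMap.sum_apply]
  refine Finset.sum_congr rfl fun i hi => ?_
  rw [LinearMap.smul_apply, face_snoc (by simpa [Nat.lt_succ_iff] using hi), LinearMap.smul_apply,
    map_smul, LinearMap.smul_apply]

end Bar

end Bar

/-! ### The contraction of the bar complex relative to a generating set of objects -/

section Contraction

variable {K : Type u} [Field K] {C : Type u} [Category.{u} C] [Preadditive C] [Linear K C]

namespace Bar

/-- The insertion `(u ⊗ v, w) ↦ u ⊗ L(v, w)`. -/
noncomputable def insertAt {n m : ℕ} {Z Y : C}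
    (L : ∀ U : C, (U ⟶ Z) →ₗ[K] Bar K n Z Y →ₗ[K] Bar K m U Y) :
    Bar K 1 Z Z →ₗ[K] Bar K n Z Y →ₗ[K] Bar K (m + 1) Z Y :=
  lift fun U => LinearMap.mk₂ K (fun (u : Z ⟶ U) (v : Bar K 0 U Z) =>
      (cons K u).comp (L U ((of K).symm v)))
    (fun u u' w => by ext; simp) (fun r u w => by ext; simp)
    (fun u w w' => by ext; simp) (fun r u w => by ext; simp)

@[simp]
theorem insertAt_cons {n m : ℕ} {Z Y U : C}
    (L : ∀ U : C, (U ⟶ Z) →ₗ[K] Bar K n Z Y →ₗ[K] Bar K m U Y) (u : Z ⟶ U) (v : U ⟶ Z)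
    (w : Bar K n Z Y) : insertAt L (cons K u (of K v)) w = cons K u (L U v w) := by
  rw [insertAt, lift_cons]; rfl

@[elab_as_elim]
theorem induction_pair {X Y : C} {p : Bar K 1 X Y → Prop} (x : Bar K 1 X Y)
    (pair : ∀ (U : C) (u : X ⟶ U) (v : U ⟶ Y), p (cons K u (of K v)))
    (add : ∀ x x', p x → p x' → p (x + x')) : p x := by
  induction x using induction_cons with
  | add x x' h h' => exact add _ _ h h'
  | cons U u v => exact pair U u ((of K).symm v)

/-- For a family `r` of elements `r_Z = ∑ u ⊗ v` with `∑ uv = 1`, the contraction up to projection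
of the bar complex, `h (a₀, …, aₙ) = ∑ₖ (-1)ᵏ ∑ (a₀ u₀, v₀ a₁ u₁, …, vₖ₋₁ aₖ uₖ, vₖ, aₖ₊₁, …, aₙ)`
for `0 ≤ k < n`. -/
noncomputable def contr (r : ∀ Z : C, Bar K 1 Z Z) :
    ∀ (n : ℕ) (X Y : C), Bar K n X Y →ₗ[K] Bar K (n + 1) X Y
  | 0, _, _ => 0
  | n + 1, _, Y => lift fun Z => (lmul (n + 2)).compl₂
      (insertAt (fun U => cons K - (lmul n).compr₂ (contr r n U Y)) (r Z))

/-- The projection `(a₀, …, aₙ) ↦ ∑ (a₀ u₀, v₀ a₁ u₁, …, vₙ₋₁ aₙ)` defined by a family of elements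
`r_Z = ∑ u ⊗ v`. -/
noncomputable def retract (r : ∀ Z : C, Bar K 1 Z Z) :
    ∀ (n : ℕ) (X Y : C), Bar K n X Y →ₗ[K] Bar K n X Y
  | 0, _, _ => LinearMap.id
  | n + 1, _, Y => lift fun Z => (lmul (n + 1)).compl₂
      (insertAt (fun U => (lmul n).compr₂ (retract r n U Y)) (r Z))

variable (r : ∀ Z : C, Bar K 1 Z Z)

theorem contr_cons {n : ℕ} {X Y Z : C} (a : X ⟶ Z) (w : Bar K n Z Y) :
    contr r (n + 1) X Y (cons K a w) = lmul (n + 2) a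
      (insertAt (fun U => cons K - (lmul n).compr₂ (contr r n U Y)) (r Z) w) :=
  lift_cons _ a w

theorem retract_cons {n : ℕ} {X Y Z : C} (a : X ⟶ Z) (w : Bar K n Z Y) :
    retract r (n + 1) X Y (cons K a w) = lmul (n + 1) a
      (insertAt (fun U => (lmul n).compr₂ (retract r n U Y)) (r Z) w) :=
  lift_cons _ a w

theorem contr_lmul {n : ℕ} {X' X Y : C} (b : X' ⟶ X) (w : Bar K n X Y) :
    contr r n X' Y (lmul n b w) = lmul (n + 1) b (contr r n X Y w) := by
  cases n with
  | zero => simp [contr]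
  | succ n =>
    induction w using induction_cons with
    | add w w' h h' => simp only [map_add, h, h']
    | cons Z a w => simp [contr_cons, lmul_lmul]

theorem contr_rmul {n : ℕ} {X Y Y' : C} (w : Bar K n X Y) (c : Y ⟶ Y') :
    contr r n X Y' (rmul n c w) = rmul (n + 1) c (contr r n X Y w) := by
  induction n generalizing X with
  | zero => simp [contr]
  | succ n ih =>
    induction w using induction_cons with
    | add w w' h h' => simp only [map_add, h, h']
    | cons Z a w =>
      rw [rmul_cons, contr_cons, contr_cons, rmul_lmul]
      congr 1
      generalize r Z = x
      induction x using induction_pair with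
      | add x x' h h' => simp only [map_add, LinearMap.add_apply, h, h']
      | pair U u v => simp [← rmul_lmul, ih]

theorem retract_lmul {n : ℕ} {X' X Y : C} (b : X' ⟶ X) (w : Bar K n X Y) :
    retract r n X' Y (lmul n b w) = lmul n b (retract r n X Y w) := by
  cases n with
  | zero => simp [retract]
  | succ n =>
    induction w using induction_cons with
    | add w w' h h' => simp only [map_add, h, h']
    | cons Z a w => simp [retract_cons, lmul_lmul]

/-- The identity `d h + h d = 1 - ρ` for the contraction `h` and the projection `ρ`. -/
theorem diff_contr (hr : ∀ Z, diff K 0 Z Z (r Z) = of K (𝟙 Z)) {n : ℕ} {X Y : C}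
    (w : Bar K (n + 1) X Y) :
    diff K (n + 1) X Y (contr r (n + 1) X Y w) + contr r n X Y (diff K n X Y w) =
      w - retract r (n + 1) X Y w := by
  induction n generalizing X with
  | zero =>
    induction w using induction_cons with
    | add w w' h h' =>
      simp only [map_add]
      rw [add_sub_add_comm, ← h, ← h']
      abel
    | cons Z a w =>
      have key : ∀ x : Bar K 1 Z Z, diff K 1 Z Y
          (insertAt (fun U => cons K - (lmul 0).compr₂ (contr r 0 U Y)) x w) =
          cons K ((of K).symm (diff K 0 Z Z x)) w -
            insertAt (fun U => (lmul 0).compr₂ (retract r 0 U Y)) x w := fun x => by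
        induction x using induction_pair with
        | add x x' h h' => simp only [map_add, LinearMap.add_apply, h, h']; abel
        | pair U u v => simp [diff_zero_cons, diff_succ_cons, contr, retract]
      rw [contr_cons, diff_lmul, key, hr, retract_cons]
      simp [contr]
  | succ n ih =>
    induction w using induction_cons with
    | add w w' h h' =>
      simp only [map_add]
      rw [add_sub_add_comm, ← h, ← h']
      abel
    | cons Z a w =>
      have key : ∀ x : Bar K 1 Z Z, diff K (n + 2) Z Y
          (insertAt (fun U => cons K - (lmul (n + 1)).compr₂ (contr r (n + 1) U Y)) x w) =
          cons K ((of K).symm (diff K 0 Z Z x)) w -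
            contr r (n + 1) Z Y (lmul (n + 1) ((of K).symm (diff K 0 Z Z x)) w) +
            insertAt (fun U => cons K - (lmul n).compr₂ (contr r n U Y)) x (diff K n Z Y w) -
            insertAt (fun U => (lmul (n + 1)).compr₂ (retract r (n + 1) U Y)) x w := fun x => by
        induction x using induction_pair with
        | add x x' h h' => simp only [map_add, LinearMap.add_apply, h, h']; abel
        | pair U u v =>
          have h := ih w
          rw [← eq_sub_iff_add_eq] at h
          simp only [insertAt_cons, LinearMap.sub_apply, LinearMap.compr₂_apply, diff_succ_cons,
            map_sub, lmul_cons, diff_zero_cons, lmul_of, LinearEquiv.symm_apply_apply, h,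
            diff_lmul, contr_lmul, lmul_lmul, retract_lmul]
          abel
      rw [contr_cons, diff_lmul, key, hr, retract_cons, diff_succ_cons,
        map_sub (contr r (n + 1) X Y), contr_lmul, contr_cons]
      simp only [LinearEquiv.symm_apply_apply, lmul_id, map_add, map_sub, lmul_cons,
        Category.comp_id, contr_lmul]
      abel

end Bar

end Contraction

/-! ### Signs and parities of morphisms -/

section Parity

variable (K : Type u) [Field K] {C : Type u} [Category.{u} C] [Preadditive C] [Linear K C]
  [SuperCategory K C]

theorem zmodTwo_cases (q : ZMod 2) : q = 0 ∨ q = 1 := by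
  revert q; decide

/-- The sign `(-1)^q`. -/
def sign (q : ZMod 2) : K := (-1) ^ q.val

@[simp]
theorem sign_zero : sign K 0 = 1 := by simp [sign]

@[simp]
theorem sign_one : sign K 1 = -1 := by simp [sign, ZMod.val_one]

theorem sign_add (p q : ZMod 2) : sign K (p + q) = sign K p * sign K q := by
  have h : (1 + 1 : ZMod 2) = 0 := rfl
  rcases zmodTwo_cases p with rfl | rfl <;> rcases zmodTwo_cases q with rfl | rfl <;> simp [h]

@[simp]
theorem sign_mul_self (q : ZMod 2) : sign K q * sign K q = 1 := by
  rcases zmodTwo_cases q with rfl | rfl <;> simp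

theorem sum_zmodTwo {M : Type*} [AddCommMonoid M] (f : ZMod 2 → M) : ∑ q, f q = f 0 + f 1 :=
  Fin.sum_univ_two f

variable {K}

theorem proj_mem (q : ZMod 2) {X Y : C} (f : X ⟶ Y) :
    proj K q X Y f ∈ SuperCategory.deg (K := K) X Y q :=
  Submodule.projection_apply_mem _ f

theorem proj_of_mem {q : ZMod 2} {X Y : C} {f : X ⟶ Y}
    (hf : f ∈ SuperCategory.deg (K := K) X Y q) (q' : ZMod 2) :
    proj K q' X Y f = if q' = q then f else 0 := by
  split_ifs with h
  · subst h
    exact Submodule.projection_apply_left (isCompl_deg K X Y q') ⟨f, hf⟩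
  · have h' : q = q' + 1 := by
      clear hf
      revert q q'
      decide
    subst h'
    exact (Submodule.projection_apply_eq_zero_iff (isCompl_deg K X Y q')).2 hf

theorem sum_proj {X Y : C} (f : X ⟶ Y) : ∑ q, proj K q X Y f = f := by
  obtain ⟨a, ha, b, hb, rfl⟩ := Submodule.mem_sup.1
    ((isCompl_deg K X Y 0).sup_eq_top.ge (Submodule.mem_top (x := f)))
  rw [sum_zmodTwo]
  simp only [map_add, proj_of_mem ha, proj_of_mem hb]
  simp

theorem hom_ext_deg {X Y : C} {W : Type*} [AddCommGroup W] [Module K W]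
    {f g : (X ⟶ Y) →ₗ[K] W}
    (h : ∀ (q : ZMod 2) (a : X ⟶ Y), a ∈ SuperCategory.deg (K := K) X Y q → f a = g a) :
    f = g := by
  ext a
  rw [← sum_proj (K := K) a, sum_zmodTwo, map_add, map_add, h 0 _ (proj_mem 0 a),
    h 1 _ (proj_mem 1 a)]

theorem signMap_of_mem {i : ZMod 2} {X Y : C} {f : X ⟶ Y}
    (hf : f ∈ SuperCategory.deg (K := K) X Y i) (q : ZMod 2) :
    signMap K q X Y f = sign K (q * i) • f := by
  have h : signMap K q X Y f = proj K 0 X Y f + sign K q • proj K 1 X Y f := rfl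
  rw [h, proj_of_mem hf, proj_of_mem hf]
  rcases zmodTwo_cases i with rfl | rfl <;> simp

theorem signMap_comp (q : ZMod 2) {X Y Z : C} (f : X ⟶ Y) (g : Y ⟶ Z) :
    signMap K q X Z (f ≫ g) = signMap K q X Y f ≫ signMap K q Y Z g := by
  have h : (Linear.comp X Y Z : (X ⟶ Y) →ₗ[K] _).compr₂ (signMap K q X Z) =
      (Linear.comp X Y Z).compl₁₂ (signMap K q X Y) (signMap K q Y Z) :=
    hom_ext_deg fun i f hf => hom_ext_deg fun j g hg => by
      change signMap K q X Z (f ≫ g) = signMap K q X Y f ≫ signMap K q Y Z g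
      rw [signMap_of_mem (SuperCategory.comp_mem hf hg), signMap_of_mem hf, signMap_of_mem hg,
        Linear.smul_comp, Linear.comp_smul, smul_smul, mul_add, sign_add]
  exact LinearMap.congr_fun₂ h f g

theorem signMap_signMap (q q' : ZMod 2) {X Y : C} (f : X ⟶ Y) :
    signMap K q X Y (signMap K q' X Y f) = signMap K (q + q') X Y f := by
  have h : signMap K q X Y ∘ₗ signMap K q' X Y = signMap K (q + q') X Y :=
    hom_ext_deg fun i f hf => by
      rw [LinearMap.comp_apply, signMap_of_mem hf, map_smul, signMap_of_mem hf, signMap_of_mem hf,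
        smul_smul, add_mul, sign_add, mul_comm]
  exact LinearMap.congr_fun h f

/-- The odd part `e` of an identity morphism satisfies `a e = 0` for even and for odd `a`, because
`a e` is the component of `a 𝟙 = a` of the other parity. -/
theorem id_mem_deg (X : C) : 𝟙 X ∈ SuperCategory.deg (K := K) X X 0 := by
  have h := sum_proj (K := K) (𝟙 X)
  rw [sum_zmodTwo] at h
  have key : (Linear.rightComp K X (proj K 1 X X (𝟙 X))) = 0 := hom_ext_deg fun q a ha => by
    have h₀ := SuperCategory.comp_mem ha (proj_mem (K := K) 0 (𝟙 X))
    have h₁ := SuperCategory.comp_mem ha (proj_mem (K := K) 1 (𝟙 X))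
    have e : a = a ≫ proj K 0 X X (𝟙 X) + a ≫ proj K 1 X X (𝟙 X) := by
      rw [← Preadditive.comp_add, h, Category.comp_id]
    have e' := congrArg (proj K (q + 1) X X) e
    rw [map_add, proj_of_mem ha, proj_of_mem h₀, proj_of_mem h₁] at e'
    simpa using e'.symm
  have e : proj K 1 X X (𝟙 X) = 0 := by
    simpa using LinearMap.congr_fun key (𝟙 X)
  rw [e, add_zero] at h
  rw [← h]
  exact proj_mem 0 _

/-! ### Signs and parities of strings -/

namespace Bar

/-- The sign operator `w ↦ (-1)^{q|w|} w`, the sign operator of morphisms applied letterwise. -/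
noncomputable def signBar (q : ZMod 2) : ∀ (n : ℕ) (X Y : C), Bar K n X Y →ₗ[K] Bar K n X Y
  | 0, X, Y => (of K).toLinearMap ∘ₗ signMap K q X Y ∘ₗ (of K).symm.toLinearMap
  | n + 1, X, Y => lift fun Z => (cons K).compl₁₂ (signMap K q X Z) (signBar q n Z Y)

@[simp]
theorem signBar_of (q : ZMod 2) {X Y : C} (a : X ⟶ Y) :
    signBar q 0 X Y (of K a) = of K (signMap K q X Y a) := rfl

@[simp]
theorem signBar_cons (q : ZMod 2) {n : ℕ} {X Y Z : C} (a : X ⟶ Z) (w : Bar K n Z Y) :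
    signBar q (n + 1) X Y (cons K a w) = cons K (signMap K q X Z a) (signBar q n Z Y w) :=
  lift_cons _ a w

theorem signBar_lmul (q : ZMod 2) {n : ℕ} {X' X Y : C} (b : X' ⟶ X) (w : Bar K n X Y) :
    signBar q n X' Y (lmul n b w) = lmul n (signMap K q X' X b) (signBar q n X Y w) := by
  cases n with
  | zero => induction w using induction_of; simp [signMap_comp]
  | succ n =>
    induction w using induction_cons with
    | add w w' h h' => simp only [map_add, h, h']
    | cons Z a w => simp [signMap_comp]

theorem signBar_snoc (q : ZMod 2) {n : ℕ} {X Y Z : C} (w : Bar K n X Z) (c : Z ⟶ Y) :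
    signBar q (n + 1) X Y (snoc n w c) =
      snoc n (signBar q n X Z w) (signMap K q Z Y c) := by
  induction n generalizing X with
  | zero => induction w using induction_of; simp
  | succ n ih =>
    induction w using induction_cons with
    | add w w' h h' => simp only [map_add, LinearMap.add_apply, h, h']
    | cons Z a w => simp [ih]

theorem signBar_face (q : ZMod 2) (i : ℕ) {n : ℕ} {X Y : C} (w : Bar K (n + 1) X Y) :
    signBar q n X Y (face i n w) = face i n (signBar q (n + 1) X Y w) := by
  induction i generalizing n X with
  | zero =>
    induction w using induction_cons with
    | add w w' h h' => simp only [map_add, h, h']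
    | cons Z a w => simp [signBar_lmul]
  | succ i ih =>
    cases n with
    | zero => simp [face]
    | succ n =>
      induction w using induction_cons with
      | add w w' h h' => simp only [map_add, h, h']
      | cons Z a w => simp [ih]

theorem signBar_signBar (q q' : ZMod 2) {n : ℕ} {X Y : C} (w : Bar K n X Y) :
    signBar q n X Y (signBar q' n X Y w) = signBar (q + q') n X Y w := by
  induction n generalizing X with
  | zero => induction w using induction_of; simp [signMap_signMap]
  | succ n ih =>
    induction w using induction_cons with
    | add w w' h h' => simp only [map_add, h, h']
    | cons Z a w => simp [ih, signMap_signMap]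

theorem signBar_contr (r : ∀ Z : C, Bar K 1 Z Z) (q : ZMod 2)
    (hr : ∀ Z, signBar q 1 Z Z (r Z) = r Z) {n : ℕ} {X Y : C} (w : Bar K n X Y) :
    signBar q (n + 1) X Y (contr r n X Y w) = contr r n X Y (signBar q n X Y w) := by
  induction n generalizing X with
  | zero => simp [contr]
  | succ n ih =>
    induction w using induction_cons with
    | add w w' h h' => simp only [map_add, h, h']
    | cons Z a w =>
      rw [signBar_cons, contr_cons, contr_cons, signBar_lmul]
      congr 1
      conv_rhs => rw [← hr Z]
      generalize r Z = x
      induction x using induction_pair with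
      | add x x' h h' => simp only [map_add, LinearMap.add_apply, h, h']
      | pair U u v => simp [ih, signBar_lmul]

/-- The span of the strings `(a₀, …, aₙ)` of homogeneous morphisms of total parity `p` whose inner
objects lie in `S`. -/
noncomputable def part (S : Set C) : ∀ (n : ℕ) (_ : ZMod 2) (X Y : C), Submodule K (Bar K n X Y)
  | 0, p, X, Y => (SuperCategory.deg X Y p).map (of K).toLinearMap
  | n + 1, p, X, Y => Submodule.span K {x | ∃ (Z : C) (_ : Z ∈ S) (q q' : ZMod 2) (a : X ⟶ Z)
      (w : Bar K n Z Y), a ∈ SuperCategory.deg (K := K) X Z q ∧ w ∈ part S n q' Z Y ∧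
        q + q' = p ∧ x = cons K a w}

variable {S : Set C}

theorem of_mem_part {p : ZMod 2} {X Y : C} {a : X ⟶ Y}
    (ha : a ∈ SuperCategory.deg (K := K) X Y p) : of K a ∈ part S 0 p X Y :=
  Submodule.mem_map_of_mem ha

theorem cons_mem_part {n : ℕ} {p q : ZMod 2} {X Y Z : C} (hZ : Z ∈ S) {a : X ⟶ Z}
    (ha : a ∈ SuperCategory.deg (K := K) X Z p) {w : Bar K n Z Y} (hw : w ∈ part S n q Z Y) :
    cons K a w ∈ part S (n + 1) (p + q) X Y :=
  Submodule.subset_span ⟨Z, hZ, p, q, a, w, ha, hw, rfl, rfl⟩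

theorem part_zero_le {p : ZMod 2} {X Y : C} {N : Submodule K (Bar K 0 X Y)}
    (h : ∀ a ∈ SuperCategory.deg (K := K) X Y p, of K a ∈ N) : part S 0 p X Y ≤ N :=
  Submodule.map_le_iff_le_comap.2 h

theorem part_succ_le {n : ℕ} {p : ZMod 2} {X Y : C} {N : Submodule K (Bar K (n + 1) X Y)}
    (h : ∀ Z ∈ S, ∀ (q q' : ZMod 2), q + q' = p → ∀ a ∈ SuperCategory.deg (K := K) X Z q,
      ∀ w ∈ part S n q' Z Y, cons K a w ∈ N) : part S (n + 1) p X Y ≤ N :=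
  Submodule.span_le.2 fun _ ⟨Z, hZ, q, q', a, w, ha, hw, hp, hx⟩ =>
    hx ▸ h Z hZ q q' hp a ha w hw

theorem part_mono {S' : Set C} (hS : S ⊆ S') (n : ℕ) (p : ZMod 2) (X Y : C) :
    part (K := K) S n p X Y ≤ part S' n p X Y := by
  induction n generalizing X p with
  | zero => exact part_zero_le fun a ha => of_mem_part ha
  | succ n ih =>
    exact part_succ_le fun Z hZ q q' hp a ha w hw => hp ▸ cons_mem_part (hS hZ) ha (ih _ _ hw)

theorem lmul_mem_part {n : ℕ} {p q : ZMod 2} {X' X Y : C} {b : X' ⟶ X}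
    (hb : b ∈ SuperCategory.deg (K := K) X' X p) {w : Bar K n X Y} (hw : w ∈ part S n q X Y) :
    lmul n b w ∈ part S n (p + q) X' Y := by
  rw [← Submodule.mem_comap]
  cases n with
  | zero =>
    refine part_zero_le (N := Submodule.comap _ _) (fun a ha => ?_) hw
    exact of_mem_part (S := S) (SuperCategory.comp_mem hb ha)
  | succ n =>
    refine part_succ_le (N := Submodule.comap _ _) (fun Z hZ i j hq a ha w hw => ?_) hw
    rw [Submodule.mem_comap, lmul_cons, ← hq, ← add_assoc]
    exact cons_mem_part hZ (SuperCategory.comp_mem hb ha) hw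

theorem snoc_mem_part {n : ℕ} {p q : ZMod 2} {X Y Z : C} (hZ : Z ∈ S) {w : Bar K n X Z}
    (hw : w ∈ part S n p X Z) {c : Z ⟶ Y} (hc : c ∈ SuperCategory.deg (K := K) Z Y q) :
    snoc n w c ∈ part S (n + 1) (p + q) X Y := by
  rw [← LinearMap.flip_apply, ← Submodule.mem_comap]
  induction n generalizing X p with
  | zero =>
    refine part_zero_le (N := Submodule.comap _ _) (fun a ha => ?_) hw
    exact cons_mem_part hZ ha (of_mem_part hc)
  | succ n ih =>
    refine part_succ_le (N := Submodule.comap _ _) (fun U hU i j hq a ha w hw => ?_) hw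
    rw [Submodule.mem_comap, LinearMap.flip_apply, snoc_cons, ← hq, add_assoc i]
    exact cons_mem_part hU ha (ih hw)

theorem part_le_of_snoc {n : ℕ} {p : ZMod 2} {X Y : C} {N : Submodule K (Bar K (n + 1) X Y)}
    (h : ∀ Z ∈ S, ∀ (q q' : ZMod 2), q + q' = p → ∀ w ∈ part S n q X Z,
      ∀ c ∈ SuperCategory.deg (K := K) Z Y q', snoc n w c ∈ N) : part S (n + 1) p X Y ≤ N := by
  induction n generalizing X p with
  | zero =>
    refine part_succ_le fun Z hZ q q' hp a ha w hw => ?_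
    obtain ⟨c, hc, rfl⟩ := hw
    exact h Z hZ q q' hp (of K a) (of_mem_part ha) c hc
  | succ n ih =>
    refine part_succ_le fun Z hZ q q' hp a ha w hw => ?_
    refine ih (N := N.comap (cons K a)) (fun U hU i j hq w hw c hc => ?_) hw
    rw [Submodule.mem_comap, ← snoc_cons]
    exact h U hU (q + i) j (by rw [add_assoc, hq, hp]) _ (cons_mem_part hZ ha hw) c hc

theorem face_mem_part (i : ℕ) {n : ℕ} {p : ZMod 2} {X Y : C} {w : Bar K (n + 1) X Y}
    (hw : w ∈ part S (n + 1) p X Y) : face i n w ∈ part S n p X Y := by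
  rw [← Submodule.mem_comap]
  induction i generalizing n X p w with
  | zero =>
    refine part_succ_le (N := Submodule.comap _ _) (fun Z hZ q q' hp a ha w hw => ?_) hw
    rw [Submodule.mem_comap, face_zero_cons, ← hp]
    exact lmul_mem_part ha hw
  | succ i ih =>
    cases n with
    | zero => simp [face]
    | succ n =>
      refine part_succ_le (N := Submodule.comap _ _) (fun Z hZ q q' hp a ha w hw => ?_) hw
      rw [Submodule.mem_comap, face_succ_cons, ← hp]
      exact cons_mem_part hZ ha (ih hw)

theorem insertAt_mem_part {n m : ℕ} {q : ZMod 2} {Z Y : C}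
    (L : ∀ U : C, (U ⟶ Z) →ₗ[K] Bar K n Z Y →ₗ[K] Bar K m U Y) {w : Bar K n Z Y}
    (hL : ∀ U ∈ S, ∀ (i : ZMod 2), ∀ v ∈ SuperCategory.deg (K := K) U Z i,
      L U v w ∈ part S m (i + q) U Y)
    {x : Bar K 1 Z Z} (hx : x ∈ part S 1 0 Z Z) :
    insertAt L x w ∈ part S (m + 1) q Z Y := by
  rw [← LinearMap.flip_apply, ← Submodule.mem_comap]
  refine part_succ_le (N := Submodule.comap _ _) (fun U hU i j hp u hu v hv => ?_) hx
  obtain ⟨v, hv, rfl⟩ := hv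
  have h := cons_mem_part hU hu (hL U hU j v hv)
  rw [← add_assoc, hp, zero_add] at h
  rw [Submodule.mem_comap, LinearMap.flip_apply]
  exact (insertAt_cons L u v w).symm ▸ h

theorem contr_mem_part (r : ∀ Z : C, Bar K 1 Z Z) (hr : ∀ Z, r Z ∈ part S 1 0 Z Z)
    {n : ℕ} {p : ZMod 2} {X Y : C} {w : Bar K n X Y} (hw : w ∈ part S n p X Y) :
    contr r n X Y w ∈ part S (n + 1) p X Y := by
  rw [← Submodule.mem_comap]
  induction n generalizing X p with
  | zero => simp [contr]
  | succ n ih =>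
    refine part_succ_le (N := Submodule.comap _ _) (fun Z hZ q q' hp a ha w hw => ?_) hw
    rw [Submodule.mem_comap, contr_cons, ← hp]
    refine lmul_mem_part ha (insertAt_mem_part _ (fun U hU i v hv => ?_) (hr Z))
    exact sub_mem (cons_mem_part hZ hv hw) (ih (lmul_mem_part hv hw))

theorem retract_mem_part (r : ∀ Z : C, Bar K 1 Z Z) (hr : ∀ Z, r Z ∈ part S 1 0 Z Z)
    {n : ℕ} {p : ZMod 2} {X Y : C} {w : Bar K n X Y} (hw : w ∈ part Set.univ n p X Y) :
    retract r n X Y w ∈ part S n p X Y := by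
  rw [← Submodule.mem_comap]
  induction n generalizing X p with
  | zero =>
    refine part_zero_le (N := Submodule.comap _ _) (fun a ha => ?_) hw
    exact of_mem_part (S := S) ha
  | succ n ih =>
    refine part_succ_le (N := Submodule.comap _ _) (fun Z _ q q' hp a ha w hw => ?_) hw
    rw [Submodule.mem_comap, retract_cons, ← hp]
    refine lmul_mem_part ha (insertAt_mem_part _ (fun U hU i v hv => ?_) (hr Z))
    exact ih (lmul_mem_part hv hw)

theorem signBar_of_mem {n : ℕ} {p : ZMod 2} {X Y : C} {w : Bar K n X Y}
    (hw : w ∈ part S n p X Y) (q : ZMod 2) : signBar q n X Y w = sign K (q * p) • w := by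
  have : part S n p X Y ≤
      LinearMap.eqLocus (signBar q n X Y) (sign K (q * p) • (LinearMap.id : _ →ₗ[K] Bar K n X Y)) := by
    clear hw w
    induction n generalizing X p with
    | zero =>
      refine part_zero_le fun a ha => ?_
      simp [LinearMap.mem_eqLocus, signMap_of_mem ha]
    | succ n ih =>
      refine part_succ_le fun Z hZ i j hp a ha w hw => ?_
      have h : signBar q n Z Y w = sign K (q * j) • w := ih hw
      rw [LinearMap.mem_eqLocus, signBar_cons, h, signMap_of_mem ha, ← hp, mul_add, sign_add]
      simp [smul_smul, mul_comm]
  exact this hw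

theorem cons_mem_sup_part {n : ℕ} {X Y Z : C} (hZ : Z ∈ S) (a : X ⟶ Z) {w : Bar K n Z Y}
    (hw : w ∈ part S n 0 Z Y ⊔ part S n 1 Z Y) :
    cons K a w ∈ part S (n + 1) 0 X Y ⊔ part S (n + 1) 1 X Y := by
  obtain ⟨w₀, h₀, w₁, h₁, rfl⟩ := Submodule.mem_sup.1 hw
  have ha := sum_proj (K := K) a
  rw [sum_zmodTwo] at ha
  rw [← ha, map_add (cons K), LinearMap.add_apply, map_add, map_add]
  have key : ∀ {i j k : ZMod 2} {v : Bar K n Z Y}, i + j = k → v ∈ part S n j Z Y →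
      cons K (proj K i X Z a) v ∈ part S (n + 1) k X Y := fun h hv =>
    h ▸ cons_mem_part hZ (proj_mem _ a) hv
  refine add_mem (add_mem ?_ ?_) (add_mem ?_ ?_)
  · exact Submodule.mem_sup_left (key (by decide) h₀)
  · exact Submodule.mem_sup_right (key (by decide) h₁)
  · exact Submodule.mem_sup_right (key (by decide) h₀)
  · exact Submodule.mem_sup_left (key (by decide) h₁)

theorem of_mem_sup_part {X Y : C} (a : X ⟶ Y) :
    of K a ∈ part S 0 0 X Y ⊔ part S 0 1 X Y := by
  rw [← sum_proj (K := K) a, sum_zmodTwo, map_add]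
  exact Submodule.add_mem_sup (of_mem_part (proj_mem 0 a)) (of_mem_part (proj_mem 1 a))

theorem mem_sup_part {n : ℕ} {X Y : C} (w : Bar K n X Y) :
    w ∈ part Set.univ n 0 X Y ⊔ part Set.univ n 1 X Y := by
  induction n generalizing X with
  | zero =>
    induction w using induction_of with | of a => ?_
    exact of_mem_sup_part a
  | succ n ih =>
    induction w using induction_cons with
    | add w w' h h' => exact add_mem h h'
    | cons Z a w => exact cons_mem_sup_part (Set.mem_univ Z) a (ih w)

end Bar

end Parity

/-! ### Words: strings along a tuple of objects -/

section Words

variable {K : Type u} [Field K] {C : Type u} [Category.{u} C] [Preadditive C] [Linear K C]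

namespace Bar

variable (K) in
/-- The string `m ⊗ a₁ ⊗ ⋯ ⊗ aₙ`. -/
noncomputable def word : ∀ {n : ℕ} {X : C} (Z : Fin (n + 1) → C) (_ : X ⟶ Z 0)
    (_ : ∀ i : Fin n, Z i.castSucc ⟶ Z i.succ), Bar K n X (Z (Fin.last n))
  | 0, _, _, m, _ => of K m
  | _ + 1, _, Z, m, a => cons K m (word (tailObj Z) (firstArrow a) (tailArrow a))

theorem word_succ {n : ℕ} {X : C} (Z : Fin (n + 2) → C) (m : X ⟶ Z 0)
    (a : ∀ i : Fin (n + 1), Z i.castSucc ⟶ Z i.succ) :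
    word K Z m a = cons K m (word K (tailObj Z) (firstArrow a) (tailArrow a)) := rfl

theorem lmul_word {n : ℕ} {X' X : C} (b : X' ⟶ X) (Z : Fin (n + 1) → C) (m : X ⟶ Z 0)
    (a : ∀ i : Fin n, Z i.castSucc ⟶ Z i.succ) :
    lmul n b (word K Z m a) = word K Z (b ≫ m) a := by
  cases n with
  | zero => rfl
  | succ n => exact lmul_cons _ _ _

variable (K) in
/-- A string as a linear function of its first letter. -/
noncomputable def wordHead {n : ℕ} (X : C) (Z : Fin (n + 1) → C)
    (a : ∀ i : Fin n, Z i.castSucc ⟶ Z i.succ) : (X ⟶ Z 0) →ₗ[K] Bar K n X (Z (Fin.last n)) where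
  toFun m := word K Z m a
  map_add' m m' := by
    cases n with
    | zero => exact map_add _ _ _
    | succ n => exact LinearMap.map_add₂ _ _ _ _
  map_smul' c m := by
    cases n with
    | zero => exact map_smul _ _ _
    | succ n => exact LinearMap.map_smul₂ _ _ _ _

theorem word_update {n : ℕ} {X : C} (Z : Fin (n + 1) → C) (m : X ⟶ Z 0)
    (a : ∀ i : Fin n, Z i.castSucc ⟶ Z i.succ) (k : Fin n) :
    ∃ L : (Z k.castSucc ⟶ Z k.succ) →ₗ[K] Bar K n X (Z (Fin.last n)),
      ∀ v, word K Z m (Function.update a k v) = L v := by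
  induction n generalizing X with
  | zero => exact k.elim0
  | succ n ih =>
    cases k using Fin.cases with
    | zero =>
      refine ⟨cons K m ∘ₗ wordHead K (Z 0) (tailObj Z) (tailArrow a), fun v => ?_⟩
      rw [word_succ, firstArrow_update_zero, tailArrow_update_zero]
      rfl
    | succ k =>
      obtain ⟨L, hL⟩ := ih (tailObj Z) (firstArrow a) (tailArrow a) k
      refine ⟨cons K m ∘ₗ L, fun v => ?_⟩
      have h : firstArrow (Function.update a k.succ v) = firstArrow a :=
        Function.update_of_ne (Fin.succ_ne_zero k).symm v a
      exact congrArg (cons K m) ((congrArg₂ (word K (tailObj Z)) h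
        (tailArrow_update_succ a k v)).trans (hL v))

/-- The tuple `(U, Z₀, …, Zₙ)`. -/
def consObj {n : ℕ} (U : C) (Z : Fin (n + 1) → C) : Fin (n + 2) → C :=
  Fin.cons U Z

/-- The string `(m, a₀, …, aₙ₋₁)` along the tuple `(U, Z₀, …, Zₙ)`. -/
def consArrow {n : ℕ} {U : C} {Z : Fin (n + 1) → C} (m : U ⟶ Z 0)
    (a : ∀ i : Fin n, Z i.castSucc ⟶ Z i.succ) :
    ∀ i : Fin (n + 1), consObj U Z i.castSucc ⟶ consObj U Z i.succ :=
  Fin.cases m a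

theorem consArrow_update_zero {n : ℕ} {U : C} {Z : Fin (n + 1) → C} (m : U ⟶ Z 0)
    (a : ∀ i : Fin n, Z i.castSucc ⟶ Z i.succ)
    (v : consObj U Z (Fin.castSucc 0) ⟶ consObj U Z (Fin.succ 0)) :
    Function.update (consArrow m a) 0 v = consArrow v a := by
  funext j
  cases j using Fin.cases with
  | zero => exact Function.update_self _ _ _
  | succ j => exact Function.update_of_ne (Fin.succ_ne_zero j) _ _

theorem consArrow_update_succ {n : ℕ} {U : C} {Z : Fin (n + 1) → C} (m : U ⟶ Z 0)
    (a : ∀ i : Fin n, Z i.castSucc ⟶ Z i.succ) (k : Fin n)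
    (v : consObj U Z k.succ.castSucc ⟶ consObj U Z k.succ.succ) :
    Function.update (consArrow m a) k.succ v = consArrow m (Function.update a k v) := by
  funext j
  cases j using Fin.cases with
  | zero => exact Function.update_of_ne (Fin.succ_ne_zero k).symm _ _
  | succ j =>
    by_cases hj : j = k
    · subst hj
      exact (Function.update_self j.succ v (consArrow m a)).trans (Function.update_self j v a).symm
    · exact (Function.update_of_ne (fun h => hj (Fin.succ_injective _ h)) v (consArrow m a)).trans
        (Function.update_of_ne hj v a).symm

theorem cons_cases {n : ℕ} (Z : Fin (n + 2) → C)
    (a : ∀ i : Fin (n + 1), Z i.castSucc ⟶ Z i.succ)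
    {p : ∀ Z : Fin (n + 2) → C, (∀ i : Fin (n + 1), Z i.castSucc ⟶ Z i.succ) → Prop}
    (h : ∀ (U : C) (Z' : Fin (n + 1) → C) (m : U ⟶ Z' 0)
      (b : ∀ i : Fin n, Z' i.castSucc ⟶ Z' i.succ), p (consObj U Z') (consArrow m b)) : p Z a := by
  obtain ⟨U, Z', rfl⟩ : ∃ U Z', Z = consObj U Z' := ⟨Z 0, tailObj Z, by
    funext i
    cases i using Fin.cases <;> rfl⟩
  have : a = consArrow (firstArrow a) (tailArrow a) := by
    funext i
    cases i using Fin.cases <;> rfl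
  rw [this]
  exact h U Z' _ _

/-- Linear maps on strings are determined by their values on words. -/
theorem hom_ext_word {n : ℕ} {X : C} {W : C → Type u} [∀ Y, AddCommGroup (W Y)]
    [∀ Y, Module K (W Y)] {f g : ∀ Y, Bar K n X Y →ₗ[K] W Y}
    (h : ∀ (Z : Fin (n + 1) → C) (m : X ⟶ Z 0) (a : ∀ i : Fin n, Z i.castSucc ⟶ Z i.succ),
      f _ (word K Z m a) = g _ (word K Z m a)) : f = g := by
  induction n generalizing X with
  | zero =>
    funext Y
    ext a
    induction a using induction_of with | of a => ?_
    exact h (fun _ => Y) a fun i => i.elim0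
  | succ n ih =>
    funext Y
    refine hom_ext fun U a w => ?_
    have := ih (f := fun Y => f Y ∘ₗ cons K a) (g := fun Y => g Y ∘ₗ cons K a)
      fun Z m b => h (consObj U Z) a (consArrow m b)
    exact LinearMap.congr_fun (congrFun this Y) w

/-- There is a linear map on strings with prescribed values on words, for values that are linear in
each letter. -/
theorem exists_wordLift {n : ℕ} {X : C} {W : C → Type u} [∀ Y, AddCommGroup (W Y)]
    [∀ Y, Module K (W Y)]
    (g : ∀ Z : Fin (n + 1) → C, (X ⟶ Z 0) → (∀ i : Fin n, Z i.castSucc ⟶ Z i.succ) →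
      W (Z (Fin.last n)))
    (hm : ∀ Z a, ∃ L : (X ⟶ Z 0) →ₗ[K] W (Z (Fin.last n)), ∀ m, g Z m a = L m)
    (ha : ∀ Z m a k, ∃ L : (Z (Fin.castSucc k) ⟶ Z k.succ) →ₗ[K] W (Z (Fin.last n)),
      ∀ v, g Z m (Function.update a k v) = L v) :
    ∃ L : ∀ Y, Bar K n X Y →ₗ[K] W Y, ∀ Z m a, L _ (word K Z m a) = g Z m a := by
  induction n generalizing X with
  | zero =>
    choose L hL using hm
    refine ⟨fun Y => L (fun _ => Y) (fun i => i.elim0) ∘ₗ (of K).symm.toLinearMap,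
      fun Z m a => ?_⟩
    obtain ⟨Y, rfl⟩ : ∃ Y, Z = fun _ => Y := ⟨Z 0, funext fun i => by
      rw [Fin.eq_zero i]⟩
    obtain rfl : a = fun i => i.elim0 := funext fun i => i.elim0
    exact (hL _ _ _).symm
  | succ n ih =>
    have key : ∀ (U : C) (m : X ⟶ U), ∃ L : ∀ Y, Bar K n U Y →ₗ[K] W Y, ∀ Z b c,
        L _ (word K Z b c) = g (consObj U Z) m (consArrow b c) := fun U m => by
      refine ih (fun Z b c => g (consObj U Z) m (consArrow b c)) (fun Z c => ?_)
        fun Z b c k => ?_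
      · obtain ⟨L, hL⟩ := ha (consObj U Z) m (consArrow 0 c) 0
        exact ⟨L, fun v => (congrArg _ (consArrow_update_zero 0 c v).symm).trans (hL v)⟩
      · obtain ⟨L, hL⟩ := ha (consObj U Z) m (consArrow b c) k.succ
        exact ⟨L, fun v => (congrArg _ (consArrow_update_succ b c k v).symm).trans (hL v)⟩
    choose L hL using key
    have hadd : ∀ U m m' Y, L U (m + m') Y = L U m Y + L U m' Y := fun U m m' => by
      refine congrFun (hom_ext_word (f := L U (m + m')) (g := fun Y => L U m Y + L U m' Y)
        fun Z b c => ?_)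
      obtain ⟨L', hL'⟩ := hm (consObj U Z) (consArrow b c)
      rw [LinearMap.add_apply, hL, hL, hL]
      exact (hL' _).trans ((map_add L' _ _).trans (congrArg₂ _ (hL' _).symm (hL' _).symm))
    have hsmul : ∀ U (r : K) m Y, L U (r • m) Y = r • L U m Y := fun U r m => by
      refine congrFun (hom_ext_word (f := L U (r • m)) (g := fun Y => r • L U m Y)
        fun Z b c => ?_)
      obtain ⟨L', hL'⟩ := hm (consObj U Z) (consArrow b c)
      rw [LinearMap.smul_apply, hL, hL]
      exact (hL' _).trans ((map_smul L' _ _).trans (congrArg _ (hL' _).symm))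
    refine ⟨fun Y => lift fun U =>
      { toFun := fun m => L U m Y
        map_add' := fun m m' => hadd U m m' Y
        map_smul' := fun r m => hsmul U r m Y }, fun Z m a => ?_⟩
    refine (lift_cons _ m _).trans ?_
    exact cons_cases Z a (p := fun Z a => ∀ m : X ⟶ Z 0, L (Z 0) m (Z (Fin.last (n + 1)))
      (word K (tailObj Z) (firstArrow a) (tailArrow a)) = g Z m a)
      (fun U Z' b c m => hL U m Z' b c) m

/-- The morphism `m : X ⟶ Z₀`, seen as a morphism to the first object of `(Z₀, …, Zₙ)`. -/
def initHead {n : ℕ} {X : C} {Z : Fin (n + 2) → C} (m : X ⟶ Z 0) : X ⟶ initObj Z 0 := m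

theorem word_eq_snoc {n : ℕ} {X : C} (Z : Fin (n + 2) → C) (m : X ⟶ Z 0)
    (a : ∀ i : Fin (n + 1), Z i.castSucc ⟶ Z i.succ) :
    word K Z m a = snoc n (word K (initObj Z) (initHead m) (initArrow a)) (lastArrow a) := by
  induction n generalizing X with
  | zero => rfl
  | succ n ih =>
    refine (congrArg (cons K m) (ih (tailObj Z) (firstArrow a) (tailArrow a))).trans ?_
    exact (snoc_cons _ _ _).symm

/-! ### Inner faces of words -/

/-- The string of composites of `a` along a monotone map `σ`. -/
noncomputable def subArrow {n k : ℕ} {Z : Fin (n + 1) → C}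
    (a : ∀ i : Fin n, Z i.castSucc ⟶ Z i.succ) (σ : Fin (k + 1) → Fin (n + 1))
    (hσ : Monotone σ) : ∀ j : Fin k, (Z ∘ σ) j.castSucc ⟶ (Z ∘ σ) j.succ :=
  fun j => pathHom Z a (hσ (Fin.castSucc_lt_succ (i := j)).le)

variable (K) in
/-- The string `m ⊗ b₁ ⊗ ⋯ ⊗ bₖ`, with its last letter multiplied by `c`, for the string `b` of
composites of `a` along a monotone map `σ`. -/
noncomputable def subWord {n k : ℕ} {X Y : C} {Z : Fin (n + 1) → C}
    (a : ∀ i : Fin n, Z i.castSucc ⟶ Z i.succ) (σ : Fin (k + 1) → Fin (n + 1))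
    (hσ : Monotone σ) (m : X ⟶ (Z ∘ σ) 0) (c : (Z ∘ σ) (Fin.last k) ⟶ Y) : Bar K k X Y :=
  rmul k c (word K (Z ∘ σ) m (subArrow a σ hσ))

theorem subWord_congr {n k : ℕ} {X Y : C} {Z : Fin (n + 1) → C}
    (a : ∀ i : Fin n, Z i.castSucc ⟶ Z i.succ) {σ τ : Fin (k + 1) → Fin (n + 1)}
    (hσ : Monotone σ) (hτ : Monotone τ) (h : σ = τ) (m : X ⟶ (Z ∘ σ) 0)
    (c : (Z ∘ σ) (Fin.last k) ⟶ Y) :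
    subWord K a σ hσ m c = subWord K a τ hτ (m ≫ eqToHom (by rw [h])) (eqToHom (by rw [h]) ≫ c) := by
  subst h
  simp

theorem subWord_succ {n k : ℕ} {X Y : C} {Z : Fin (n + 1) → C}
    (a : ∀ i : Fin n, Z i.castSucc ⟶ Z i.succ) (σ : Fin (k + 2) → Fin (n + 1))
    (hσ : Monotone σ) (m : X ⟶ (Z ∘ σ) 0) (c : (Z ∘ σ) (Fin.last (k + 1)) ⟶ Y) :
    subWord K a σ hσ m c = cons K m (subWord K a (σ ∘ Fin.succ)
      (hσ.comp (Fin.strictMono_succ).monotone) (pathHom Z a (hσ (Fin.zero_le 1))) c) :=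
  rmul_cons _ _ _

theorem pathHom_tail {n : ℕ} {Z : Fin (n + 2) → C}
    (a : ∀ i : Fin (n + 1), Z i.castSucc ⟶ Z i.succ) {x y : Fin (n + 1)} (h : x ≤ y) :
    pathHom (tailObj Z) (tailArrow a) h = pathHom Z a (Fin.succ_le_succ_iff.2 h) := by
  induction y using Fin.induction with
  | zero =>
    obtain rfl : x = 0 := le_antisymm h (Fin.zero_le x)
    rw [pathHom_self]
    exact (pathHom_self Z a _).symm
  | succ y ih =>
    rcases h.eq_or_lt with rfl | hlt
    · rw [pathHom_self]
      exact (pathHom_self Z a _).symm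
    · have hx : x ≤ y.castSucc := Fin.le_castSucc_iff.2 hlt
      rw [pathHom_trans _ _ hx Fin.castSucc_lt_succ.le, ih hx, pathHom_succ]
      refine Eq.trans ?_ (pathHom_trans Z a (Fin.succ_le_succ_iff.2 hx)
        (Fin.succ_le_succ_iff.2 Fin.castSucc_lt_succ.le)).symm
      exact congrArg _ (pathHom_succ Z a y.succ Fin.castSucc_lt_succ.le).symm

theorem subWord_tail {n k : ℕ} {X Y : C} {Z : Fin (n + 2) → C}
    (a : ∀ i : Fin (n + 1), Z i.castSucc ⟶ Z i.succ) (σ : Fin (k + 1) → Fin (n + 1))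
    (hσ : Monotone σ) (m : X ⟶ (tailObj Z ∘ σ) 0)
    (c : (tailObj Z ∘ σ) (Fin.last k) ⟶ Y) :
    subWord K (tailArrow a) σ hσ m c =
      subWord K a (Fin.succ ∘ σ) (Fin.strictMono_succ.monotone.comp hσ) m c := by
  have h : subArrow (tailArrow a) σ hσ = subArrow a (Fin.succ ∘ σ)
      (Fin.strictMono_succ.monotone.comp hσ) := funext fun j => pathHom_tail a _
  exact congrArg (fun b => rmul k c (word K (tailObj Z ∘ σ) m b)) h

theorem subWord_id {n : ℕ} {X : C} {Z : Fin (n + 1) → C}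
    (a : ∀ i : Fin n, Z i.castSucc ⟶ Z i.succ) (m : X ⟶ Z 0) :
    subWord K a id monotone_id m (𝟙 _) = word K Z m a := by
  have h : subArrow a id monotone_id = a := funext fun j => pathHom_succ Z a j _
  exact (rmul_id _ _).trans (congrArg (word K Z m) h)

theorem cons_eqToHom {n : ℕ} {X Z Z' Y : C} (a : X ⟶ Z) (h : Z = Z') (w : Bar K n Z' Y) :
    cons K (a ≫ eqToHom h) w = cons K a (lmul n (eqToHom h) w) := by
  subst h
  simp

theorem lmul_subWord {n k : ℕ} {X' X Y : C} {Z : Fin (n + 1) → C}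
    (a : ∀ i : Fin n, Z i.castSucc ⟶ Z i.succ) (σ : Fin (k + 1) → Fin (n + 1))
    (hσ : Monotone σ) (b : X' ⟶ X) (m : X ⟶ (Z ∘ σ) 0) (c : (Z ∘ σ) (Fin.last k) ⟶ Y) :
    lmul k b (subWord K a σ hσ m c) = subWord K a σ hσ (b ≫ m) c := by
  rw [subWord, subWord, ← rmul_lmul, lmul_word]

theorem pathHom_eqToHom {n : ℕ} (Z : Fin (n + 1) → C)
    (a : ∀ i : Fin n, Z i.castSucc ⟶ Z i.succ) {x x' y y' : Fin (n + 1)} (h : x ≤ y)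
    (hx : x' = x) (hy : y = y') (h₁ : Z x' = Z x) (h₂ : Z y = Z y') :
    eqToHom h₁ ≫ pathHom Z a h ≫ eqToHom h₂ = pathHom Z a (hx.trans_le (h.trans_eq hy)) := by
  subst hx hy
  simp

theorem rmul_word_merge {n : ℕ} {X : C} (Z : Fin (n + 3) → C) (m : X ⟶ Z 0)
    (a : ∀ i : Fin (n + 2), Z i.castSucc ⟶ Z i.succ) (i : Fin (n + 1))
    (τ : Fin (n + 1) → Fin (n + 3)) (h : i.castSucc.succ.succAbove ∘ Fin.succ = τ)
    (hτ : Monotone τ) (hl : (Z ∘ τ) (Fin.last n) = Z (Fin.last (n + 2))) :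
    rmul (n + 1) (eqToHom (mergeObj_last Z i))
        (word K (mergeObj Z i) (m ≫ eqToHom (mergeObj_zero Z i).symm) (mergeArrow i a)) =
      cons K m (subWord K a τ hτ (pathHom Z a (Fin.zero_le (τ 0))) (eqToHom hl)) := by
  have hσ : Monotone (i.castSucc.succ.succAbove) :=
    (Fin.strictMono_succAbove i.castSucc.succ).monotone
  have h₀ : i.castSucc.succ.succAbove 0 = 0 := Fin.ext (by rw [val_succAbove]; simp)
  have h₁ : (Z ∘ i.castSucc.succ.succAbove) (Fin.last (n + 1)) = Z (Fin.last (n + 2)) :=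
    mergeObj_last Z i
  have h₂ : Z 0 = (Z ∘ i.castSucc.succ.succAbove) 0 := (mergeObj_zero Z i).symm
  change subWord K a _ hσ (m ≫ eqToHom h₂) (eqToHom h₁) = _
  rw [subWord_succ, cons_eqToHom, lmul_subWord, subWord_congr a _ hτ h, Category.assoc]
  congr 2
  · exact pathHom_eqToHom Z a (hσ (Fin.zero_le 1)) h₀.symm (congrFun h 0) _ _
  · exact eqToHom_trans _ _

theorem face_word {n : ℕ} {X : C} (Z : Fin (n + 2) → C) (m : X ⟶ Z 0)
    (a : ∀ i : Fin (n + 1), Z i.castSucc ⟶ Z i.succ) (i : Fin n) :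
    face (i + 1) n (word K Z m a) = rmul n (eqToHom (mergeObj_last Z i))
      (word K (mergeObj Z i) (m ≫ eqToHom (mergeObj_zero Z i).symm) (mergeArrow i a)) := by
  induction n generalizing X with
  | zero => exact i.elim0
  | succ n ih =>
    cases i using Fin.cases with
    | zero =>
      have h : (Fin.castSucc (0 : Fin (n + 1))).succ.succAbove ∘ Fin.succ =
          Fin.succ ∘ Fin.succ := by
        funext j
        refine Fin.ext ?_
        rw [Function.comp_apply, val_succAbove]
        simp
      rw [rmul_word_merge Z m a 0 _ h (Fin.strictMono_succ.comp Fin.strictMono_succ).monotone rfl]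
      refine (face_succ_cons 0 m _).trans (congrArg (cons K m) ?_)
      refine (face_zero_cons _ _).trans ((lmul_word (firstArrow a) (tailObj (tailObj Z))
        (firstArrow (tailArrow a)) (tailArrow (tailArrow a))).trans ?_)
      refine Eq.trans ?_ (subWord_tail a Fin.succ Fin.strictMono_succ.monotone
        (pathHom Z a (Fin.zero_le (Fin.succ (Fin.succ 0)))) (𝟙 _))
      refine Eq.trans ?_ (subWord_tail (tailArrow a) id monotone_id
        (pathHom Z a (Fin.zero_le (Fin.succ (Fin.succ 0)))) (𝟙 _))
      refine Eq.trans ?_ (subWord_id (tailArrow (tailArrow a))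
        (pathHom Z a (Fin.zero_le (Fin.succ (Fin.succ 0))))).symm
      refine congrArg (fun b => word K (tailObj (tailObj Z)) b (tailArrow (tailArrow a))) ?_
      refine Eq.trans ?_ (pathHom_trans Z a (x := 0) (y := Fin.succ 0) (z := Fin.succ (Fin.succ 0))
        (Fin.zero_le _) (Fin.succ_le_succ_iff.2 (Fin.zero_le _))).symm
      exact congrArg₂ (fun (b : Z 0 ⟶ Z (Fin.succ 0)) (c : Z (Fin.succ 0) ⟶ Z (Fin.succ (Fin.succ 0)))
        => b ≫ c) (pathHom_succ Z a 0 (Fin.zero_le _)).symm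
        (pathHom_succ Z a (Fin.succ 0) Fin.castSucc_lt_succ.le).symm
    | succ i =>
      have hm : Monotone (i.castSucc.succ.succAbove) :=
        (Fin.strictMono_succAbove i.castSucc.succ).monotone
      have h : (Fin.castSucc i.succ).succ.succAbove ∘ Fin.succ =
          Fin.succ ∘ i.castSucc.succ.succAbove := by
        funext j
        refine Fin.ext ?_
        simp only [Function.comp_apply, val_succAbove, Fin.val_succ, Fin.val_castSucc]
        split_ifs <;> omega
      have hl : (Z ∘ (Fin.succ ∘ i.castSucc.succ.succAbove)) (Fin.last n) = Z (Fin.last (n + 2)) :=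
        mergeObj_last (tailObj Z) i
      rw [rmul_word_merge Z m a i.succ _ h (Fin.strictMono_succ.monotone.comp hm) hl]
      refine (face_succ_cons (i + 1) m _).trans (congrArg (cons K m) ?_)
      refine (ih (tailObj Z) (firstArrow a) (tailArrow a) i).trans ?_
      refine Eq.trans ?_ (subWord_tail a _ hm (pathHom Z a (Fin.zero_le _)) (eqToHom hl))
      have h₀ : i.castSucc.succ.succAbove 0 = 0 := Fin.ext (by rw [val_succAbove]; simp)
      refine congrArg (fun b => rmul n (eqToHom hl) (word K (mergeObj (tailObj Z) i) b
        (mergeArrow i (tailArrow a)))) ?_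
      have e := pathHom_eqToHom Z a (x := 0) (x' := 0) (y := Fin.succ 0)
        (y' := Fin.succ (i.castSucc.succ.succAbove 0)) (Fin.zero_le _) rfl
        (congrArg Fin.succ h₀.symm) rfl (congrArg (Z ∘ Fin.succ) h₀.symm)
      refine Eq.trans ?_ e
      rw [eqToHom_refl, Category.id_comp]
      exact congrArg (fun b : Z 0 ⟶ Z (Fin.succ 0) => b ≫ eqToHom (congrArg (Z ∘ Fin.succ) h₀.symm))
        (pathHom_succ Z a 0 (Fin.zero_le _)).symm

end Bar

end Words

/-! ### Hochschild chains as closed strings -/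

section Closed

variable (K : Type u) [Field K] (C : Type u) [Category.{u} C] [Preadditive C] [Linear K C]

/-- The space of closed strings `(a₀, …, aₙ)`: the source of `a₀` is the target of `aₙ`. -/
abbrev Closed (n : ℕ) : Type u := ⨁ X : C, Bar K n X X

namespace Closed

variable {K C}

open scoped Classical in
/-- A string from `X` to `X` as a closed string. -/
noncomputable def mk {n : ℕ} (X : C) : Bar K n X X →ₗ[K] Closed K C n :=
  DirectSum.lof K C (fun X => Bar K n X X) X

open scoped Classical in
theorem hom_ext {n : ℕ} {W : Type*} [AddCommGroup W] [Module K W] {f g : Closed K C n →ₗ[K] W}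
    (h : ∀ X w, f (mk X w) = g (mk X w)) : f = g :=
  DirectSum.linearMap_ext K fun X => LinearMap.ext fun w => h X w

open scoped Classical in
/-- The linear map on closed strings with given restrictions to the strings from `X` to `X`. -/
noncomputable def lift {n : ℕ} {W : Type*} [AddCommGroup W] [Module K W]
    (f : ∀ X : C, Bar K n X X →ₗ[K] W) : Closed K C n →ₗ[K] W :=
  DirectSum.toModule K C W f

@[simp]
theorem lift_mk {n : ℕ} {W : Type*} [AddCommGroup W] [Module K W]
    (f : ∀ X : C, Bar K n X X →ₗ[K] W) (X : C) (w : Bar K n X X) : lift f (mk X w) = f X w := by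
  classical
  exact DirectSum.toModule_lof K (M := fun X => Bar K n X X) X w

/-- The map of closed strings induced by maps of strings. -/
noncomputable def map {n m : ℕ} (f : ∀ X : C, Bar K n X X →ₗ[K] Bar K m X X) :
    Closed K C n →ₗ[K] Closed K C m :=
  lift fun X => mk X ∘ₗ f X

@[simp]
theorem map_mk {n m : ℕ} (f : ∀ X : C, Bar K n X X →ₗ[K] Bar K m X X) (X : C)
    (w : Bar K n X X) : map f (mk X w) = mk X (f X w) :=
  lift_mk _ X w

theorem mk_eqToHom {n : ℕ} {X Y : C} (h : X = Y) (w : Bar K n Y X) :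
    mk X (Bar.lmul n (eqToHom h) w) = mk Y (Bar.rmul n (eqToHom h) w) := by
  subst h
  simp

theorem word_ext {n : ℕ} {W : Type u} [AddCommGroup W] [Module K W] {f g : Closed K C n →ₗ[K] W}
    (h : ∀ (Z : Fin (n + 1) → C) (m : Z (Fin.last n) ⟶ Z 0)
      (a : ∀ i : Fin n, Z i.castSucc ⟶ Z i.succ),
      f (mk _ (Bar.word K Z m a)) = g (mk _ (Bar.word K Z m a))) : f = g := by
  refine hom_ext fun X w => ?_
  -- A linear map on strings from `X` to `X` is extended to strings from `X` to any `Y` by letting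
  -- its values be functions of a morphism `Y ⟶ X`.
  have key := Bar.hom_ext_word (X := X) (W := fun Y => (Y ⟶ X) →ₗ[K] W)
    (f := fun Y => ((Bar.lmul n : (Y ⟶ X) →ₗ[K] Bar K n X Y →ₗ[K] Bar K n Y Y).compr₂
      (f ∘ₗ mk Y)).flip)
    (g := fun Y => ((Bar.lmul n : (Y ⟶ X) →ₗ[K] Bar K n X Y →ₗ[K] Bar K n Y Y).compr₂
      (g ∘ₗ mk Y)).flip) fun Z m a => LinearMap.ext fun c => by
        simp only [LinearMap.flip_apply, LinearMap.compr₂_apply, LinearMap.comp_apply,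
          Bar.lmul_word]
        exact h Z (c ≫ m) a
  have := LinearMap.congr_fun (LinearMap.congr_fun (congrFun key X) w) (𝟙 X)
  simpa using this

end Closed

variable [SuperCategory K C]

open scoped Classical in
theorem Chain.hom_ext {n : ℕ} {W : Type*} [AddCommGroup W] [Module K W]
    {f g : Chain K C n →ₗ[K] W} (h : ∀ (Z : Fin (n + 1) → C) (m : Z (Fin.last n) ⟶ Z 0)
      (a : ∀ i : Fin n, Z i.castSucc ⟶ Z i.succ),
      f (Chain.mk K C Z m a) = g (Chain.mk K C Z m a)) :
    f = g := by
  refine DirectSum.linearMap_ext K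
    (M := fun Z : Fin (n + 1) → C => (Z (Fin.last n) ⟶ Z 0) ⊗[K] Nerve K Z) fun Z => ?_
  refine TensorProduct.ext (LinearMap.ext fun m => PiTensorProduct.ext ?_)
  exact MultilinearMap.ext fun a => h Z m a

/-- The identification of Hochschild chains with closed strings, as a linear map. -/
noncomputable def toClosed (n : ℕ) : Chain K C n →ₗ[K] Closed K C n :=
  Chain.lift K C (fun Z m a => Closed.mk _ (Bar.word K Z m a))
    (fun Z a => ⟨Closed.mk _ ∘ₗ Bar.wordHead K _ Z a, fun _ => rfl⟩)
    (fun Z m a k => by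
      obtain ⟨L, hL⟩ := Bar.word_update (K := K) Z m a k
      exact ⟨Closed.mk _ ∘ₗ L, fun v => by rw [hL]; rfl⟩)

theorem toClosed_mk {n : ℕ} (Z : Fin (n + 1) → C) (m : Z (Fin.last n) ⟶ Z 0)
    (a : ∀ i : Fin n, Z i.castSucc ⟶ Z i.succ) :
    toClosed K C n (Chain.mk K C Z m a) = Closed.mk _ (Bar.word K Z m a) :=
  Chain.lift_mk K C _ _ _ Z m a

theorem exists_ofClosed (n : ℕ) : ∃ L : Closed K C n →ₗ[K] Chain K C n,
    ∀ Z m a, L (Closed.mk _ (Bar.word K Z m a)) = Chain.mk K C Z m a := by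
  have key : ∀ X : C, ∃ L : ∀ Y, Bar K n X Y →ₗ[K] ((Y ⟶ X) →ₗ[K] Chain K C n),
      ∀ Z m a, L _ (Bar.word K Z m a) =
        Chain.mkHead K C Z a ∘ₗ Linear.rightComp K _ m := fun X => by
    refine Bar.exists_wordLift (W := fun Y => (Y ⟶ X) →ₗ[K] Chain K C n)
      (fun Z m a => Chain.mkHead K C Z a ∘ₗ Linear.rightComp K _ m) (fun Z a => ?_)
      fun Z m a k => ?_
    · exact ⟨(Linear.comp (Z (Fin.last n)) X (Z 0)).flip.compr₂ (Chain.mkHead K C Z a),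
        fun m => rfl⟩
    · refine ⟨{ toFun := fun v => Chain.mkHead K C Z (Function.update a k v) ∘ₗ
          Linear.rightComp K _ m, map_add' := fun v w => ?_, map_smul' := fun r v => ?_ },
        fun v => rfl⟩
      · exact LinearMap.ext fun c => map_add (Chain.mkArrow K C Z (c ≫ m) a k) v w
      · exact LinearMap.ext fun c => map_smul (Chain.mkArrow K C Z (c ≫ m) a k) r v
  choose L hL using key
  refine ⟨Closed.lift fun X => (L X X).flip (𝟙 X), fun Z m a => ?_⟩
  rw [Closed.lift_mk, LinearMap.flip_apply, hL]
  change Chain.mk K C Z (𝟙 _ ≫ m) a = _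
  rw [Category.id_comp]

/-- Hochschild chains are closed strings. -/
noncomputable def closedEquiv (n : ℕ) : Chain K C n ≃ₗ[K] Closed K C n :=
  LinearEquiv.ofLinearMap (toClosed K C n) (exists_ofClosed K C n).choose
    (Closed.word_ext fun Z m a => by
      rw [LinearMap.comp_apply, (exists_ofClosed K C n).choose_spec, toClosed_mk]; rfl)
    (Chain.hom_ext K C fun Z m a => by
      rw [LinearMap.comp_apply, toClosed_mk, (exists_ofClosed K C n).choose_spec]; rfl)

theorem closedEquiv_mk {n : ℕ} (Z : Fin (n + 1) → C) (m : Z (Fin.last n) ⟶ Z 0)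
    (a : ∀ i : Fin n, Z i.castSucc ⟶ Z i.succ) :
    closedEquiv K C n (Chain.mk K C Z m a) = Closed.mk _ (Bar.word K Z m a) :=
  toClosed_mk K C Z m a

variable {K C}

theorem closedEquiv_faceZero {n : ℕ} (x : Chain K C (n + 1)) :
    closedEquiv K C n (faceZero K C n x) =
      Closed.map (fun _ => Bar.face 0 n) (closedEquiv K C (n + 1) x) := by
  revert x
  refine LinearMap.congr_fun (f := (closedEquiv K C n).toLinearMap ∘ₗ faceZero K C n)
    (g := Closed.map (fun _ => Bar.face 0 n) ∘ₗ (closedEquiv K C (n + 1)).toLinearMap)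
    (Chain.hom_ext K C fun Z m a => ?_)
  simp only [LinearMap.comp_apply, LinearEquiv.coe_coe, closedEquiv_mk, Closed.map_mk]
  rw [faceZero, Chain.lift_mk, closedEquiv_mk, Bar.word_succ]
  refine congrArg (Closed.mk (Z (Fin.last (n + 1)))) ?_
  exact ((Bar.face_zero_cons _ _).trans (Bar.lmul_word _ _ _ _)).symm

theorem closedEquiv_faceInner {n : ℕ} (i : Fin n) (x : Chain K C (n + 1)) :
    closedEquiv K C n (faceInner K C n i x) =
      Closed.map (fun _ => Bar.face (i + 1) n) (closedEquiv K C (n + 1) x) := by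
  revert x
  refine LinearMap.congr_fun (f := (closedEquiv K C n).toLinearMap ∘ₗ faceInner K C n i)
    (g := Closed.map (fun _ => Bar.face (i + 1) n) ∘ₗ (closedEquiv K C (n + 1)).toLinearMap)
    (Chain.hom_ext K C fun Z m a => ?_)
  simp only [LinearMap.comp_apply, LinearEquiv.coe_coe, closedEquiv_mk, Closed.map_mk]
  rw [faceInner, Chain.lift_mk, closedEquiv_mk, Bar.face_word, ← Closed.mk_eqToHom, Bar.lmul_word]

theorem closedEquiv_barBoundary {n : ℕ} (x : Chain K C (n + 1)) :
    closedEquiv K C n (barBoundary K C n x) =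
      Closed.map (fun X => Bar.diff K n X X) (closedEquiv K C (n + 1) x) := by
  have h : Closed.map (fun X : C => Bar.diff K n X X) =
      ∑ i ∈ Finset.range (n + 1), ((-1 : K) ^ i) • Closed.map (fun _ => Bar.face i n) := by
    refine Closed.hom_ext fun X w => ?_
    simp [Bar.diff, LinearMap.sum_apply, map_sum]
  rw [h, barBoundary, Finset.sum_range_succ', Finset.sum_range]
  simp only [LinearMap.add_apply, LinearMap.sum_apply, LinearMap.smul_apply, map_add, map_sum,
    map_smul, closedEquiv_faceZero, closedEquiv_faceInner]
  rw [pow_zero, one_smul, add_comm]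

namespace Closed

/-- The rotation `(a₀, …, aₙ₊₁) ↦ (-1)^{|aₙ₊₁| (|a₀| + ⋯ + |aₙ|)} (aₙ₊₁, a₀, …, aₙ)` of closed
strings. -/
noncomputable def rot (n : ℕ) : Closed K C (n + 1) →ₗ[K] Closed K C (n + 1) :=
  lift fun X => Bar.snocLift n fun Z => ∑ q : ZMod 2,
    (((Bar.cons K : (Z ⟶ X) →ₗ[K] Bar K n X Z →ₗ[K] Bar K (n + 1) Z Z).compl₁₂
      (proj K q Z X) (Bar.signBar q n X Z)).compr₂ (mk Z)).flip

theorem rot_mk_snoc {n : ℕ} {X Z : C} (w : Bar K n X Z) (c : Z ⟶ X) :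
    rot n (mk X (Bar.snoc n w c)) =
      ∑ q : ZMod 2, mk Z (Bar.cons K (proj K q Z X c) (Bar.signBar q n X Z w)) := by
  simp only [rot, lift_mk, Bar.snocLift_snoc, LinearMap.sum_apply, LinearMap.flip_apply,
    LinearMap.compr₂_apply, LinearMap.compl₁₂_apply]

end Closed

theorem Bar.signBar_word {q : ZMod 2} {n : ℕ} {X : C} (Z : Fin (n + 1) → C) (m : X ⟶ Z 0)
    (a : ∀ i : Fin n, Z i.castSucc ⟶ Z i.succ) :
    Bar.signBar q n X _ (Bar.word K Z m a) =
      Bar.word K Z (signMap K q _ _ m) fun i => signMap K q _ _ (a i) := by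
  induction n generalizing X with
  | zero => rfl
  | succ n ih =>
    refine (Bar.signBar_cons _ _ _).trans (congrArg _ ?_)
    exact ih (tailObj Z) (firstArrow a) (tailArrow a)

theorem closedEquiv_rotate {n : ℕ} (x : Chain K C (n + 1)) :
    closedEquiv K C (n + 1) (rotate K C n x) =
      Closed.rot n (closedEquiv K C (n + 1) x) := by
  revert x
  refine LinearMap.congr_fun (f := (closedEquiv K C (n + 1)).toLinearMap ∘ₗ rotate K C n)
    (g := Closed.rot n ∘ₗ (closedEquiv K C (n + 1)).toLinearMap)
    (Chain.hom_ext K C fun Z m a => ?_)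
  simp only [LinearMap.comp_apply, LinearEquiv.coe_coe, closedEquiv_mk]
  rw [rotate, Chain.lift_mk, map_sum, Bar.word_eq_snoc]
  refine Eq.trans ?_ (Closed.rot_mk_snoc _ _).symm
  refine Finset.sum_congr rfl fun q _ => ?_
  rw [closedEquiv_mk]
  refine congrArg (Closed.mk (Z (Fin.last n).castSucc)) ?_
  refine congrArg (Bar.cons K _) ?_
  exact (Bar.signBar_word _ _ _).symm

end Closed

/-! ### Parities of closed strings -/

section ClosedParity

variable {K : Type u} [Field K] {C : Type u} [Category.{u} C] [Preadditive C] [Linear K C]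
  [SuperCategory K C]

namespace Bar

theorem word_mem_part {S : Set C} {n : ℕ} {X : C} {Z : Fin (n + 1) → C} {m : X ⟶ Z 0}
    {a : ∀ i : Fin n, Z i.castSucc ⟶ Z i.succ} (hZ : ∀ i : Fin n, Z i.castSucc ∈ S) {q : ZMod 2}
    {ε : Fin n → ZMod 2} (hm : m ∈ SuperCategory.deg (K := K) X (Z 0) q)
    (ha : ∀ i, a i ∈ SuperCategory.deg (K := K) (Z i.castSucc) (Z i.succ) (ε i)) :
    word K Z m a ∈ part S n (q + ∑ i, ε i) X (Z (Fin.last n)) := by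
  induction n generalizing X q with
  | zero =>
    rw [Fin.sum_univ_zero, add_zero]
    exact of_mem_part hm
  | succ n ih =>
    rw [Fin.sum_univ_succ]
    exact cons_mem_part (hZ 0) hm (ih (Z := tailObj Z) (m := firstArrow a) (a := tailArrow a)
      (fun i => hZ i.succ) (ha 0) fun i => ha i.succ)

theorem word_mem_sup_part {S : Set C} {n : ℕ} {X : C} {Z : Fin (n + 1) → C} (m : X ⟶ Z 0)
    (a : ∀ i : Fin n, Z i.castSucc ⟶ Z i.succ) (hZ : ∀ i : Fin n, Z i.castSucc ∈ S) :
    word K Z m a ∈ part S n 0 X (Z (Fin.last n)) ⊔ part S n 1 X (Z (Fin.last n)) := by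
  induction n generalizing X with
  | zero => exact of_mem_sup_part m
  | succ n ih =>
    exact cons_mem_sup_part (hZ 0) m (ih (Z := tailObj Z) (firstArrow a) (tailArrow a)
      fun i => hZ i.succ)

/-- The strings of parity `p` with inner objects in `S` are spanned by the words of homogeneous
morphisms with inner objects in `S`. -/
theorem part_le_of_word {S : Set C} {n : ℕ} {p : ZMod 2} {X : C}
    {N : ∀ Y, Submodule K (Bar K n X Y)}
    (h : ∀ (Z : Fin (n + 1) → C) (m : X ⟶ Z 0) (a : ∀ i : Fin n, Z i.castSucc ⟶ Z i.succ)
      (q : ZMod 2) (ε : Fin n → ZMod 2), (∀ i : Fin n, Z i.castSucc ∈ S) → m ∈ SuperCategory.deg (K := K) X (Z 0) q →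
      (∀ i, a i ∈ SuperCategory.deg (K := K) (Z i.castSucc) (Z i.succ) (ε i)) →
      q + ∑ i, ε i = p → word K Z m a ∈ N _) (Y : C) : part S n p X Y ≤ N Y := by
  induction n generalizing X p with
  | zero =>
    exact part_zero_le fun a ha => h (fun _ => Y) a (fun i => i.elim0) p (fun i => i.elim0)
      (fun i => i.elim0) ha (fun i => i.elim0) (by simp)
  | succ n ih =>
    refine part_succ_le fun U hU q q' hq a ha w hw => ?_
    refine ih (N := fun Y => (N Y).comap (cons K a)) (fun Z m b i ε hZ hm hb hi => ?_) hw
    refine h (consObj U Z) a (consArrow m b) q (Fin.cons i ε) (fun j => ?_) ha (fun j => ?_) ?_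
    · cases j using Fin.cases with
      | zero => exact hU
      | succ j => exact hZ j
    · cases j using Fin.cases with
      | zero => exact hm
      | succ j => exact hb j
    · rw [Fin.sum_univ_succ]
      simpa [hi] using hq

/-- The projection of a string onto its component of parity `p`. -/
noncomputable def projBar : ∀ (n : ℕ) (_ : ZMod 2) (X Y : C), Bar K n X Y →ₗ[K] Bar K n X Y
  | 0, p, X, Y => (of K).toLinearMap ∘ₗ proj K p X Y ∘ₗ (of K).symm.toLinearMap
  | n + 1, p, X, Y => lift fun Z => ∑ q : ZMod 2,
      (cons K).compl₁₂ (proj K q X Z) (projBar n (p + q) Z Y)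

theorem projBar_of_mem {S : Set C} {n : ℕ} {p : ZMod 2} {X Y : C} {w : Bar K n X Y}
    (hw : w ∈ part S n p X Y) (p' : ZMod 2) :
    projBar n p' X Y w = if p' = p then w else 0 := by
  have : part S n p X Y ≤ LinearMap.eqLocus (projBar n p' X Y)
      (if p' = p then LinearMap.id else 0 : Bar K n X Y →ₗ[K] Bar K n X Y) := by
    clear hw w
    induction n generalizing X p p' with
    | zero =>
      refine part_zero_le fun a ha => ?_
      have : projBar 0 p' X Y (of K a) = of K (proj K p' X Y a) := rfl
      rw [LinearMap.mem_eqLocus, this, proj_of_mem ha]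
      split_ifs <;> simp
    | succ n ih =>
      refine part_succ_le fun Z hZ i j hp a ha w hw => ?_
      have h : ∀ q, projBar n q Z Y w = if q = j then w else 0 := fun q => by
        have := ih (p' := q) hw
        rw [LinearMap.mem_eqLocus] at this
        rw [this]
        split_ifs <;> simp
      rw [LinearMap.mem_eqLocus, projBar, lift_cons, LinearMap.sum_apply, LinearMap.sum_apply]
      simp only [LinearMap.compl₁₂_apply, h, proj_of_mem ha]
      rw [Finset.sum_eq_single i]
      · have e : p' + i = j ↔ p' = p := by
          clear h ha a hw w
          revert hp i j p p'
          decide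
        simp only [if_true, e]
        split_ifs <;> simp
      · intro q _ hq
        rw [if_neg hq]
        simp
      · simp
  have h := this hw
  rw [LinearMap.mem_eqLocus] at h
  rw [h]
  split_ifs <;> simp

end Bar

namespace Closed

variable (K) in
/-- The span of the closed strings `(a₀, …, aₙ)` of homogeneous morphisms of total parity `p` all
of whose objects lie in `S`. -/
noncomputable def part (S : Set C) (n : ℕ) (p : ZMod 2) : Submodule K (Closed K C n) :=
  ⨆ X : S, (Bar.part S n p X.1 X.1).map (mk X.1)

variable {S : Set C}

theorem mk_mem_part {n : ℕ} {p : ZMod 2} {X : C} (hX : X ∈ S) {w : Bar K n X X}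
    (hw : w ∈ Bar.part S n p X X) : mk X w ∈ part K S n p :=
  Submodule.mem_iSup_of_mem ⟨X, hX⟩ (Submodule.mem_map_of_mem hw)

theorem part_le {n : ℕ} {p : ZMod 2} {N : Submodule K (Closed K C n)}
    (h : ∀ X ∈ S, ∀ w ∈ Bar.part S n p X X, mk X w ∈ N) : part K S n p ≤ N :=
  iSup_le fun X => Submodule.map_le_iff_le_comap.2 (h X.1 X.2)

theorem part_mono {S' : Set C} (hS : S ⊆ S') (n : ℕ) (p : ZMod 2) :
    part K S n p ≤ part K S' n p :=
  part_le fun X hX _ hw => mk_mem_part (hS hX) (Bar.part_mono hS n p X X hw)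

theorem map_mem_part {n m : ℕ} {p : ZMod 2} {f : ∀ X : C, Bar K n X X →ₗ[K] Bar K m X X}
    (hf : ∀ X, ∀ w ∈ Bar.part S n p X X, f X w ∈ Bar.part S m p X X) {x : Closed K C n}
    (hx : x ∈ part K S n p) : map f x ∈ part K S m p := by
  refine part_le (N := (part K S m p).comap (map f)) (fun X hX w hw => ?_) hx
  rw [Submodule.mem_comap, map_mk]
  exact mk_mem_part hX (hf X w hw)

theorem rot_mem_part {n : ℕ} {p : ZMod 2} {x : Closed K C (n + 1)}
    (hx : x ∈ part K S (n + 1) p) : rot n x ∈ part K S (n + 1) p := by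
  refine part_le (N := (part K S (n + 1) p).comap (rot n)) (fun X hX w hw => ?_) hx
  refine Bar.part_le_of_snoc (N := (part K S (n + 1) p).comap (rot n ∘ₗ mk X))
    (fun Z hZ q q' hq w hw c hc => ?_) hw
  rw [Submodule.mem_comap, LinearMap.comp_apply, rot_mk_snoc]
  refine Submodule.sum_mem _ fun s _ => ?_
  rw [proj_of_mem hc, Bar.signBar_of_mem hw, map_smul, map_smul]
  refine Submodule.smul_mem _ _ ?_
  split_ifs
  · refine mk_mem_part hZ ?_
    rw [← hq, add_comm q]
    exact Bar.cons_mem_part hX hc hw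
  · simp

theorem mem_sup_part {n : ℕ} (x : Closed K C n) :
    x ∈ part K Set.univ n 0 ⊔ part K Set.univ n 1 := by
  have : (LinearMap.id : Closed K C n →ₗ[K] _).range ≤
      part K Set.univ n 0 ⊔ part K Set.univ n 1 := by
    rw [← Submodule.ker_mkQ (part K Set.univ n 0 ⊔ part K Set.univ n 1), LinearMap.range_le_ker_iff]
    refine hom_ext fun X w => ?_
    rw [LinearMap.comp_apply, LinearMap.id_apply, LinearMap.zero_apply, Submodule.mkQ_apply,
      Submodule.Quotient.mk_eq_zero]
    obtain ⟨w₀, h₀, w₁, h₁, rfl⟩ := Submodule.mem_sup.1 (Bar.mem_sup_part w)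
    rw [map_add]
    exact Submodule.add_mem_sup (mk_mem_part (Set.mem_univ X) h₀)
      (mk_mem_part (Set.mem_univ X) h₁)
  exact this ⟨x, rfl⟩

theorem projBar_of_mem {n : ℕ} {p : ZMod 2} {x : Closed K C n} (hx : x ∈ part K S n p)
    (p' : ZMod 2) : map (fun X => Bar.projBar n p' X X) x = if p' = p then x else 0 := by
  have : part K S n p ≤ LinearMap.eqLocus (map (fun X => Bar.projBar n p' X X))
      (if p' = p then LinearMap.id else 0 : Closed K C n →ₗ[K] Closed K C n) := by
    refine part_le fun X hX w hw => ?_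
    rw [LinearMap.mem_eqLocus, map_mk, Bar.projBar_of_mem hw]
    split_ifs <;> simp
  have h := this hx
  rw [LinearMap.mem_eqLocus] at h
  rw [h]
  split_ifs <;> simp

end Closed

theorem map_closedEquiv_chainPart (n : ℕ) (p : ZMod 2) :
    (chainPart K C n p).map (closedEquiv K C n).toLinearMap = Closed.part K Set.univ n p := by
  refine le_antisymm ?_ (Closed.part_le fun X _ w hw => ?_)
  · rw [Submodule.map_le_iff_le_comap]
    refine Submodule.span_le.2 ?_
    rintro _ ⟨Z, m, a, q, ε, hm, ha, rfl, rfl⟩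
    change closedEquiv K C n (Chain.mk K C Z m a) ∈ Closed.part K Set.univ n _
    rw [closedEquiv_mk]
    exact Closed.mk_mem_part (Set.mem_univ _) (Bar.word_mem_part (fun _ => Set.mem_univ _) hm ha)
  · have key := Bar.part_le_of_word (K := K) (S := Set.univ) (n := n) (p := p) (X := X)
      (N := fun Y => ⨅ h : Y = X, Submodule.comap (Closed.mk X ∘ₗ Bar.rmul n (eqToHom h))
        ((chainPart K C n p).map (closedEquiv K C n).toLinearMap))
      (fun Z m a q ε _ hm ha hp => by
        refine (Submodule.mem_iInf _).2 fun h => ?_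
        subst h
        rw [Submodule.mem_comap, LinearMap.comp_apply, eqToHom_refl, Bar.rmul_id,
          ← closedEquiv_mk]
        exact Submodule.mem_map_of_mem (Submodule.subset_span ⟨Z, m, a, q, ε, hm, ha, hp, rfl⟩)) X hw
    simpa using key

theorem mem_chainPart_iff {n : ℕ} {p : ZMod 2} {x : Chain K C n} :
    x ∈ chainPart K C n p ↔ closedEquiv K C n x ∈ Closed.part K Set.univ n p := by
  rw [← map_closedEquiv_chainPart]
  exact ((closedEquiv K C n).injective.mem_set_image (s := (chainPart K C n p : Set _))).symm

end ClosedParity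

/-! ### The cyclic structure of closed strings -/

section Cyclic

variable {K : Type u} [Field K] {C : Type u} [Category.{u} C] [Preadditive C] [Linear K C]
  [SuperCategory K C]

namespace Bar

/-- The concatenation `w ⊗ v` of a string of `i + 1` letters and a string of `j + 1` letters, as a
string of `N + 1` letters. -/
noncomputable def cat : ∀ (j i N : ℕ) (_ : i + j + 1 = N) {X Y Z : C},
    Bar K i X Y →ₗ[K] Bar K j Y Z →ₗ[K] Bar K N X Z
  | 0, i, _, h, _, _, _ => h ▸ (snoc i).compl₂ (of K).symm.toLinearMap
  | j + 1, i, N, h, X, _, Z => LinearMap.flip <| lift fun U =>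
      LinearMap.mk₂ K (fun a v => (LinearMap.flip (cat j (i + 1) N (by omega)) v).comp
          ((snoc i).flip a))
        (fun a a' v => by ext; simp) (fun r a v => by ext; simp)
        (fun a v v' => by ext; simp) (fun r a v => by ext; simp)

theorem cat_cons {j i N : ℕ} (h : i + (j + 1) + 1 = N) {X Y U Z : C} (w : Bar K i X Y) (a : Y ⟶ U)
    (v : Bar K j U Z) :
    cat (j + 1) i N h w (cons K a v) = cat j (i + 1) N (by omega) (snoc i w a) v := by
  rw [cat, LinearMap.flip_apply, lift_cons]
  rfl

theorem cat_snoc {j i N : ℕ} (h : i + j + 1 = N) {X Y U Z : C} (w : Bar K i X Y)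
    (v : Bar K j Y U) (c : U ⟶ Z) :
    cat (j + 1) i (N + 1) (by omega) w (snoc j v c) = snoc N (cat j i N h w v) c := by
  induction j generalizing i Y with
  | zero =>
    subst h
    induction v using induction_of with | of a => ?_
    rw [snoc_of, cat_cons]
    rfl
  | succ j ih =>
    induction v using induction_cons with
    | add v v' hv hv' => simp only [map_add, LinearMap.add_apply, hv, hv']
    | cons V a v => rw [snoc_cons, cat_cons, cat_cons, ih]

theorem cons_cat {j i N : ℕ} (h : i + j + 1 = N) {X U Y Z : C} (a : X ⟶ U) (w : Bar K i U Y)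
    (v : Bar K j Y Z) :
    cons K a (cat j i N h w v) = cat j (i + 1) (N + 1) (by omega) (cons K a w) v := by
  induction j generalizing i Y with
  | zero =>
    subst h
    induction v using induction_of with | of b => ?_
    exact (snoc_cons a w b).symm
  | succ j ih =>
    induction v using induction_cons with
    | add v v' hv hv' => simp only [map_add, hv, hv']
    | cons V b v => rw [cat_cons, cat_cons, ih, snoc_cons]

theorem cat_of_left {n : ℕ} {X Y Z : C} (a : X ⟶ Y) (v : Bar K n Y Z) :
    cat n 0 (n + 1) (by omega) (of K a) v = cons K a v := by
  induction n generalizing X Y with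
  | zero => rfl
  | succ n ih =>
    induction v using induction_cons with
    | add v v' hv hv' => simp only [map_add, hv, hv']
    | cons V b v => rw [cat_cons, snoc_of, ← cons_cat (i := 0) (by omega), ih]

theorem cat_mem_part {S : Set C} {i j N : ℕ} (h : i + j + 1 = N) {p q : ZMod 2} {X Y Z : C}
    (hY : Y ∈ S) {w : Bar K i X Y} (hw : w ∈ part S i p X Y) {v : Bar K j Y Z}
    (hv : v ∈ part S j q Y Z) : cat j i N h w v ∈ part S N (p + q) X Z := by
  rw [← Submodule.mem_comap]
  induction j generalizing i p q Y with
  | zero =>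
    subst h
    refine part_zero_le (N := Submodule.comap _ _) (fun c hc => ?_) hv
    rw [Submodule.mem_comap]
    exact snoc_mem_part hY hw hc
  | succ j ih =>
    refine part_succ_le (N := Submodule.comap _ _) (fun U hU s t hq a ha v hv => ?_) hv
    rw [Submodule.mem_comap, cat_cons, ← hq, ← add_assoc]
    exact ih _ hU (snoc_mem_part hY hw ha) hv

end Bar

namespace Closed

/-- The face of closed strings that composes the letters `i` and `i + 1`. -/
noncomputable def face (i n : ℕ) : Closed K C (n + 1) →ₗ[K] Closed K C n :=
  map fun _ => Bar.face i n

@[simp]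
theorem face_mk (i n : ℕ) (X : C) (w : Bar K (n + 1) X X) :
    face i n (mk X w) = mk X (Bar.face i n w) :=
  map_mk _ X w

variable (K C) in
/-- The differential `∑_{i ≤ n} (-1)ⁱ dᵢ` of closed strings, without the last face. -/
noncomputable def diff (n : ℕ) : Closed K C (n + 1) →ₗ[K] Closed K C n :=
  map fun X => Bar.diff K n X X

theorem diff_eq_sum (n : ℕ) :
    diff K C n = ∑ i ∈ Finset.range (n + 1), ((-1 : K) ^ i) • face i n := by
  refine hom_ext fun X w => ?_
  simp [diff, Bar.diff, LinearMap.sum_apply, map_sum]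

theorem diff_diff (n : ℕ) (x : Closed K C (n + 2)) : diff K C n (diff K C (n + 1) x) = 0 := by
  revert x
  refine LinearMap.congr_fun (f := diff K C n ∘ₗ diff K C (n + 1)) (g := 0)
    (hom_ext fun X w => ?_)
  simp [diff, Bar.diff_diff]

theorem face_face_zero (i n : ℕ) (x : Closed K C (n + 2)) :
    face i n (face 0 (n + 1) x) = face 0 n (face (i + 1) (n + 1) x) := by
  revert x
  refine LinearMap.congr_fun (f := face i n ∘ₗ face 0 (n + 1))
    (g := face 0 n ∘ₗ face (i + 1) (n + 1)) (hom_ext fun X w => ?_)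
  simp [Bar.face_face_zero]

theorem rot_mk_snoc_of_mem {n : ℕ} {X Z : C} (w : Bar K n X Z) {q : ZMod 2} {c : Z ⟶ X}
    (hc : c ∈ SuperCategory.deg (K := K) Z X q) :
    rot n (mk X (Bar.snoc n w c)) = mk Z (Bar.cons K c (Bar.signBar q n X Z w)) := by
  rw [rot_mk_snoc, Finset.sum_eq_single q]
  · rw [proj_of_mem hc, if_pos rfl]
  · intro s _ hs
    rw [proj_of_mem hc, if_neg hs]
    simp
  · simp

theorem snoc_ext {n : ℕ} {W : Type*} [AddCommGroup W] [Module K W]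
    {f g : Closed K C (n + 1) →ₗ[K] W}
    (h : ∀ (X Z : C) (w : Bar K n X Z) (q : ZMod 2) (c : Z ⟶ X),
      c ∈ SuperCategory.deg (K := K) Z X q →
      f (mk X (Bar.snoc n w c)) = g (mk X (Bar.snoc n w c))) : f = g := by
  refine hom_ext fun X w => ?_
  induction w using Bar.induction_snoc with
  | add w w' hw hw' => rw [map_add, map_add, map_add, hw, hw']
  | snoc Z w c =>
    have := hom_ext_deg (f := f ∘ₗ mk X ∘ₗ Bar.snoc n w) (g := g ∘ₗ mk X ∘ₗ Bar.snoc n w)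
      fun q c hc => h X Z w q c hc
    exact LinearMap.congr_fun this c

theorem face_succ_rot {i n : ℕ} (hi : i ≤ n) (x : Closed K C (n + 2)) :
    face (i + 1) (n + 1) (rot (n + 1) x) = rot n (face i (n + 1) x) := by
  revert x
  refine LinearMap.congr_fun (f := face (i + 1) (n + 1) ∘ₗ rot (n + 1))
    (g := rot n ∘ₗ face i (n + 1)) (snoc_ext fun X Z w q c hc => ?_)
  simp only [LinearMap.comp_apply]
  rw [rot_mk_snoc_of_mem w hc, face_mk, face_mk, Bar.face_succ_cons, Bar.face_snoc hi,
    rot_mk_snoc_of_mem _ hc, Bar.signBar_face]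

theorem face_zero_rot_rot (n : ℕ) (x : Closed K C (n + 2)) :
    face 0 (n + 1) (rot (n + 1) (rot (n + 1) x)) = rot n (face (n + 1) (n + 1) x) := by
  revert x
  refine LinearMap.congr_fun (f := face 0 (n + 1) ∘ₗ rot (n + 1) ∘ₗ rot (n + 1))
    (g := rot n ∘ₗ face (n + 1) (n + 1)) (snoc_ext fun X Z w q c hc => ?_)
  simp only [LinearMap.comp_apply]
  rw [rot_mk_snoc_of_mem w hc, face_mk, Bar.face_last_snoc]
  induction w using Bar.induction_snoc with
  | add w w' hw hw' => simp only [map_add, hw, hw']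
  | snoc U w b =>
    refine LinearMap.congr_fun (f := face 0 (n + 1) ∘ₗ rot (n + 1) ∘ₗ mk Z ∘ₗ
      Bar.cons K c ∘ₗ Bar.signBar q (n + 1) X Z ∘ₗ Bar.snoc n w)
      (g := rot n ∘ₗ mk X ∘ₗ Bar.rmul (n + 1) c ∘ₗ Bar.snoc n w)
      (hom_ext_deg fun s b hb => ?_) b
    simp only [LinearMap.comp_apply]
    rw [Bar.signBar_snoc, ← Bar.snoc_cons, signMap_of_mem hb, map_smul, map_smul, map_smul,
      map_smul, rot_mk_snoc_of_mem _ hb, Bar.rmul_snoc,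
      rot_mk_snoc_of_mem _ (SuperCategory.comp_mem hb hc), face_mk, Bar.face_zero_cons,
      Bar.signBar_cons, signMap_of_mem hc, Bar.lmul_cons, Bar.signBar_signBar]
    simp [smul_smul, mul_comm]

/-- The rotation by the length of `v` of a closed string `w ⊗ v`. -/
theorem rot_pow_cat {i j N : ℕ} (h : i + j + 1 = N + 1) {p q : ZMod 2} {X Y : C}
    {w : Bar K i X Y} (hw : w ∈ Bar.part Set.univ i p X Y) {v : Bar K j Y X}
    (hv : v ∈ Bar.part Set.univ j q Y X) :
    (rot N ^ (j + 1) : Module.End K (Closed K C (N + 1))) (mk X (Bar.cat j i (N + 1) h w v)) =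
      sign K (p * q) • mk Y (Bar.cat i j (N + 1) (by omega) v w) := by
  have sign_identity : ∀ p s t : ZMod 2, t * (p + s) + (t + p) * s = p * (s + t) := by decide
  induction j generalizing i p q X Y with
  | zero =>
    obtain ⟨c, hc, rfl⟩ := hv
    obtain rfl : i = N := by omega
    change rot i (mk X (Bar.snoc i w c)) = _
    rw [rot_mk_snoc_of_mem _ hc, Bar.signBar_of_mem hw, map_smul, map_smul, mul_comm]
    congr 2
    exact (Bar.cat_of_left c w).symm
  | succ j ih =>
    obtain ⟨N, rfl⟩ : ∃ M, N = M + 1 := ⟨N - 1, by omega⟩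
    have := Bar.part_le_of_snoc (S := Set.univ) (n := j) (p := q) (X := Y) (Y := X)
      (N := LinearMap.eqLocus
        ((rot (N + 1) ^ (j + 2) : Module.End K (Closed K C (N + 2))) ∘ₗ mk X ∘ₗ
          Bar.cat (j + 1) i (N + 2) h w)
        (sign K (p * q) • (mk Y ∘ₗ (Bar.cat i (j + 1) (N + 2) (by omega)).flip w)))
      (fun Z _ s t hst v hv c hc => by
        have hN : i + j + 1 = N + 1 := by omega
        have hc' := ih (i := i + 1) (by omega) (Bar.cons_mem_part (Set.mem_univ X) hc hw) hv
        rw [LinearMap.mem_eqLocus]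
        simp only [LinearMap.comp_apply, LinearMap.smul_apply, LinearMap.flip_apply]
        have hcat : Bar.cat j i (N + 1) hN w v ∈ Bar.part Set.univ (N + 1) (p + s) X Z :=
          Bar.cat_mem_part hN (Set.mem_univ Y) hw hv
        rw [Bar.cat_snoc hN, pow_succ, Module.End.mul_apply, rot_mk_snoc_of_mem _ hc,
          Bar.signBar_of_mem hcat, map_smul, map_smul, map_smul, Bar.cons_cat, hc', smul_smul,
          Bar.cat_cons, ← sign_add]
        congr 2
        rw [← hst]
        exact sign_identity p s t) hv
    exact this

theorem rot_pow (n : ℕ) : (rot n ^ (n + 2) : Module.End K (Closed K C (n + 1))) = 1 := by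
  refine hom_ext fun X w => ?_
  induction w using Bar.induction_cons with
  | add w w' hw hw' => simp only [map_add, hw, hw']
  | cons Z a w =>
    refine LinearMap.congr_fun₂ (f := (Bar.cons K).compr₂
      ((rot n ^ (n + 2) : Module.End K (Closed K C (n + 1))) ∘ₗ mk X))
      (g := (Bar.cons K).compr₂ (mk X)) (hom_ext_deg fun p a ha => ?_) a w
    refine LinearMap.ext fun w => ?_
    have key : ∀ q, Bar.part Set.univ n q Z X ≤ LinearMap.eqLocus
        ((rot n ^ (n + 2) : Module.End K (Closed K C (n + 1))) ∘ₗ mk X ∘ₗ Bar.cons K a)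
        (mk X ∘ₗ Bar.cons K a) := fun q w hw => by
      have h := rot_pow_cat (N := n) (by omega) (Bar.of_mem_part (S := Set.univ) ha) hw
      have h' := rot_pow_cat (N := n) (by omega) hw (Bar.of_mem_part (S := Set.univ) ha)
      rw [Bar.cat_of_left] at h h'
      rw [LinearMap.mem_eqLocus]
      simp only [LinearMap.comp_apply]
      rw [show n + 2 = 0 + 1 + (n + 1) by omega, pow_add, Module.End.mul_apply, h, map_smul, h',
        smul_smul, mul_comm q, sign_mul_self, one_smul]
    exact sup_le (key 0) (key 1) (Bar.mem_sup_part w)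

end Closed

end Cyclic

/-! ### The differentials of the cyclic bicomplex -/

section CyclicIdentities

variable {K : Type u} [Field K]

section Abstract

variable {A B : Type*} [AddCommGroup A] [Module K A] [AddCommGroup B] [Module K B]
  {t : Module.End K A} {s : Module.End K B} {D : ℕ → A →ₗ[K] B} {n : ℕ}

theorem sum_comp_one_sub (hD : ∀ i ≤ n, ∀ x, D (i + 1) (t x) = s (D i x))
    (h0 : ∀ x, D 0 (t x) = D (n + 1) x) (x : A) :
    (∑ i ∈ Finset.range (n + 2), D i (x - t x)) =
      (∑ i ∈ Finset.range (n + 1), D i x) - s (∑ i ∈ Finset.range (n + 1), D i x) := by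
  simp only [map_sub, Finset.sum_sub_distrib]
  rw [Finset.sum_range_succ, Finset.sum_range_succ' (fun i => D i (t x)), h0, map_sum,
    Finset.sum_congr rfl fun i hi => hD i (by simpa [Nat.lt_succ_iff] using hi) x]
  abel

theorem sum_comp_norm (hD : ∀ i ≤ n, ∀ x, D (i + 1) (t x) = s (D i x))
    (ht : t ^ (n + 2) = 1) (hs : s ^ (n + 1) = 1) (x : A) :
    (∑ i ∈ Finset.range (n + 1), D i (∑ j ∈ Finset.range (n + 2), (t ^ j) x)) =
      ∑ j ∈ Finset.range (n + 1), (s ^ j) (∑ i ∈ Finset.range (n + 2), D i x) := by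
  have hDi : ∀ i ≤ n + 1, ∀ x, D i ((t ^ i) x) = (s ^ i) (D 0 x) := by
    intro i hi
    induction i with
    | zero => simp
    | succ i ih =>
      intro x
      rw [pow_succ', Module.End.mul_apply, hD i (by omega), ih (by omega), pow_succ',
        Module.End.mul_apply]
  have hN : ∀ i x, ∑ j ∈ Finset.range (n + 2), (t ^ j) x =
      (t ^ i) (∑ j ∈ Finset.range (n + 2), (t ^ j) x) := by
    intro i x
    induction i with
    | zero => simp
    | succ i ih =>
      have h := LinearMap.congr_fun (mul_geom_sum t (n + 2)) x
      rw [ht, sub_self, Module.End.mul_apply, LinearMap.sub_apply, LinearMap.zero_apply,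
        Module.End.one_apply, sub_eq_zero, LinearMap.sum_apply] at h
      rw [pow_succ, Module.End.mul_apply, h, ← ih]
  have hM : ∀ i y, ∑ j ∈ Finset.range (n + 1), (s ^ j) ((s ^ i) y) =
      ∑ j ∈ Finset.range (n + 1), (s ^ j) y := by
    intro i y
    induction i generalizing y with
    | zero => simp
    | succ i ih =>
      have h := LinearMap.congr_fun (geom_sum_mul s (n + 1)) y
      rw [hs, sub_self, Module.End.mul_apply, LinearMap.sub_apply, LinearMap.zero_apply,
        Module.End.one_apply, map_sub, sub_eq_zero, LinearMap.sum_apply, LinearMap.sum_apply] at h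
      rw [← h, ← ih (s y), pow_succ]
      rfl
  have hL : ∀ i ∈ Finset.range (n + 1), D i (∑ j ∈ Finset.range (n + 2), (t ^ j) x) =
      (s ^ i) (D 0 (∑ j ∈ Finset.range (n + 2), (t ^ j) x)) := fun i hi => by
    rw [hN i x, hDi i (by simp at hi; omega), ← hN]
  have hR : ∀ i ∈ Finset.range (n + 2), ∑ j ∈ Finset.range (n + 1), (s ^ j) (D i x) =
      ∑ j ∈ Finset.range (n + 1), (s ^ j) (D 0 ((t ^ (n + 2 - i)) x)) := fun i hi => by
    have hi' : i ≤ n + 1 := by simp at hi; omega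
    have e : x = (t ^ i) ((t ^ (n + 2 - i)) x) := by
      rw [← Module.End.mul_apply, ← pow_add, show i + (n + 2 - i) = n + 2 by omega, ht]
      rfl
    conv_lhs => rw [e, hDi i hi', hM]
  rw [Finset.sum_congr rfl hL]
  simp only [map_sum (s ^ _)]
  rw [Finset.sum_comm, Finset.sum_congr rfl hR, Finset.sum_comm]
  refine Finset.sum_congr rfl fun j _ => ?_
  rw [← map_sum, ← map_sum]
  congr 2
  rw [Finset.sum_range_succ' (fun i => (t ^ i) x),
    Finset.sum_range_succ' (fun i => (t ^ (n + 2 - i)) x),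
    ← Finset.sum_range_reflect (fun i => (t ^ (i + 1)) x)]
  congr 1
  · refine Finset.sum_congr rfl fun i hi => ?_
    have hi' := Finset.mem_range.1 hi
    congr 2
    omega
  · simp [ht]

end Abstract

variable {C : Type u} [Category.{u} C] [Preadditive C] [Linear K C] [SuperCategory K C]

namespace Closed

/-- The last face `(a₀, …, aₙ₊₁) ↦ ± (aₙ₊₁ a₀, a₁, …, aₙ)` of closed strings. -/
noncomputable def lastFace (n : ℕ) : Closed K C (n + 1) →ₗ[K] Closed K C n :=
  face 0 n ∘ₗ rot n

theorem lastFace_apply (n : ℕ) (x : Closed K C (n + 1)) : lastFace n x = face 0 n (rot n x) := rfl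

variable (K C) in
/-- The Hochschild boundary of closed strings. -/
noncomputable def bdry (n : ℕ) : Closed K C (n + 1) →ₗ[K] Closed K C n :=
  diff K C n + ((-1 : K) ^ (n + 1)) • lastFace n

theorem bdry_apply (n : ℕ) (x : Closed K C (n + 1)) :
    bdry K C n x = diff K C n x + ((-1 : K) ^ (n + 1)) • lastFace n x := rfl

variable (K C) in
/-- The cyclic operator on closed strings. -/
noncomputable def cyc : ∀ n : ℕ, Module.End K (Closed K C n)
  | 0 => 1
  | n + 1 => ((-1 : K) ^ (n + 1)) • rot n

variable (K C) in
/-- The norm operator on closed strings. -/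
noncomputable def norm (n : ℕ) : Module.End K (Closed K C n) :=
  ∑ i ∈ Finset.range (n + 1), cyc K C n ^ i

theorem cyc_pow (n : ℕ) : cyc K C n ^ (n + 1) = 1 := by
  cases n with
  | zero => exact one_pow _
  | succ n =>
    rw [cyc, smul_pow, rot_pow, ← pow_mul, (Nat.even_mul_succ_self (n + 1)).neg_one_pow, one_smul]

/-- The faces of closed strings with the signs they have in the Hochschild boundary. -/
noncomputable def signedFace (n i : ℕ) : Closed K C (n + 1) →ₗ[K] Closed K C n :=
  if i ≤ n then ((-1 : K) ^ i) • face i n else ((-1 : K) ^ (n + 1)) • lastFace n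

theorem diff_eq_signedFace (n : ℕ) (x : Closed K C (n + 1)) :
    diff K C n x = ∑ i ∈ Finset.range (n + 1), signedFace n i x := by
  rw [diff_eq_sum, LinearMap.sum_apply]
  refine Finset.sum_congr rfl fun i hi => ?_
  rw [signedFace, if_pos (by simpa [Nat.lt_succ_iff] using hi)]

theorem bdry_eq_signedFace (n : ℕ) (x : Closed K C (n + 1)) :
    bdry K C n x = ∑ i ∈ Finset.range (n + 2), signedFace n i x := by
  rw [Finset.sum_range_succ, ← diff_eq_signedFace, signedFace, if_neg (by omega)]
  rfl

theorem neg_one_pow_mul_self (n : ℕ) : (-1 : K) ^ n * (-1) ^ n = 1 := by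
  rw [← pow_add, Even.neg_one_pow ⟨n, rfl⟩]

theorem signedFace_cyc {n i : ℕ} (hi : i ≤ n) (x : Closed K C (n + 1)) :
    signedFace n (i + 1) (cyc K C (n + 1) x) = cyc K C n (signedFace n i x) := by
  rw [signedFace, signedFace, if_pos hi, cyc]
  rcases hi.eq_or_lt with rfl | hi'
  · rw [if_neg (by omega)]
    simp only [LinearMap.smul_apply, map_smul, smul_smul, neg_one_pow_mul_self, lastFace_apply]
    cases i with
    | zero =>
      have h : rot 0 (rot 0 x) = x :=
        LinearMap.congr_fun ((pow_two (rot 0)).symm.trans (rot_pow (K := K) (C := C) 0)) x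
      rw [h]
      simp [cyc]
    | succ i =>
      rw [face_zero_rot_rot, cyc, LinearMap.smul_apply, smul_smul, neg_one_pow_mul_self]
  · obtain ⟨n, rfl⟩ : ∃ m, n = m + 1 := ⟨n - 1, by omega⟩
    rw [if_pos (by omega)]
    simp only [LinearMap.smul_apply, map_smul, smul_smul, cyc, face_succ_rot (Nat.lt_succ_iff.1 hi')]
    congr 1
    ring

theorem signedFace_zero_cyc (n : ℕ) (x : Closed K C (n + 1)) :
    signedFace n 0 (cyc K C (n + 1) x) = signedFace n (n + 1) x := by
  rw [signedFace, signedFace, if_pos (by omega), if_neg (by omega), cyc]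
  simp [lastFace_apply]

theorem bdry_sub_cyc (n : ℕ) (x : Closed K C (n + 1)) :
    bdry K C n (x - cyc K C (n + 1) x) = diff K C n x - cyc K C n (diff K C n x) := by
  rw [bdry_eq_signedFace, diff_eq_signedFace]
  exact sum_comp_one_sub (fun i hi => signedFace_cyc hi) (signedFace_zero_cyc n) x

theorem diff_norm (n : ℕ) (x : Closed K C (n + 1)) :
    diff K C n (norm K C (n + 1) x) = norm K C n (bdry K C n x) := by
  rw [bdry_eq_signedFace, diff_eq_signedFace, norm, norm, LinearMap.sum_apply,
    LinearMap.sum_apply]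
  exact sum_comp_norm (fun i hi => signedFace_cyc hi) (cyc_pow (n + 1)) (cyc_pow n) x

theorem norm_sub_cyc (n : ℕ) (x : Closed K C n) : norm K C n (x - cyc K C n x) = 0 := by
  have h := LinearMap.congr_fun (geom_sum_mul (cyc K C n) (n + 1)) x
  rw [cyc_pow, sub_self, Module.End.mul_apply, LinearMap.sub_apply] at h
  rw [← neg_sub, map_neg, neg_eq_zero]
  exact h

theorem norm_eq_cyc_norm (n : ℕ) (x : Closed K C n) :
    norm K C n x - cyc K C n (norm K C n x) = 0 := by
  have h := LinearMap.congr_fun (mul_geom_sum (cyc K C n) (n + 1)) x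
  rw [cyc_pow, sub_self, Module.End.mul_apply, LinearMap.sub_apply] at h
  rw [← neg_sub, neg_eq_zero]
  exact h

theorem lastFace_diff (n : ℕ) (x : Closed K C (n + 2)) :
    lastFace n (diff K C (n + 1) x) = bdry K C n (lastFace (n + 1) x) := by
  have h : rot n (diff K C (n + 1) x) =
      ∑ i ∈ Finset.range (n + 1), ((-1 : K) ^ i) • face (i + 1) (n + 1) (rot (n + 1) x) +
        ((-1 : K) ^ (n + 1)) • face 0 (n + 1) (rot (n + 1) (rot (n + 1) x)) := by
    rw [diff_eq_sum, LinearMap.sum_apply, Finset.sum_range_succ, map_add, map_sum,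
      face_zero_rot_rot]
    simp only [LinearMap.smul_apply, map_smul]
    congr 1
    refine Finset.sum_congr rfl fun i hi => ?_
    rw [face_succ_rot (by simpa [Nat.lt_succ_iff] using hi)]
  rw [lastFace_apply, h, bdry_apply, diff_eq_sum, map_add, map_sum, LinearMap.sum_apply, map_smul]
  congr 1
  · refine Finset.sum_congr rfl fun i _ => ?_
    rw [map_smul, LinearMap.smul_apply, lastFace_apply, face_face_zero]
  · rw [face_face_zero, face_succ_rot (Nat.zero_le _), lastFace_apply, lastFace_apply]

theorem bdry_bdry (n : ℕ) (x : Closed K C (n + 2)) : bdry K C n (bdry K C (n + 1) x) = 0 := by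
  have h := lastFace_diff n x
  rw [bdry_apply] at h
  rw [bdry_apply (n + 1), map_add, map_smul, bdry_apply, bdry_apply, diff_diff, h, zero_add,
    smul_add, pow_succ (-1 : K) (n + 1)]
  simp only [mul_neg, mul_one, neg_smul, smul_add]
  abel

end Closed

end CyclicIdentities

/-! ### The contraction of the Hochschild complex relative to a generating set of objects -/

section Contraction

variable {K : Type u} [Field K] {C : Type u} [Category.{u} C] [Preadditive C] [Linear K C]
  [SuperCategory K C]

namespace Closed

theorem lastFace_mk_snoc_of_mem {n : ℕ} {X Z : C} (w : Bar K n X Z) {q : ZMod 2} {c : Z ⟶ X}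
    (hc : c ∈ SuperCategory.deg (K := K) Z X q) :
    lastFace n (mk X (Bar.snoc n w c)) = mk Z (Bar.lmul n c (Bar.signBar q n X Z w)) := by
  rw [lastFace_apply, rot_mk_snoc_of_mem w hc, face_mk, Bar.face_zero_cons]

theorem _root_.SuperHochschild.Bar.signBar_zero {n : ℕ} {X Y : C} (w : Bar K n X Y) :
    Bar.signBar 0 n X Y w = w := by
  have h : ∀ q, Bar.part Set.univ n q X Y ≤ LinearMap.eqLocus (Bar.signBar 0 n X Y)
      (LinearMap.id : Bar K n X Y →ₗ[K] _) := fun q w hw => by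
    rw [LinearMap.mem_eqLocus, Bar.signBar_of_mem hw, zero_mul, sign_zero, one_smul]
    rfl
  exact sup_le (h 0) (h 1) (Bar.mem_sup_part w)

theorem lastFace_snoc_id {n : ℕ} {X : C} (w : Bar K n X X) :
    lastFace n (mk X (Bar.snoc n w (𝟙 X))) = mk X w := by
  rw [lastFace_mk_snoc_of_mem w (id_mem_deg X), Bar.signBar_zero, Bar.lmul_id]

/-- The last face is a trace: a morphism may be moved from the end of a string to its beginning. -/
theorem lastFace_rmul {n : ℕ} {X Z : C} (x : Bar K (n + 1) X Z) {q : ZMod 2} {c : Z ⟶ X}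
    (hc : c ∈ SuperCategory.deg (K := K) Z X q) :
    lastFace n (mk X (Bar.rmul (n + 1) c x)) =
      lastFace n (mk Z (Bar.lmul (n + 1) c (Bar.signBar q (n + 1) X Z x))) := by
  induction x using Bar.induction_snoc with
  | add x x' h h' => simp only [map_add, h, h']
  | snoc U w b =>
    refine LinearMap.congr_fun (f := lastFace n ∘ₗ mk X ∘ₗ Bar.rmul (n + 1) c ∘ₗ Bar.snoc n w)
      (g := lastFace n ∘ₗ mk Z ∘ₗ Bar.lmul (n + 1) c ∘ₗ Bar.signBar q (n + 1) X Z ∘ₗ Bar.snoc n w)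
      (hom_ext_deg fun s b hb => ?_) b
    simp only [LinearMap.comp_apply]
    rw [Bar.rmul_snoc, lastFace_mk_snoc_of_mem _ (SuperCategory.comp_mem hb hc), Bar.signBar_snoc,
      signMap_of_mem hb, Bar.lmul_snoc, map_smul, map_smul, map_smul, lastFace_mk_snoc_of_mem _ hb,
      Bar.signBar_lmul, signMap_of_mem hc, Bar.signBar_signBar, Bar.lmul_lmul]
    simp [smul_smul, mul_comm, Linear.comp_smul]

theorem lastFace_mk_mem_part {S : Set C} {n : ℕ} {p : ZMod 2} {X : C} {x : Bar K (n + 1) X X}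
    (hx : x ∈ Bar.part S (n + 1) p X X) : lastFace n (mk X x) ∈ part K S n p := by
  refine Bar.part_le_of_snoc (N := (part K S n p).comap (lastFace n ∘ₗ mk X))
    (fun Z hZ q q' hq w hw c hc => ?_) hx
  rw [Submodule.mem_comap, LinearMap.comp_apply, lastFace_mk_snoc_of_mem w hc,
    Bar.signBar_of_mem hw, map_smul, map_smul, ← hq, add_comm q]
  exact Submodule.smul_mem _ _ (mk_mem_part hZ (Bar.lmul_mem_part hc hw))

variable (r : ∀ Z : C, Bar K 1 Z Z)

/-- The contraction `(a₀, …, aₙ) ↦ dₙ₊₂ h (a₀, …, aₙ, 1)` of the Hochschild complex, where `h` is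
the contraction of the bar complex defined by `r`. -/
noncomputable def contr (n : ℕ) : Closed K C n →ₗ[K] Closed K C (n + 1) :=
  lift fun X => lastFace (n + 1) ∘ₗ mk X ∘ₗ Bar.contr r (n + 1) X X ∘ₗ (Bar.snoc n).flip (𝟙 X)

/-- The map `(a₀, …, aₙ) ↦ dₙ₊₁ ρ (a₀, …, aₙ, 1)`, where `ρ` is the projection of the bar complex
defined by `r`. -/
noncomputable def retract (n : ℕ) : Closed K C n →ₗ[K] Closed K C n :=
  lift fun X => lastFace n ∘ₗ mk X ∘ₗ Bar.retract r (n + 1) X X ∘ₗ (Bar.snoc n).flip (𝟙 X)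

theorem contr_mk {n : ℕ} {X : C} (w : Bar K n X X) :
    contr r n (mk X w) = lastFace (n + 1) (mk X (Bar.contr r (n + 1) X X (Bar.snoc n w (𝟙 X)))) :=
  lift_mk _ X w

theorem retract_mk {n : ℕ} {X : C} (w : Bar K n X X) :
    retract r n (mk X w) = lastFace n (mk X (Bar.retract r (n + 1) X X (Bar.snoc n w (𝟙 X)))) :=
  lift_mk _ X w

theorem bdry_contr_mk (hr : ∀ Z, Bar.diff K 0 Z Z (r Z) = Bar.of K (𝟙 Z)) {n : ℕ} {X : C}
    (w : Bar K n X X) :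
    bdry K C n (contr r n (mk X w)) = mk X w - retract r n (mk X w) -
      lastFace n (mk X (Bar.contr r n X X (Bar.diff K n X X (Bar.snoc n w (𝟙 X))))) := by
  have h := Bar.diff_contr r hr (Bar.snoc n w (𝟙 X))
  rw [← eq_sub_iff_add_eq] at h
  rw [contr_mk, ← lastFace_diff, diff, map_mk, h, map_sub, map_sub, map_sub, map_sub,
    lastFace_snoc_id, retract_mk]

theorem bdry_contr_zero (hr : ∀ Z, Bar.diff K 0 Z Z (r Z) = Bar.of K (𝟙 Z)) (x : Closed K C 0) :
    bdry K C 0 (contr r 0 x) = x - retract r 0 x := by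
  revert x
  refine LinearMap.congr_fun (f := bdry K C 0 ∘ₗ contr r 0) (g := LinearMap.id - retract r 0)
    (hom_ext fun X w => ?_)
  rw [LinearMap.comp_apply, bdry_contr_mk r hr]
  simp [Bar.contr]

theorem contr_lastFace (hσ : ∀ q Z, Bar.signBar q 1 Z Z (r Z) = r Z) {n : ℕ} {X : C}
    (w : Bar K (n + 1) X X) :
    contr r n (lastFace n (mk X w)) = lastFace (n + 1) (mk X (Bar.contr r (n + 1) X X w)) := by
  induction w using Bar.induction_snoc with
  | add w w' h h' => simp only [map_add, h, h']
  | snoc Z w c =>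
    refine LinearMap.congr_fun (f := contr r n ∘ₗ lastFace n ∘ₗ mk X ∘ₗ Bar.snoc n w)
      (g := lastFace (n + 1) ∘ₗ mk X ∘ₗ Bar.contr r (n + 1) X X ∘ₗ Bar.snoc n w)
      (hom_ext_deg fun q c hc => ?_) c
    simp only [LinearMap.comp_apply]
    have h : Bar.snoc n w c = Bar.rmul (n + 1) c (Bar.snoc n w (𝟙 Z)) := by
      rw [Bar.rmul_snoc, Category.id_comp]
    rw [lastFace_mk_snoc_of_mem w hc, h, Bar.contr_rmul, lastFace_rmul _ hc, contr_mk,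
      ← Bar.lmul_snoc, Bar.contr_lmul, Bar.signBar_contr r q (hσ q), Bar.signBar_snoc,
      signMap_of_mem (id_mem_deg Z), mul_zero, sign_zero, one_smul]

theorem bdry_contr_succ (hr : ∀ Z, Bar.diff K 0 Z Z (r Z) = Bar.of K (𝟙 Z))
    (hσ : ∀ q Z, Bar.signBar q 1 Z Z (r Z) = r Z) {n : ℕ} (x : Closed K C (n + 1)) :
    bdry K C (n + 1) (contr r (n + 1) x) =
      x - retract r (n + 1) x - contr r n (bdry K C n x) := by
  revert x
  refine LinearMap.congr_fun (f := bdry K C (n + 1) ∘ₗ contr r (n + 1))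
    (g := LinearMap.id - retract r (n + 1) - contr r n ∘ₗ bdry K C n) (hom_ext fun X w => ?_)
  rw [LinearMap.comp_apply, bdry_contr_mk r hr, Bar.diff_succ_snoc, Bar.rmul_id]
  simp only [LinearMap.sub_apply, LinearMap.id_apply, LinearMap.comp_apply, bdry_apply, map_add,
    map_smul, contr_lastFace r hσ, diff, map_mk, contr_mk]

variable {S : Set C}

theorem retract_mem_part (hS : ∀ Z, r Z ∈ Bar.part S 1 0 Z Z) {n : ℕ} {p : ZMod 2}
    {x : Closed K C n} (hx : x ∈ part K Set.univ n p) : retract r n x ∈ part K S n p := by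
  refine part_le (N := (part K S n p).comap (retract r n)) (fun X _ w hw => ?_) hx
  rw [Submodule.mem_comap, retract_mk]
  have h := Bar.snoc_mem_part (Set.mem_univ X) hw (id_mem_deg X)
  rw [add_zero] at h
  exact lastFace_mk_mem_part (Bar.retract_mem_part r hS h)

theorem contr_mem_part (hS : ∀ Z, r Z ∈ Bar.part S 1 0 Z Z) {n : ℕ} {p : ZMod 2}
    {x : Closed K C n} (hx : x ∈ part K S n p) : contr r n x ∈ part K S (n + 1) p := by
  refine part_le (N := (part K S (n + 1) p).comap (contr r n)) (fun X hX w hw => ?_) hx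
  rw [Submodule.mem_comap, contr_mk]
  have h := Bar.snoc_mem_part hX hw (id_mem_deg X)
  rw [add_zero] at h
  exact lastFace_mk_mem_part (Bar.contr_mem_part r hS h)

/-- The contraction `(a₀, …, aₙ) ↦ (1, a₀, …, aₙ)` of the complex of closed strings with the
differential that leaves out the last face. -/
noncomputable def consId (n : ℕ) : Closed K C n →ₗ[K] Closed K C (n + 1) :=
  map fun X => Bar.cons K (𝟙 X)

theorem diff_consId_zero (x : Closed K C 0) : diff K C 0 (consId 0 x) = x := by
  revert x
  refine LinearMap.congr_fun (f := diff K C 0 ∘ₗ consId 0) (g := LinearMap.id)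
    (hom_ext fun X w => ?_)
  simp [diff, consId, Bar.diff_zero_cons]

theorem diff_consId_succ {n : ℕ} (x : Closed K C (n + 1)) :
    diff K C (n + 1) (consId (n + 1) x) = x - consId n (diff K C n x) := by
  revert x
  refine LinearMap.congr_fun (f := diff K C (n + 1) ∘ₗ consId (n + 1))
    (g := LinearMap.id - consId n ∘ₗ diff K C n) (hom_ext fun X w => ?_)
  simp [diff, consId, Bar.diff_succ_cons]

theorem consId_mem_part {n : ℕ} {p : ZMod 2} {x : Closed K C n} (hx : x ∈ part K S n p) :
    consId n x ∈ part K S (n + 1) p := by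
  refine part_le (N := (part K S (n + 1) p).comap (consId n)) (fun X hX w hw => ?_) hx
  rw [Submodule.mem_comap, consId, map_mk]
  have h := Bar.cons_mem_part hX (id_mem_deg X) hw
  rw [zero_add] at h
  exact mk_mem_part hX h

end Closed

end Contraction

/-! ### Relatively acyclic complexes -/

section LinearAlgebra

variable {K : Type u} [Field K]

theorem nonempty_subquotientEquiv {V W : Type u} [AddCommGroup V] [Module K V] [AddCommGroup W]
    [Module K W] {Z B : Submodule K V} {Z' B' : Submodule K W} (f : V →ₗ[K] W)
    (hZ : ∀ x ∈ Z, f x ∈ Z') (hB : ∀ x ∈ B, f x ∈ B') (hinj : ∀ x ∈ Z, f x ∈ B' → x ∈ B)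
    (hsurj : ∀ y ∈ Z', ∃ x ∈ Z, y - f x ∈ B') :
    Nonempty (Subquotient Z B ≃ₗ[K] Subquotient Z' B') := by
  let g : Subquotient Z B →ₗ[K] Subquotient Z' B' :=
    Submodule.mapQ (B.submoduleOf Z) (B'.submoduleOf Z') (f.restrict hZ) fun x hx => hB _ hx
  refine ⟨LinearEquiv.ofBijective g ⟨?_, fun y => ?_⟩⟩
  · rw [← LinearMap.ker_eq_bot, LinearMap.ker_eq_bot']
    intro x hx
    obtain ⟨x, rfl⟩ := Submodule.mkQ_surjective _ x
    have hx' : (Submodule.Quotient.mk ⟨f x.1, hZ _ x.2⟩ : Subquotient Z' B') = 0 := hx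
    exact (Submodule.Quotient.mk_eq_zero _).2
      (hinj x.1 x.2 ((Submodule.Quotient.mk_eq_zero (B'.submoduleOf Z')).1 hx'))
  · obtain ⟨y, rfl⟩ := Submodule.mkQ_surjective _ y
    obtain ⟨x, hx, h⟩ := hsurj y.1 y.2
    refine ⟨Submodule.mkQ _ ⟨x, hx⟩, ((Submodule.Quotient.eq _).2 ?_).symm⟩
    exact h

/-- The cycles in a graded piece `P` of a complex. -/
noncomputable def cyclesOf {V : ℕ → Type u} [∀ n, AddCommGroup (V n)] [∀ n, Module K (V n)]
    (d : ∀ n, V (n + 1) →ₗ[K] V n) (P : ∀ n, Submodule K (V n)) : ∀ n, Submodule K (V n)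
  | 0 => P 0
  | n + 1 => P (n + 1) ⊓ LinearMap.ker (d n)

/-- The complex `P` is acyclic relative to its subcomplex `S`: every relative cycle is a relative
boundary. -/
structure RelAcyclic {W : ℕ → Type u} [∀ n, AddCommGroup (W n)] [∀ n, Module K (W n)]
    (d : ∀ n, W (n + 1) →ₗ[K] W n) (P S : ∀ n, Submodule K (W n)) : Prop where
  zero : ∀ x ∈ P 0, ∃ y ∈ P 1, x - d 0 y ∈ S 0
  succ : ∀ n, ∀ x ∈ P (n + 1), d n x ∈ S n → ∃ y ∈ P (n + 2), x - d (n + 1) y ∈ S (n + 1)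

theorem RelAcyclic.neg {W : ℕ → Type u} [∀ n, AddCommGroup (W n)] [∀ n, Module K (W n)]
    {d : ∀ n, W (n + 1) →ₗ[K] W n} {P S : ∀ n, Submodule K (W n)} (h : RelAcyclic d P S) :
    RelAcyclic (fun n => -d n) P S where
  zero x hx := by
    obtain ⟨y, hy, hxy⟩ := h.zero x hx
    exact ⟨-y, neg_mem hy, by simpa using hxy⟩
  succ n x hx hdx := by
    obtain ⟨y, hy, hxy⟩ := h.succ n x hx (by simpa using hdx)
    exact ⟨-y, neg_mem hy, by simpa using hxy⟩

/-- An injective chain map onto a subcomplex relative to which the target is acyclic induces an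
isomorphism in homology. -/
theorem RelAcyclic.nonempty_homologyEquiv {V W : ℕ → Type u} [∀ n, AddCommGroup (V n)]
    [∀ n, Module K (V n)] [∀ n, AddCommGroup (W n)] [∀ n, Module K (W n)]
    {dV : ∀ n, V (n + 1) →ₗ[K] V n} {dW : ∀ n, W (n + 1) →ₗ[K] W n}
    {PV : ∀ n, Submodule K (V n)} {PW : ∀ n, Submodule K (W n)} (i : ∀ n, V n →ₗ[K] W n)
    (hd : ∀ n x, i n (dV n x) = dW n (i (n + 1) x)) (hi : ∀ n, Function.Injective (i n))
    (hP : ∀ n, ∀ x ∈ PV n, i n x ∈ PW n) (hdd : ∀ n x, dW n (dW (n + 1) x) = 0)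
    (h : RelAcyclic dW PW fun n => (PV n).map (i n)) (n : ℕ) :
    Nonempty (Subquotient (cyclesOf dV PV n) ((PV (n + 1)).map (dV n)) ≃ₗ[K]
      Subquotient (cyclesOf dW PW n) ((PW (n + 1)).map (dW n))) := by
  refine nonempty_subquotientEquiv (i n) (fun x hx => ?_) ?_ (fun x hx hxB => ?_) fun y hy => ?_
  · cases n with
    | zero => exact hP 0 x hx
    | succ n =>
      refine ⟨hP _ x hx.1, ?_⟩
      rw [SetLike.mem_coe, LinearMap.mem_ker, ← hd, LinearMap.mem_ker.1 hx.2, map_zero]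
  · rintro _ ⟨x, hx, rfl⟩
    exact ⟨i (n + 1) x, hP _ x hx, (hd n x).symm⟩
  · obtain ⟨z, hz, hzx⟩ := hxB
    have hxP : x ∈ PV n := by
      cases n with
      | zero => exact hx
      | succ n => exact hx.1
    obtain ⟨y, hy, v, hv, hvy⟩ := h.succ n z hz ⟨x, hxP, hzx.symm⟩
    refine ⟨v, hv, hi n ?_⟩
    rw [hd, hvy, map_sub, hdd, sub_zero, hzx]
  · cases n with
    | zero =>
      obtain ⟨z, hz, v, hv, hvz⟩ := h.zero y hy
      exact ⟨v, hv, z, hz, by rw [hvz, sub_sub_cancel]⟩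
    | succ n =>
      have hdy : dW n y = 0 := hy.2
      obtain ⟨z, hz, v, hv, hvz⟩ := h.succ n y hy.1 (hdy ▸ zero_mem _)
      refine ⟨v, ⟨hv, hi n ?_⟩, z, hz, by rw [hvz, sub_sub_cancel]⟩
      rw [hd, hvz, map_sub, hdd, hdy, map_zero, sub_zero]

/-! ### The cohomology of a dual complex -/

/-- The coboundaries, in the dual of a complex, of the forms vanishing on `Q`. -/
noncomputable def dualCoboundaries {V : ℕ → Type u} [∀ n, AddCommGroup (V n)]
    [∀ n, Module K (V n)] (d : ∀ n, V (n + 1) →ₗ[K] V n) (Q : ∀ n, Submodule K (V n)) :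
    ∀ n, Submodule K (Module.Dual K (V n))
  | 0 => ⊥
  | n + 1 => (Q n).dualAnnihilator.map (d n).dualMap

/-- Over a field, the cohomology of the dual of a complex `P ⊕ Q` in the part that vanishes on `Q`
is the dual of the homology of `P`. -/
theorem nonempty_dualCohomologyEquiv {V : ℕ → Type u} [∀ n, AddCommGroup (V n)]
    [∀ n, Module K (V n)] {d : ∀ n, V (n + 1) →ₗ[K] V n} {P Q : ∀ n, Submodule K (V n)}
    (hPQ : ∀ n, IsCompl (P n) (Q n)) (hP : ∀ n, ∀ x ∈ P (n + 1), d n x ∈ P n)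
    (hQ : ∀ n, ∀ x ∈ Q (n + 1), d n x ∈ Q n) (hdd : ∀ n x, d n (d (n + 1) x) = 0) (n : ℕ) :
    Nonempty (Subquotient ((Q n).dualAnnihilator ⊓ LinearMap.ker (d n).dualMap)
        (dualCoboundaries d Q n) ≃ₗ[K]
      Module.Dual K (Subquotient (cyclesOf d P n) ((P (n + 1)).map (d n)))) := by
  set A := (Q n).dualAnnihilator ⊓ LinearMap.ker (d n).dualMap with hA
  set Z := cyclesOf d P n with hZ
  set B := (P (n + 1)).map (d n) with hB
  have hZP : Z ≤ P n := by
    cases n with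
    | zero => exact le_rfl
    | succ n => exact inf_le_left
  have hBZ : ∀ x ∈ P (n + 1), d n x ∈ Z := fun x hx => by
    cases n with
    | zero => exact hP 0 x hx
    | succ n => exact ⟨hP _ x hx, hdd n x⟩
  have hdec : ∀ m (x : V m), ∃ p ∈ P m, ∃ q ∈ Q m, p + q = x := fun m x =>
    Submodule.mem_sup.1 ((hPQ m).sup_eq_top.ge Submodule.mem_top)
  let F : A →ₗ[K] Module.Dual K (Subquotient Z B) :=
    { toFun := fun φ => (B.submoduleOf Z).liftQ (φ.1 ∘ₗ Z.subtype) (by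
        rintro ⟨_, hx⟩ ⟨y, hy, rfl⟩
        exact LinearMap.congr_fun (LinearMap.mem_ker.1 φ.2.2) y)
      map_add' := fun φ ψ => Submodule.linearMap_qext _ (LinearMap.ext fun x => rfl)
      map_smul' := fun c φ => Submodule.linearMap_qext _ (LinearMap.ext fun x => rfl) }
  have hF : ∀ (φ : A) (z : V n) (hz : z ∈ Z), F φ (Submodule.mkQ _ ⟨z, hz⟩) = φ.1 z :=
    fun _ _ _ => rfl
  have hker : LinearMap.ker F = (dualCoboundaries d Q n).submoduleOf A := by
    ext φ
    have hφQ : ∀ q ∈ Q n, φ.1 q = 0 := (Submodule.mem_dualAnnihilator _).1 φ.2.1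
    rw [LinearMap.mem_ker]
    constructor
    · intro h
      have hφ : ∀ z ∈ Z, φ.1 z = 0 := fun z hz => by rw [← hF φ z hz, h]; rfl
      change φ.1 ∈ dualCoboundaries d Q n
      cases n with
      | zero =>
        refine (Submodule.mem_bot K).2 (LinearMap.ext fun x => ?_)
        obtain ⟨p, hp, q, hq, rfl⟩ := hdec 0 x
        rw [map_add, hφ p hp, hφQ q hq]
        simp
      | succ n =>
        have h₁ : φ.1 ∈ (LinearMap.ker (d n)).dualAnnihilator := by
          refine (Submodule.mem_dualAnnihilator _).2 fun x hx => ?_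
          obtain ⟨p, hp, q, hq, rfl⟩ := hdec (n + 1) x
          rw [LinearMap.mem_ker, map_add] at hx
          have hdp : d n p = 0 := by
            refine (Submodule.disjoint_def.1 (hPQ n).disjoint) _ (hP n p hp) ?_
            rw [eq_neg_of_add_eq_zero_left hx]
            exact neg_mem (hQ n q hq)
          rw [map_add, hφ p ⟨hp, hdp⟩, hφQ q hq, add_zero]
        rw [← LinearMap.range_dualMap_eq_dualAnnihilator_ker] at h₁
        obtain ⟨ψ, hψ⟩ := h₁
        refine ⟨ψ ∘ₗ Submodule.projection _ _ (hPQ n), ?_, LinearMap.ext fun x => ?_⟩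
        · refine (Submodule.mem_dualAnnihilator _).2 fun q hq => ?_
          rw [LinearMap.comp_apply, (Submodule.projection_apply_eq_zero_iff (hPQ n)).2 hq, map_zero]
        · obtain ⟨p, hp, q, hq, rfl⟩ := hdec (n + 1) x
          change ψ (Submodule.projection _ _ (hPQ n) (d n (p + q))) = _
          rw [map_add, map_add, (Submodule.projection_apply_eq_zero_iff (hPQ n)).2 (hQ n q hq),
            add_zero, Submodule.projection_apply_left (hPQ n) ⟨_, hP n p hp⟩, map_add, hφQ q hq,
            add_zero]
          exact LinearMap.congr_fun hψ p
    · intro h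
      refine Submodule.linearMap_qext _ (LinearMap.ext fun z => ?_)
      change φ.1 z.1 = 0
      have h' : φ.1 ∈ dualCoboundaries d Q n := h
      cases n with
      | zero =>
        rw [(Submodule.mem_bot K).1 h']
        rfl
      | succ n =>
        obtain ⟨ψ, _, hψ⟩ := h'
        rw [← hψ]
        change ψ (d n z.1) = 0
        rw [LinearMap.mem_ker.1 z.2.2, map_zero]
  have hsurj : Function.Surjective F := fun g => by
    obtain ⟨φ, hφ⟩ := LinearMap.exists_extend (p := Z) (g ∘ₗ Submodule.mkQ _)
    have hφ' : ∀ z (hz : z ∈ Z), φ z = g (Submodule.mkQ _ ⟨z, hz⟩) := fun z hz =>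
      LinearMap.congr_fun hφ ⟨z, hz⟩
    have hp : ∀ p ∈ P n, Submodule.projection _ _ (hPQ n) p = p := fun p hp =>
      Submodule.projection_apply_left (hPQ n) ⟨p, hp⟩
    have hq : ∀ q ∈ Q n, Submodule.projection _ _ (hPQ n) q = 0 := fun q hq =>
      (Submodule.projection_apply_eq_zero_iff (hPQ n)).2 hq
    refine ⟨⟨φ ∘ₗ Submodule.projection _ _ (hPQ n), ?_, ?_⟩, ?_⟩
    · refine (Submodule.mem_dualAnnihilator _).2 fun q hq' => ?_
      rw [LinearMap.comp_apply, hq q hq', map_zero]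
    · refine LinearMap.ext fun x => ?_
      obtain ⟨p, hp', q, hq', rfl⟩ := hdec (n + 1) x
      change φ (Submodule.projection _ _ (hPQ n) (d n (p + q))) = 0
      rw [map_add, map_add, hp _ (hP n p hp'), hq _ (hQ n q hq'), add_zero, hφ' _ (hBZ p hp')]
      have h0 : Submodule.mkQ (B.submoduleOf Z) ⟨d n p, hBZ p hp'⟩ = 0 :=
        (Submodule.Quotient.mk_eq_zero _).2 ⟨p, hp', rfl⟩
      rw [h0, map_zero]
    · refine Submodule.linearMap_qext _ (LinearMap.ext fun z => ?_)
      change φ (Submodule.projection _ _ (hPQ n) z.1) = _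
      rw [hp _ (hZP z.2)]
      exact hφ' z.1 z.2
  exact ⟨(Submodule.quotEquivOfEq _ _ hker.symm).trans (F.quotKerEquivOfSurjective hsurj)⟩

/-! ### The total complex of a bicomplex -/

section Total

variable {W : ℕ → Type u} [∀ n, AddCommGroup (W n)] [∀ n, Module K (W n)]

/-- The differential of the total complex of a bicomplex all of whose columns consist of the same
modules `W q`; the total complex is indexed by `q`. -/
noncomputable def totDiff (vert : ∀ _ q : ℕ, W (q + 1) →ₗ[K] W q)
    (hor : ∀ _ q : ℕ, W q →ₗ[K] W q) (n : ℕ) :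
    (∀ q : Fin (n + 2), W q.val) →ₗ[K] ∀ q : Fin (n + 1), W q.val :=
  LinearMap.pi fun q : Fin (n + 1) =>
    vert (n - q.val) q.val ∘ₗ (LinearMap.proj q.succ : (∀ q : Fin (n + 2), W q.val) →ₗ[K] _) +
      hor (n + 1 - q.val) q.val ∘ₗ
        (LinearMap.proj q.castSucc : (∀ q : Fin (n + 2), W q.val) →ₗ[K] _)

variable {vert : ∀ _ q : ℕ, W (q + 1) →ₗ[K] W q} {hor : ∀ _ q : ℕ, W q →ₗ[K] W q}

theorem totDiff_apply (n : ℕ) (x : ∀ q : Fin (n + 2), W q.val) (q : Fin (n + 1)) :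
    totDiff vert hor n x q =
      vert (n - q.val) q.val (x q.succ) + hor (n + 1 - q.val) q.val (x q.castSucc) := rfl

theorem totDiff_totDiff (hvv : ∀ p q x, vert p q (vert p (q + 1) x) = 0)
    (hhh : ∀ p q x, hor (p + 1) q (hor (p + 2) q x) = 0)
    (hvh : ∀ p q x, vert p q (hor (p + 1) (q + 1) x) + hor (p + 1) q (vert (p + 1) q x) = 0)
    (n : ℕ) (x : ∀ q : Fin (n + 3), W q.val) :
    totDiff vert hor n (totDiff vert hor (n + 1) x) = 0 := by
  funext ⟨q, hq⟩
  obtain ⟨p, rfl⟩ : ∃ p, n = q + p := ⟨n - q, by omega⟩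
  rw [totDiff_apply, totDiff_apply, totDiff_apply]
  have e₁ : q + p - q = p := by omega
  have e₂ : q + p + 1 - (q + 1) = p := by omega
  have e₃ : q + p + 1 + 1 - (q + 1) = p + 1 := by omega
  have e₄ : q + p + 1 - q = p + 1 := by omega
  have e₅ : q + p + 1 + 1 - q = p + 2 := by omega
  simp only [Fin.val_succ, Fin.val_castSucc, e₁, e₂, e₃, e₄, e₅, map_add]
  have h₁ := hvv p q (x (Fin.succ (Fin.succ ⟨q, hq⟩)))
  have h₂ := hhh p q (x (Fin.castSucc (Fin.castSucc ⟨q, hq⟩)))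
  have h₃ := hvh p q (x (Fin.castSucc (Fin.succ ⟨q, hq⟩)))
  refine Eq.trans (congrArg₂ (· + ·) (congrArg (· + _) h₁) (congrArg (_ + ·) h₂)) ?_
  rw [zero_add, add_zero]
  exact h₃

theorem totDiff_mem {P : ∀ n, Submodule K (W n)} (hv : ∀ p q, ∀ x ∈ P (q + 1), vert p q x ∈ P q)
    (hh : ∀ p q, ∀ x ∈ P q, hor p q x ∈ P q) {n : ℕ} {x : ∀ q : Fin (n + 2), W q.val}
    (hx : ∀ q, x q ∈ P q.val) (q : Fin (n + 1)) : totDiff vert hor n x q ∈ P q.val :=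
  add_mem (hv _ _ _ (hx q.succ)) (hh _ _ _ (hx q.castSucc))

/-- A relative cycle of the total complex is moved into the subcomplex one component at a time,
starting with the component of lowest degree in its column. -/
theorem exists_totDiff_sub_mem {P S : ∀ n, Submodule K (W n)}
    (hac : ∀ p, RelAcyclic (vert p) P S) (hv : ∀ p q, ∀ x ∈ P (q + 1), vert p q x ∈ P q)
    (hh : ∀ p q, ∀ x ∈ P q, hor p q x ∈ P q) {n : ℕ} {z : ∀ q : Fin (n + 1), W q.val}
    (hz : ∀ q, z q ∈ P q.val)
    (hcyc : ∀ y : ∀ q : Fin (n + 2), W q.val, ∀ (k : ℕ) (hk : k + 1 < n + 1),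
      (z - totDiff vert hor n y) ⟨k, by omega⟩ ∈ S k →
      vert (n - (k + 1)) k ((z - totDiff vert hor n y) ⟨k + 1, hk⟩) ∈ S k) (k : ℕ)
    (hk : k ≤ n + 1) :
    ∃ y : ∀ q : Fin (n + 2), W q.val, (∀ q, y q ∈ P q.val) ∧
      ∀ q : Fin (n + 1), q.val < k → (z - totDiff vert hor n y) q ∈ S q.val := by
  induction k with
  | zero => exact ⟨0, fun q => zero_mem _, fun q hq => absurd hq (Nat.not_lt_zero _)⟩
  | succ k ih =>
    obtain ⟨y, hy, hS⟩ := ih (by omega)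
    have hP : ∀ q, (z - totDiff vert hor n y) q ∈ P q.val := fun q =>
      sub_mem (hz q) (totDiff_mem hv hh hy q)
    obtain ⟨w, hw, hwS⟩ : ∃ w ∈ P (k + 1),
        (z - totDiff vert hor n y) ⟨k, by omega⟩ - vert (n - k) k w ∈ S k := by
      cases k with
      | zero => exact (hac (n - 0)).zero _ (hP ⟨0, by omega⟩)
      | succ k =>
        exact (hac (n - (k + 1))).succ k _ (hP ⟨k + 1, by omega⟩)
          (hcyc y k (by omega) (hS ⟨k, by omega⟩ (Nat.lt_succ_self k)))
    let w' : ∀ q : Fin (n + 2), W q.val :=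
      Pi.single (M := fun q : Fin (n + 2) => W q.val) ⟨k + 1, by omega⟩ w
    have hne : ∀ q : Fin (n + 2), q.val ≠ k + 1 → w' q = 0 := fun q hq =>
      Pi.single_eq_of_ne (fun h => hq (congrArg Fin.val h)) _
    have heq : w' ⟨k + 1, by omega⟩ = w := Pi.single_eq_same _ _
    refine ⟨y + w', fun q => ?_, fun q hq => ?_⟩
    · refine add_mem (hy q) ?_
      by_cases h : q = ⟨k + 1, by omega⟩
      · subst h
        exact heq.symm ▸ hw
      · rw [hne q fun h' => h (Fin.ext h')]
        exact zero_mem _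
    · have e : (z - totDiff vert hor n (y + w')) q =
          (z - totDiff vert hor n y) q - totDiff vert hor n w' q := by
        rw [map_add, ← sub_sub]
        rfl
      have hc : w' q.castSucc = 0 := hne _ (by rw [Fin.val_castSucc]; omega)
      rw [e, totDiff_apply, hc, map_zero, add_zero]
      rcases Nat.lt_succ_iff_lt_or_eq.1 hq with hlt | rfl
      · rw [hne q.succ (by rw [Fin.val_succ]; omega), map_zero, sub_zero]
        exact hS q hlt
      · exact heq.symm ▸ hwS

/-- A bicomplex with relatively acyclic columns has a relatively acyclic total complex. -/
theorem RelAcyclic.tot {P S : ∀ n, Submodule K (W n)} (hac : ∀ p, RelAcyclic (vert p) P S)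
    (hvv : ∀ p q x, vert p q (vert p (q + 1) x) = 0)
    (hhh : ∀ p q x, hor (p + 1) q (hor (p + 2) q x) = 0)
    (hvh : ∀ p q x, vert p q (hor (p + 1) (q + 1) x) + hor (p + 1) q (vert (p + 1) q x) = 0)
    (hv : ∀ p q, ∀ x ∈ P (q + 1), vert p q x ∈ P q) (hh : ∀ p q, ∀ x ∈ P q, hor p q x ∈ P q)
    (hhS : ∀ p q, ∀ x ∈ S q, hor p q x ∈ S q) :
    RelAcyclic (W := fun n => ∀ q : Fin (n + 1), W q.val) (totDiff vert hor)
      (fun n => Submodule.pi Set.univ fun q : Fin (n + 1) => P q.val)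
      (fun n => Submodule.pi Set.univ fun q : Fin (n + 1) => S q.val) where
  zero x hx := by
    obtain ⟨y, hy, h⟩ := exists_totDiff_sub_mem (hor := hor) hac hv hh
      (fun q => hx q (Set.mem_univ q)) (fun y k hk => absurd hk (by omega)) 1 le_rfl
    exact ⟨y, fun q _ => hy q, fun q _ => h q q.2⟩
  succ n x hx hdx := by
    obtain ⟨y, hy, h⟩ := exists_totDiff_sub_mem (hor := hor) hac hv hh
      (fun q => hx q (Set.mem_univ q)) (fun y k hk hkS => by
        have h := hdx ⟨k, by omega⟩ (Set.mem_univ _)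
        have e : totDiff vert hor n x =
            totDiff vert hor n (x - totDiff vert hor (n + 1) y) := by
          rw [map_sub, totDiff_totDiff hvv hhh hvh, sub_zero]
        rw [e, totDiff_apply] at h
        have e' : n + 1 - (k + 1) = n - k := by omega
        rw [e']
        exact (Submodule.add_mem_iff_left (S k) (hhS (n + 1 - k) k _ hkS)).1 h) (n + 2) le_rfl
    exact ⟨y, fun q _ => hy q, fun q _ => h q q.2⟩

end Total

end LinearAlgebra

/-! ### Full inclusions of superadditive categories -/

section Inclusion

open scoped Classical in
/-- A map of direct sums along an injection of the index sets is injective if its components are. -/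
theorem directSum_injective {K : Type*} [Field K] {ι κ : Type*} {M : ι → Type*} {N : κ → Type*}
    [∀ i, AddCommGroup (M i)] [∀ i, Module K (M i)] [∀ i, AddCommGroup (N i)] [∀ i, Module K (N i)]
    {e : ι → κ} (he : Function.Injective e) (g : ∀ i, M i →ₗ[K] N (e i))
    (hg : ∀ i, Function.Injective (g i)) (L : (⨁ i, M i) →ₗ[K] ⨁ k, N k)
    (hL : ∀ i x, L (DirectSum.lof K ι M i x) = DirectSum.lof K κ N (e i) (g i x)) :
    Function.Injective L := by
  have key : ∀ i, DirectSum.component K κ N (e i) ∘ₗ L = g i ∘ₗ DirectSum.component K ι M i :=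
    fun i => DirectSum.linearMap_ext K fun j => LinearMap.ext fun x => by
      simp only [LinearMap.comp_apply]
      rw [hL]
      by_cases h : j = i
      · subst h
        rw [DirectSum.component.lof_self, DirectSum.component.lof_self]
      · rw [DirectSum.component.of, dif_neg fun h' => h (he h'), DirectSum.component.of,
          dif_neg h, map_zero]
  rw [← LinearMap.ker_eq_bot, LinearMap.ker_eq_bot']
  intro x hx
  refine DirectSum.ext_component K fun i => hg i ?_
  have h := LinearMap.congr_fun (key i) x
  rw [LinearMap.comp_apply, LinearMap.comp_apply, hx, map_zero] at h
  rw [← h, map_zero, map_zero]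

variable {K : Type u} [Field K]
  {C : Type u} [Category.{u} C] [Preadditive C] [Linear K C] [SuperCategory K C]
  {E : Type u} [Category.{u} E] [Preadditive E] [Linear K E] [SuperCategory K E]

variable (K C E) in
/-- A fully faithful even `K`-linear functor that is injective on objects. -/
structure FullInclusion where
  obj : C → E
  obj_injective : Function.Injective obj
  map : ∀ {X Y : C}, (X ⟶ Y) ≃ₗ[K] (obj X ⟶ obj Y)
  map_id : ∀ X : C, map (𝟙 X) = 𝟙 (obj X)
  map_comp : ∀ {X Y Z : C} (f : X ⟶ Y) (g : Y ⟶ Z), map (f ≫ g) = map f ≫ map g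
  map_mem : ∀ {X Y : C} {q : ZMod 2} {f : X ⟶ Y}, f ∈ SuperCategory.deg (K := K) X Y q →
    map f ∈ SuperCategory.deg (K := K) (obj X) (obj Y) q

namespace FullInclusion

variable (F : FullInclusion K C E)

theorem map_proj (q : ZMod 2) {X Y : C} (f : X ⟶ Y) :
    F.map (proj K q X Y f) = proj K q _ _ (F.map f) := by
  refine LinearMap.congr_fun (f := F.map.toLinearMap ∘ₗ proj K q X Y)
    (g := proj K q _ _ ∘ₗ F.map.toLinearMap) (hom_ext_deg fun s a ha => ?_) f
  simp only [LinearMap.comp_apply, LinearEquiv.coe_coe]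
  rw [proj_of_mem ha, proj_of_mem (F.map_mem ha)]
  split_ifs <;> simp

theorem map_signMap (q : ZMod 2) {X Y : C} (f : X ⟶ Y) :
    F.map (signMap K q X Y f) = signMap K q _ _ (F.map f) := by
  simp only [signMap, LinearMap.add_apply, LinearMap.smul_apply, map_add, map_smul, map_proj]

theorem map_symm_mem {X Y : C} {q : ZMod 2} {g : F.obj X ⟶ F.obj Y}
    (hg : g ∈ SuperCategory.deg (K := K) (F.obj X) (F.obj Y) q) :
    F.map.symm g ∈ SuperCategory.deg (K := K) X Y q := by
  have h : proj K q X Y (F.map.symm g) = F.map.symm g := by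
    apply F.map.injective
    rw [map_proj, LinearEquiv.apply_symm_apply, proj_of_mem hg, if_pos rfl]
  rw [← h]
  exact proj_mem q _

/-- The map of strings induced by a full inclusion. -/
noncomputable def mapBar : ∀ (n : ℕ) {X Y : C}, Bar K n X Y →ₗ[K] Bar K n (F.obj X) (F.obj Y)
  | 0, _, _ => (Bar.of K).toLinearMap ∘ₗ F.map.toLinearMap ∘ₗ (Bar.of K).symm.toLinearMap
  | n + 1, _, _ => Bar.lift fun _ => (Bar.cons K).compl₁₂ F.map.toLinearMap (mapBar n)

theorem mapBar_of {X Y : C} (a : X ⟶ Y) : F.mapBar 0 (Bar.of K a) = Bar.of K (F.map a) := rfl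

theorem mapBar_cons {n : ℕ} {X Y Z : C} (a : X ⟶ Z) (w : Bar K n Z Y) :
    F.mapBar (n + 1) (Bar.cons K a w) = Bar.cons K (F.map a) (F.mapBar n w) :=
  Bar.lift_cons _ a w

theorem mapBar_lmul {n : ℕ} {X' X Y : C} (b : X' ⟶ X) (w : Bar K n X Y) :
    F.mapBar n (Bar.lmul n b w) = Bar.lmul n (F.map b) (F.mapBar n w) := by
  cases n with
  | zero =>
    induction w using Bar.induction_of
    simp [mapBar_of, F.map_comp]
  | succ n =>
    induction w using Bar.induction_cons with
    | add w w' h h' => simp only [map_add, h, h']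
    | cons Z a w => simp [mapBar_cons, F.map_comp]

theorem mapBar_snoc {n : ℕ} {X Y Z : C} (w : Bar K n X Z) (c : Z ⟶ Y) :
    F.mapBar (n + 1) (Bar.snoc n w c) = Bar.snoc n (F.mapBar n w) (F.map c) := by
  induction n generalizing X with
  | zero =>
    induction w using Bar.induction_of
    simp [mapBar_of, mapBar_cons]
  | succ n ih =>
    induction w using Bar.induction_cons with
    | add w w' h h' => simp only [map_add, LinearMap.add_apply, h, h']
    | cons Z a w => simp [mapBar_cons, ih]

theorem mapBar_face (i : ℕ) {n : ℕ} {X Y : C} (w : Bar K (n + 1) X Y) :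
    F.mapBar n (Bar.face i n w) = Bar.face i n (F.mapBar (n + 1) w) := by
  induction i generalizing n X with
  | zero =>
    induction w using Bar.induction_cons with
    | add w w' h h' => simp only [map_add, h, h']
    | cons Z a w => simp [mapBar_cons, mapBar_lmul]
  | succ i ih =>
    cases n with
    | zero => simp [Bar.face]
    | succ n =>
      induction w using Bar.induction_cons with
      | add w w' h h' => simp only [map_add, h, h']
      | cons Z a w => simp [mapBar_cons, ih]

theorem mapBar_signBar (q : ZMod 2) {n : ℕ} {X Y : C} (w : Bar K n X Y) :
    F.mapBar n (Bar.signBar q n X Y w) = Bar.signBar q n _ _ (F.mapBar n w) := by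
  induction n generalizing X with
  | zero =>
    induction w using Bar.induction_of
    simp [mapBar_of, map_signMap]
  | succ n ih =>
    induction w using Bar.induction_cons with
    | add w w' h h' => simp only [map_add, h, h']
    | cons Z a w => simp [mapBar_cons, ih, map_signMap]

theorem mapBar_injective (n : ℕ) (X Y : C) :
    Function.Injective (F.mapBar n : Bar K n X Y →ₗ[K] _) := by
  classical
  induction n generalizing X with
  | zero => exact (F.map (X := X) (Y := Y)).injective
  | succ n ih =>
    refine directSum_injective (K := K) (M := fun Z => (X ⟶ Z) ⊗[K] Bar K n Z Y)
      (N := fun Z => (F.obj X ⟶ Z) ⊗[K] Bar K n Z (F.obj Y)) F.obj_injective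
      (fun Z => TensorProduct.map F.map.toLinearMap (F.mapBar n))
      (fun Z => TensorProduct.map_injective_of_flat_flat _ _ F.map.injective (ih Z)) _
      fun Z x => ?_
    refine LinearMap.congr_fun
      (f := (F.mapBar (n + 1) : Bar K (n + 1) X Y →ₗ[K] _) ∘ₗ
        DirectSum.lof K C (fun Z => (X ⟶ Z) ⊗[K] Bar K n Z Y) Z)
      (g := DirectSum.lof K E (fun Z => (F.obj X ⟶ Z) ⊗[K] Bar K n Z (F.obj Y)) (F.obj Z) ∘ₗ
        TensorProduct.map F.map.toLinearMap (F.mapBar n)) (TensorProduct.ext' fun a w => ?_) x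
    exact F.mapBar_cons a w

theorem mapBar_mem_part {n : ℕ} {p : ZMod 2} {X Y : C} {w : Bar K n X Y}
    (hw : w ∈ Bar.part Set.univ n p X Y) :
    F.mapBar n w ∈ Bar.part (Set.range F.obj) n p (F.obj X) (F.obj Y) := by
  rw [← Submodule.mem_comap]
  induction n generalizing X p with
  | zero =>
    refine Bar.part_zero_le (N := Submodule.comap _ _) (fun a ha => ?_) hw
    rw [Submodule.mem_comap]
    exact Bar.of_mem_part (F.map_mem ha)
  | succ n ih =>
    refine Bar.part_succ_le (N := Submodule.comap _ _) (fun Z _ i j hq a ha w hw => ?_) hw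
    rw [Submodule.mem_comap, mapBar_cons, ← hq]
    exact Bar.cons_mem_part (Set.mem_range_self Z) (F.map_mem ha) (ih hw)

theorem part_range_le (n : ℕ) (p : ZMod 2) (X Y : C) :
    Bar.part (Set.range F.obj) n p (F.obj X) (F.obj Y) ≤
      (Bar.part (K := K) Set.univ n p X Y).map (F.mapBar n) := by
  induction n generalizing X p with
  | zero =>
    refine Bar.part_zero_le fun a ha => ⟨Bar.of K (F.map.symm a),
      Bar.of_mem_part (F.map_symm_mem ha), ?_⟩
    rw [mapBar_of, LinearEquiv.apply_symm_apply]
  | succ n ih =>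
    refine Bar.part_succ_le ?_
    rintro _ ⟨Z, rfl⟩ q q' hq a ha w hw
    obtain ⟨v, hv, rfl⟩ := ih q' Z hw
    refine ⟨Bar.cons K (F.map.symm a) v, hq ▸ Bar.cons_mem_part (Set.mem_univ Z)
      (F.map_symm_mem ha) hv, ?_⟩
    rw [mapBar_cons, LinearEquiv.apply_symm_apply]

/-- The map of closed strings induced by a full inclusion. -/
noncomputable def mapClosed (n : ℕ) : Closed K C n →ₗ[K] Closed K E n :=
  Closed.lift fun X => Closed.mk (F.obj X) ∘ₗ F.mapBar n

theorem mapClosed_mk {n : ℕ} (X : C) (w : Bar K n X X) :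
    F.mapClosed n (Closed.mk X w) = Closed.mk (F.obj X) (F.mapBar n w) :=
  Closed.lift_mk _ X w

theorem mapClosed_injective (n : ℕ) : Function.Injective (F.mapClosed n) := by
  classical
  exact directSum_injective (K := K) (M := fun X => Bar K n X X)
    (N := fun X => Bar K n X X) F.obj_injective (fun X => F.mapBar n)
    (fun X => F.mapBar_injective n X X) _ fun X w => F.mapClosed_mk X w

theorem map_mapClosed_part (n : ℕ) (p : ZMod 2) :
    (Closed.part K Set.univ n p).map (F.mapClosed n) = Closed.part K (Set.range F.obj) n p := by
  refine le_antisymm ?_ (Closed.part_le ?_)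
  · rw [Submodule.map_le_iff_le_comap]
    refine Closed.part_le fun X _ w hw => ?_
    rw [Submodule.mem_comap, mapClosed_mk]
    exact Closed.mk_mem_part (Set.mem_range_self X) (F.mapBar_mem_part hw)
  · rintro _ ⟨X, rfl⟩ w hw
    obtain ⟨v, hv, rfl⟩ := F.part_range_le n p X X hw
    exact ⟨Closed.mk X v, Closed.mk_mem_part (Set.mem_univ X) hv, F.mapClosed_mk X v⟩

theorem mapClosed_face (i n : ℕ) (x : Closed K C (n + 1)) :
    F.mapClosed n (Closed.face i n x) = Closed.face i n (F.mapClosed (n + 1) x) := by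
  revert x
  refine LinearMap.congr_fun (f := F.mapClosed n ∘ₗ Closed.face i n)
    (g := Closed.face i n ∘ₗ F.mapClosed (n + 1)) (Closed.hom_ext fun X w => ?_)
  simp [mapClosed_mk, mapBar_face]

theorem mapClosed_rot (n : ℕ) (x : Closed K C (n + 1)) :
    F.mapClosed (n + 1) (Closed.rot n x) = Closed.rot n (F.mapClosed (n + 1) x) := by
  revert x
  refine LinearMap.congr_fun (f := F.mapClosed (n + 1) ∘ₗ Closed.rot n)
    (g := Closed.rot n ∘ₗ F.mapClosed (n + 1)) (Closed.snoc_ext fun X Z w q c hc => ?_)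
  simp only [LinearMap.comp_apply]
  rw [Closed.rot_mk_snoc_of_mem w hc, mapClosed_mk, mapClosed_mk, mapBar_snoc,
    Closed.rot_mk_snoc_of_mem _ (F.map_mem hc), mapBar_cons, mapBar_signBar]

theorem mapClosed_diff (n : ℕ) (x : Closed K C (n + 1)) :
    F.mapClosed n (Closed.diff K C n x) = Closed.diff K E n (F.mapClosed (n + 1) x) := by
  simp only [Closed.diff_eq_sum, LinearMap.sum_apply, LinearMap.smul_apply, map_sum, map_smul,
    mapClosed_face]

theorem mapClosed_bdry (n : ℕ) (x : Closed K C (n + 1)) :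
    F.mapClosed n (Closed.bdry K C n x) = Closed.bdry K E n (F.mapClosed (n + 1) x) := by
  simp only [Closed.bdry_apply, Closed.lastFace_apply, map_add, map_smul, mapClosed_diff,
    mapClosed_face, mapClosed_rot]

theorem mapClosed_cyc (n : ℕ) (x : Closed K C n) :
    F.mapClosed n (Closed.cyc K C n x) = Closed.cyc K E n (F.mapClosed n x) := by
  cases n with
  | zero => rfl
  | succ n => simp only [Closed.cyc, LinearMap.smul_apply, map_smul, mapClosed_rot]

theorem mapClosed_norm (n : ℕ) (x : Closed K C n) :
    F.mapClosed n (Closed.norm K C n x) = Closed.norm K E n (F.mapClosed n x) := by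
  have h : ∀ i, F.mapClosed n ((Closed.cyc K C n ^ i) x) =
      (Closed.cyc K E n ^ i) (F.mapClosed n x) := fun i => by
    induction i with
    | zero => rfl
    | succ i ih => rw [pow_succ', pow_succ', Module.End.mul_apply, Module.End.mul_apply,
        mapClosed_cyc, ih]
  simp only [Closed.norm, LinearMap.sum_apply, map_sum, h]

end FullInclusion

end Inclusion

/-! ### Homology and full inclusions -/

section Homology

variable {K : Type u} [Field K] {C : Type u} [Category.{u} C] [Preadditive C] [Linear K C]
  [SuperCategory K C]

theorem closedEquiv_boundary {n : ℕ} (x : Chain K C (n + 1)) :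
    closedEquiv K C n (boundary K C n x) = Closed.bdry K C n (closedEquiv K C (n + 1) x) := by
  rw [boundary, faceLast, LinearMap.add_apply, LinearMap.smul_apply, LinearMap.comp_apply, map_add,
    map_smul, closedEquiv_barBoundary, closedEquiv_faceZero, closedEquiv_rotate]
  rfl

theorem closedEquiv_cyclicOp {n : ℕ} (x : Chain K C n) :
    closedEquiv K C n (cyclicOp K C n x) = Closed.cyc K C n (closedEquiv K C n x) := by
  cases n with
  | zero => rfl
  | succ n => rw [cyclicOp, LinearMap.smul_apply, map_smul, closedEquiv_rotate]; rfl

theorem closedEquiv_normOp {n : ℕ} (x : Chain K C n) :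
    closedEquiv K C n (normOp K C n x) = Closed.norm K C n (closedEquiv K C n x) := by
  have h : ∀ i, closedEquiv K C n ((cyclicOp K C n ^ i : Module.End K (Chain K C n)) x) =
      (Closed.cyc K C n ^ i) (closedEquiv K C n x) := fun i => by
    induction i with
    | zero => rfl
    | succ i ih => rw [pow_succ', pow_succ', Module.End.mul_apply, Module.End.mul_apply,
        closedEquiv_cyclicOp, ih]
  rw [normOp, Closed.norm, LinearMap.sum_apply, LinearMap.sum_apply, map_sum]
  exact Finset.sum_congr rfl fun i _ => h i

namespace Closed

variable (K C) in
/-- The vertical differentials of the cyclic bicomplex of closed strings. -/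
noncomputable def vert (p q : ℕ) : Closed K C (q + 1) →ₗ[K] Closed K C q :=
  if Even p then bdry K C q else -diff K C q

variable (K C) in
/-- The horizontal differentials of the cyclic bicomplex of closed strings. -/
noncomputable def hor (p q : ℕ) : Closed K C q →ₗ[K] Closed K C q :=
  if Even p then norm K C q else LinearMap.id - cyc K C q

theorem vert_vert (p q : ℕ) (x : Closed K C (q + 2)) :
    vert K C p q (vert K C p (q + 1) x) = 0 := by
  rw [vert, vert]
  split_ifs
  · exact bdry_bdry q x
  · simp [diff_diff]

theorem hor_hor (p q : ℕ) (x : Closed K C q) : hor K C (p + 1) q (hor K C (p + 2) q x) = 0 := by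
  rw [hor, hor]
  by_cases hp : Even p
  · rw [if_neg (by simpa [Nat.even_add_one] using hp), if_pos (by simpa [Nat.even_add] using hp)]
    exact norm_eq_cyc_norm q x
  · rw [if_pos (by simpa [Nat.even_add_one] using hp), if_neg (by simpa [Nat.even_add] using hp)]
    exact norm_sub_cyc q x

theorem vert_hor (p q : ℕ) (x : Closed K C (q + 1)) :
    vert K C p q (hor K C (p + 1) (q + 1) x) + hor K C (p + 1) q (vert K C (p + 1) q x) = 0 := by
  rw [vert, vert, hor, hor]
  by_cases hp : Even p
  · have hp' : ¬ Even (p + 1) := by simpa [Nat.even_add_one] using hp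
    rw [if_pos hp, if_neg hp', if_neg hp', if_neg hp']
    have h := bdry_sub_cyc q x
    simp only [LinearMap.sub_apply, LinearMap.id_apply, LinearMap.neg_apply, map_neg, h]
    abel
  · have hp' : Even (p + 1) := by simpa [Nat.even_add_one] using hp
    rw [if_neg hp, if_pos hp', if_pos hp', if_pos hp', LinearMap.neg_apply, diff_norm]
    exact neg_add_cancel _

section Parts

variable {S : Set C} {p : ZMod 2}

theorem diff_mem_part {n : ℕ} {x : Closed K C (n + 1)} (hx : x ∈ part K S (n + 1) p) :
    diff K C n x ∈ part K S n p := by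
  rw [diff_eq_sum, LinearMap.sum_apply]
  exact Submodule.sum_mem _ fun i _ => Submodule.smul_mem _ _
    (map_mem_part (fun _ _ hw => Bar.face_mem_part i hw) hx)

theorem bdry_mem_part {n : ℕ} {x : Closed K C (n + 1)} (hx : x ∈ part K S (n + 1) p) :
    bdry K C n x ∈ part K S n p :=
  add_mem (diff_mem_part hx) (Submodule.smul_mem _ _
    (map_mem_part (fun _ _ hw => Bar.face_mem_part 0 hw) (rot_mem_part hx)))

theorem cyc_mem_part {n : ℕ} {x : Closed K C n} (hx : x ∈ part K S n p) :
    cyc K C n x ∈ part K S n p := by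
  cases n with
  | zero => exact hx
  | succ n => exact Submodule.smul_mem _ _ (rot_mem_part hx)

theorem norm_mem_part {n : ℕ} {x : Closed K C n} (hx : x ∈ part K S n p) :
    norm K C n x ∈ part K S n p := by
  rw [norm, LinearMap.sum_apply]
  refine Submodule.sum_mem _ fun i hi => ?_
  clear hi
  induction i with
  | zero => exact hx
  | succ i ih => rw [pow_succ', Module.End.mul_apply]; exact cyc_mem_part ih

theorem vert_mem_part (k q : ℕ) (x : Closed K C (q + 1)) (hx : x ∈ part K S (q + 1) p) :
    vert K C k q x ∈ part K S q p := by
  rw [vert]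
  split_ifs
  · exact bdry_mem_part hx
  · exact neg_mem (diff_mem_part hx)

theorem hor_mem_part (k q : ℕ) (x : Closed K C q) (hx : x ∈ part K S q p) :
    hor K C k q x ∈ part K S q p := by
  rw [hor]
  split_ifs
  · exact norm_mem_part hx
  · exact sub_mem hx (cyc_mem_part hx)

/-- A set of objects `S` generates `C` if every identity morphism is a finite sum of composites
`uv` of homogeneous morphisms of equal parity through objects of `S`. -/
def _root_.SuperHochschild.Generates (K : Type u) [Field K] {C : Type u} [Category.{u} C]
    [Preadditive C] [Linear K C] [SuperCategory K C] (S : Set C) : Prop :=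
  ∀ Z : C, ∃ r ∈ Bar.part (K := K) S 1 0 Z Z, Bar.diff K 0 Z Z r = Bar.of K (𝟙 Z)

theorem relAcyclic_bdry (hS : Generates K S) (p : ZMod 2) :
    RelAcyclic (bdry K C) (part K Set.univ · p) (part K S · p) := by
  choose r hrS hr using hS
  have hσ : ∀ q Z, Bar.signBar q 1 Z Z (r Z) = r Z := fun q Z => by
    rw [Bar.signBar_of_mem (hrS Z), mul_zero, sign_zero, one_smul]
  have hru : ∀ Z, r Z ∈ Bar.part Set.univ 1 0 Z Z := fun Z =>
    Bar.part_mono (Set.subset_univ S) _ _ _ _ (hrS Z)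
  refine ⟨fun x hx => ⟨contr r 0 x, contr_mem_part r hru hx, ?_⟩, fun n x hx hdx =>
    ⟨contr r (n + 1) x, contr_mem_part r hru hx, ?_⟩⟩
  · rw [bdry_contr_zero r hr, sub_sub_cancel]
    exact retract_mem_part r hrS hx
  · rw [bdry_contr_succ r hr hσ, sub_sub, sub_sub_cancel]
    exact add_mem (retract_mem_part r hrS hx) (contr_mem_part r hrS hdx)

theorem relAcyclic_diff (S : Set C) (p : ZMod 2) :
    RelAcyclic (diff K C) (part K Set.univ · p) (part K S · p) := by
  refine ⟨fun x hx => ⟨consId 0 x, consId_mem_part hx, ?_⟩, fun n x hx hdx =>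
    ⟨consId (n + 1) x, consId_mem_part hx, ?_⟩⟩
  · rw [diff_consId_zero, sub_self]
    exact zero_mem _
  · rw [diff_consId_succ, sub_sub_cancel]
    exact consId_mem_part hdx

theorem relAcyclic_vert (hS : Generates K S) (p : ZMod 2) (k : ℕ) :
    RelAcyclic (vert K C k) (part K Set.univ · p) (part K S · p) := by
  by_cases hk : Even k
  · have : vert K C k = bdry K C := funext fun q => if_pos hk
    rw [this]
    exact relAcyclic_bdry hS p
  · have : vert K C k = fun q => -diff K C q := funext fun q => if_neg hk
    rw [this]
    exact (relAcyclic_diff S p).neg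

end Parts

end Closed

/-! #### The parity decomposition of chains -/

theorem isCompl_chainPart (n : ℕ) (p : ZMod 2) :
    IsCompl (chainPart K C n p) (chainPart K C n (p + 1)) := by
  constructor
  · rw [Submodule.disjoint_def]
    intro x hx hx'
    rw [mem_chainPart_iff] at hx hx'
    have h := Closed.projBar_of_mem hx p
    rw [Closed.projBar_of_mem hx' p, if_pos rfl, if_neg (by clear hx hx' h; revert p; decide)] at h
    exact (map_eq_zero_iff _ (closedEquiv K C n).injective).1 h.symm
  · rw [codisjoint_iff_le_sup]
    intro x _
    have h₁ : (chainPart K C n p ⊔ chainPart K C n (p + 1)) =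
        chainPart K C n 0 ⊔ chainPart K C n 1 := by
      rcases zmodTwo_cases p with rfl | rfl
      · rw [zero_add]
      · rw [sup_comm]
        congr 2
    rw [h₁]
    obtain ⟨y, hy, z, hz, hyz⟩ := Submodule.mem_sup.1 (Closed.mem_sup_part (closedEquiv K C n x))
    rw [← map_closedEquiv_chainPart] at hy hz
    obtain ⟨y, hy, rfl⟩ := hy
    obtain ⟨z, hz, rfl⟩ := hz
    have : y + z = x := (closedEquiv K C n).injective (by rw [map_add]; exact hyz)
    exact this ▸ Submodule.add_mem_sup hy hz

end Homology

/-! ### Invariance of Hochschild and cyclic homology under full inclusions -/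

section HomologyInvariance

variable {K : Type u} [Field K] {C : Type u} [Category.{u} C] [Preadditive C] [Linear K C]
  [SuperCategory K C]

theorem closedEquiv_vertical {p q : ℕ} (x : Chain K C (q + 1)) :
    closedEquiv K C q (vertical K C p q x) = Closed.vert K C p q (closedEquiv K C (q + 1) x) := by
  rw [vertical, Closed.vert]
  split_ifs
  · exact closedEquiv_boundary x
  · rw [LinearMap.neg_apply, map_neg, closedEquiv_barBoundary]
    rfl

theorem closedEquiv_horizontal {p q : ℕ} (x : Chain K C q) :
    closedEquiv K C q (horizontal K C p q x) = Closed.hor K C p q (closedEquiv K C q x) := by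
  rw [horizontal, Closed.hor]
  split_ifs
  · exact closedEquiv_normOp x
  · rw [LinearMap.sub_apply, map_sub, closedEquiv_cyclicOp]
    rfl

theorem totBoundary_totBoundary (n : ℕ) (x : Tot K C (n + 2)) :
    totBoundary K C n (totBoundary K C (n + 1) x) = 0 := by
  refine totDiff_totDiff (vert := vertical K C) (hor := horizontal K C) (fun p q x => ?_)
    (fun p q x => ?_) (fun p q x => ?_) n x
  · apply (closedEquiv K C q).injective
    rw [closedEquiv_vertical, closedEquiv_vertical, Closed.vert_vert, map_zero]
  · apply (closedEquiv K C q).injective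
    rw [closedEquiv_horizontal, closedEquiv_horizontal, Closed.hor_hor, map_zero]
  · apply (closedEquiv K C q).injective
    rw [map_add, closedEquiv_vertical, closedEquiv_horizontal, closedEquiv_horizontal,
      closedEquiv_vertical, Closed.vert_hor, map_zero]

theorem vertical_mem_chainPart (k q : ℕ) (p : ZMod 2) (x : Chain K C (q + 1))
    (hx : x ∈ chainPart K C (q + 1) p) : vertical K C k q x ∈ chainPart K C q p := by
  rw [mem_chainPart_iff] at hx ⊢
  rw [closedEquiv_vertical]
  exact Closed.vert_mem_part k q _ hx

theorem horizontal_mem_chainPart (k q : ℕ) (p : ZMod 2) (x : Chain K C q)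
    (hx : x ∈ chainPart K C q p) : horizontal K C k q x ∈ chainPart K C q p := by
  rw [mem_chainPart_iff] at hx ⊢
  rw [closedEquiv_horizontal]
  exact Closed.hor_mem_part k q _ hx

theorem totBoundary_mem_totPart (n : ℕ) (p : ZMod 2) (x : Tot K C (n + 1))
    (hx : x ∈ totPart K C (n + 1) p) : totBoundary K C n x ∈ totPart K C n p := fun q _ =>
  totDiff_mem (P := fun n => chainPart K C n p) (vert := vertical K C) (hor := horizontal K C)
    (fun k q x hx => vertical_mem_chainPart k q p x hx)
    (fun k q x hx => horizontal_mem_chainPart k q p x hx) (fun q => hx q (Set.mem_univ q)) q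

theorem isCompl_totPart (n : ℕ) (p : ZMod 2) :
    IsCompl (totPart K C n p) (totPart K C n (p + 1)) := by
  constructor
  · rw [Submodule.disjoint_def]
    intro x hx hx'
    funext q
    exact Submodule.disjoint_def.1 (isCompl_chainPart q.val p).disjoint _ (hx q (Set.mem_univ q))
      (hx' q (Set.mem_univ q))
  · rw [codisjoint_iff_le_sup]
    intro x _
    have h : ∀ q : Fin (n + 1), ∃ y ∈ chainPart K C q.val p, ∃ z ∈ chainPart K C q.val (p + 1),
        y + z = x q := fun q =>
      Submodule.mem_sup.1 ((isCompl_chainPart q.val p).sup_eq_top.ge Submodule.mem_top)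
    choose y hy z hz hyz using h
    have e : y + z = x := funext hyz
    exact e ▸ Submodule.add_mem_sup (fun q _ => hy q) (fun q _ => hz q)

variable (K C) in
/-- Cyclic cohomology is dual to cyclic homology. -/
theorem nonempty_cyclicCohomologyEquiv (n : ℕ) (p : ZMod 2) :
    Nonempty (CyclicCohomology K C n p ≃ₗ[K] Module.Dual K (CyclicHomology K C n p)) := by
  have h := nonempty_dualCohomologyEquiv (V := fun n => Tot K C n) (d := totBoundary K C)
    (fun n => isCompl_totPart n p) (fun n => totBoundary_mem_totPart n p)
    (fun n => totBoundary_mem_totPart n (p + 1)) totBoundary_totBoundary n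
  have e₁ : dualCoboundaries (V := fun n => Tot K C n) (totBoundary K C)
      (fun n => totPart K C n (p + 1)) n = cyclicCoboundaries K C p n := by
    cases n <;> rfl
  have e₂ : cyclesOf (V := fun n => Tot K C n) (totBoundary K C) (fun n => totPart K C n p) n =
      cyclicCycles K C p n := by
    cases n <;> rfl
  rw [e₁, e₂] at h
  exact h

variable {E : Type u} [Category.{u} E] [Preadditive E] [Linear K E] [SuperCategory K E]

namespace FullInclusion

variable (F : FullInclusion K C E)

/-- The map from chains of `C` to closed strings of `E` induced by a full inclusion. -/
noncomputable def ofChain (n : ℕ) : Chain K C n →ₗ[K] Closed K E n :=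
  F.mapClosed n ∘ₗ (closedEquiv K C n).toLinearMap

theorem ofChain_injective (n : ℕ) : Function.Injective (F.ofChain n) :=
  (F.mapClosed_injective n).comp (closedEquiv K C n).injective

theorem map_ofChain_chainPart (n : ℕ) (p : ZMod 2) :
    (chainPart K C n p).map (F.ofChain n) = Closed.part K (Set.range F.obj) n p := by
  rw [ofChain, Submodule.map_comp, map_closedEquiv_chainPart, map_mapClosed_part]

theorem ofChain_mem_part {n : ℕ} {p : ZMod 2} {x : Chain K C n} (hx : x ∈ chainPart K C n p) :
    F.ofChain n x ∈ Closed.part K Set.univ n p :=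
  Closed.part_mono (Set.subset_univ _) n p
    ((F.map_ofChain_chainPart n p).le (Submodule.mem_map_of_mem hx))

theorem ofChain_boundary (n : ℕ) (x : Chain K C (n + 1)) :
    F.ofChain n (boundary K C n x) = Closed.bdry K E n (F.ofChain (n + 1) x) :=
  (congrArg (F.mapClosed n) (closedEquiv_boundary x)).trans (F.mapClosed_bdry n _)

theorem ofChain_vertical (p q : ℕ) (x : Chain K C (q + 1)) :
    F.ofChain q (vertical K C p q x) = Closed.vert K E p q (F.ofChain (q + 1) x) := by
  refine (congrArg (F.mapClosed q) (closedEquiv_vertical x)).trans ?_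
  rw [Closed.vert, Closed.vert]
  split_ifs
  · exact F.mapClosed_bdry q _
  · rw [LinearMap.neg_apply, map_neg, mapClosed_diff]
    rfl

theorem ofChain_horizontal (p q : ℕ) (x : Chain K C q) :
    F.ofChain q (horizontal K C p q x) = Closed.hor K E p q (F.ofChain q x) := by
  refine (congrArg (F.mapClosed q) (closedEquiv_horizontal x)).trans ?_
  rw [Closed.hor, Closed.hor]
  split_ifs
  · exact F.mapClosed_norm q _
  · rw [LinearMap.sub_apply, map_sub, mapClosed_cyc]
    rfl

theorem nonempty_hochschildHomologyEquiv (hF : Generates K (Set.range F.obj)) (n : ℕ)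
    (p : ZMod 2) : Nonempty (HochschildHomology K C n p ≃ₗ[K]
      Subquotient (cyclesOf (Closed.bdry K E) (Closed.part K Set.univ · p) n)
        ((Closed.part K Set.univ (n + 1) p).map (Closed.bdry K E n))) := by
  have hac := Closed.relAcyclic_bdry hF p
  simp only [← map_ofChain_chainPart] at hac
  have h := hac.nonempty_homologyEquiv (V := fun n => Chain K C n) (dV := boundary K C)
    F.ofChain F.ofChain_boundary F.ofChain_injective (fun n x hx => F.ofChain_mem_part hx)
    Closed.bdry_bdry n
  have e : cyclesOf (V := fun n => Chain K C n) (boundary K C) (fun n => chainPart K C n p) n =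
      cycles K C p n := by
    cases n <;> rfl
  rw [e] at h
  exact h

theorem nonempty_cyclicHomologyEquiv (hF : Generates K (Set.range F.obj)) (n : ℕ)
    (p : ZMod 2) : Nonempty (CyclicHomology K C n p ≃ₗ[K]
      Subquotient (cyclesOf (V := fun n => ∀ q : Fin (n + 1), Closed K E q.val)
          (totDiff (Closed.vert K E) (Closed.hor K E))
          (fun n => Submodule.pi Set.univ fun q : Fin (n + 1) =>
            Closed.part K Set.univ q.val p) n)
        ((Submodule.pi Set.univ fun q : Fin (n + 2) => Closed.part K Set.univ q.val p).map
          (totDiff (Closed.vert K E) (Closed.hor K E) n))) := by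
  have hac := RelAcyclic.tot (fun k => Closed.relAcyclic_vert hF p k) Closed.vert_vert
    Closed.hor_hor Closed.vert_hor (fun k q x hx => Closed.vert_mem_part k q x hx)
    (fun k q x hx => Closed.hor_mem_part k q x hx) (fun k q x hx => Closed.hor_mem_part k q x hx)
  let i : ∀ n, Tot K C n →ₗ[K] ∀ q : Fin (n + 1), Closed K E q.val := fun n =>
    LinearMap.pi fun q => F.ofChain q.val ∘ₗ LinearMap.proj q
  have hi : ∀ n, (totPart K C n p).map (i n) = Submodule.pi Set.univ fun q : Fin (n + 1) =>
      Closed.part K (Set.range F.obj) q.val p := fun n => by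
    ext x
    constructor
    · rintro ⟨y, hy, rfl⟩ q _
      exact (F.map_ofChain_chainPart q.val p).le (Submodule.mem_map_of_mem (hy q (Set.mem_univ q)))
    · intro hx
      have h : ∀ q : Fin (n + 1), ∃ y ∈ chainPart K C q.val p, F.ofChain q.val y = x q := fun q =>
        (F.map_ofChain_chainPart q.val p).ge (hx q (Set.mem_univ q))
      choose y hy hyx using h
      exact ⟨y, fun q _ => hy q, funext hyx⟩
  simp only [← hi] at hac
  have h := hac.nonempty_homologyEquiv (V := fun n => Tot K C n) (dV := totBoundary K C)
    (PV := fun n => totPart K C n p)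
    (PW := fun n => Submodule.pi Set.univ fun q : Fin (n + 1) => Closed.part K Set.univ q.val p) i
    (fun n x => funext fun q => ?_)
    (fun n x y hxy => funext fun q => F.ofChain_injective q.val (congrFun hxy q))
    (fun n x hx q _ => F.ofChain_mem_part (hx q (Set.mem_univ q)))
    (totDiff_totDiff Closed.vert_vert Closed.hor_hor Closed.vert_hor) n
  · have e : cyclesOf (V := fun n => Tot K C n) (totBoundary K C) (fun n => totPart K C n p) n =
        cyclicCycles K C p n := by
      cases n <;> rfl
    rw [e] at h
    exact h
  · refine (map_add (F.ofChain q.val) _ _).trans ?_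
    exact congrArg₂ (· + ·) (F.ofChain_vertical _ _ _) (F.ofChain_horizontal _ _ _)

end FullInclusion

end HomologyInvariance

/-! ### Hochschild cochains as linear maps on strings -/

section Cochains

variable {K : Type u} [Field K] {C : Type u} [Category.{u} C] [Preadditive C] [Linear K C]
  [SuperCategory K C]

namespace Cochain

theorem ext_eval {n : ℕ} {φ ψ : Cochain K C n}
    (h : ∀ Z a, Cochain.eval K C φ Z a = Cochain.eval K C ψ Z a) : φ = ψ :=
  funext fun Z => PiTensorProduct.ext (MultilinearMap.ext fun a => h Z a)

theorem exists_toBar {n : ℕ} (p : ZMod 2) (φ : Cochain K C n) (X : C) :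
    ∃ L : ∀ Y, Bar K n X Y →ₗ[K] (X ⟶ Y), ∀ Z m a,
      L _ (Bar.word K Z m a) = signMap K p _ _ m ≫ Cochain.eval K C φ Z a :=
  Bar.exists_wordLift (W := fun Y => (X ⟶ Y))
    (fun Z m a => signMap K p _ _ m ≫ Cochain.eval K C φ Z a)
    (fun Z a => ⟨Linear.rightComp K X (Cochain.eval K C φ Z a) ∘ₗ signMap K p _ _, fun _ => rfl⟩)
    (fun Z m a k => ⟨Linear.leftComp K _ (signMap K p _ _ m) ∘ₗ Cochain.evalArrow K C φ Z a k,
      fun _ => rfl⟩)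

/-- A cochain `φ` of parity `p` as a linear map on strings that is linear in the first letter:
`(m, a₁, …, aₙ) ↦ (-1)^{p|m|} m φ(a₁, …, aₙ)`. -/
noncomputable def toBar {n : ℕ} (p : ZMod 2) (φ : Cochain K C n) (X Y : C) :
    Bar K n X Y →ₗ[K] (X ⟶ Y) :=
  (exists_toBar p φ X).choose Y

theorem toBar_word {n : ℕ} (p : ZMod 2) (φ : Cochain K C n) {X : C} (Z : Fin (n + 1) → C)
    (m : X ⟶ Z 0) (a : ∀ i : Fin n, Z i.castSucc ⟶ Z i.succ) :
    toBar p φ X _ (Bar.word K Z m a) = signMap K p _ _ m ≫ Cochain.eval K C φ Z a :=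
  (exists_toBar p φ X).choose_spec Z m a

theorem signMap_id (p : ZMod 2) (X : C) : signMap K p X X (𝟙 X) = 𝟙 X := by
  rw [signMap_of_mem (id_mem_deg X), mul_zero, sign_zero, one_smul]

theorem eval_eq_toBar {n : ℕ} (p : ZMod 2) (φ : Cochain K C n) (Z : Fin (n + 1) → C)
    (a : ∀ i : Fin n, Z i.castSucc ⟶ Z i.succ) :
    Cochain.eval K C φ Z a = toBar p φ _ _ (Bar.word K Z (𝟙 (Z 0)) a) := by
  rw [toBar_word, signMap_id, Category.id_comp]

theorem ext_toBar {n : ℕ} (p : ZMod 2) {φ ψ : Cochain K C n}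
    (h : ∀ X Y w, toBar p φ X Y w = toBar p ψ X Y w) : φ = ψ :=
  ext_eval fun Z a => by rw [eval_eq_toBar p, eval_eq_toBar p, h]

theorem toBar_zero {n : ℕ} (p : ZMod 2) (X Y : C) : toBar p (0 : Cochain K C n) X Y = 0 := by
  refine congrFun (Bar.hom_ext_word (f := toBar p (0 : Cochain K C n) X) (g := fun _ => 0)
    fun Z m a => ?_) Y
  rw [toBar_word]
  exact Limits.comp_zero

theorem toBar_lmul {n : ℕ} (p : ZMod 2) (φ : Cochain K C n) {X' X Y : C} (b : X' ⟶ X)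
    (w : Bar K n X Y) :
    toBar p φ X' Y (Bar.lmul n b w) = signMap K p _ _ b ≫ toBar p φ X Y w := by
  refine LinearMap.congr_fun (congrFun (Bar.hom_ext_word
    (f := fun Y => toBar p φ X' Y ∘ₗ Bar.lmul n b)
    (g := fun Y => Linear.leftComp K Y (signMap K p _ _ b) ∘ₗ toBar p φ X Y)
    fun Z m a => ?_) Y) w
  simp only [LinearMap.comp_apply]
  rw [Bar.lmul_word, toBar_word, toBar_word, signMap_comp, Category.assoc]
  rfl

/-- The cochain of values of a linear map on strings that start with an identity morphism. -/
noncomputable def ofBar {n : ℕ} (ψ : ∀ X Y : C, Bar K n X Y →ₗ[K] (X ⟶ Y)) : Cochain K C n :=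
  fun Z => PiTensorProduct.lift (mkMultilinear K (fun a => ψ _ _ (Bar.word K Z (𝟙 (Z 0)) a))
    fun a k => by
      obtain ⟨L, hL⟩ := Bar.word_update (K := K) Z (𝟙 (Z 0)) a k
      exact ⟨ψ _ _ ∘ₗ L, fun v => congrArg _ (hL v)⟩)

theorem ofBar_eval {n : ℕ} (ψ : ∀ X Y : C, Bar K n X Y →ₗ[K] (X ⟶ Y)) (Z : Fin (n + 1) → C)
    (a : ∀ i : Fin n, Z i.castSucc ⟶ Z i.succ) :
    Cochain.eval K C (ofBar ψ) Z a = ψ _ _ (Bar.word K Z (𝟙 (Z 0)) a) :=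
  PiTensorProduct.lift.tprod a

theorem toBar_ofBar {n : ℕ} (p : ZMod 2) (ψ : ∀ X Y : C, Bar K n X Y →ₗ[K] (X ⟶ Y))
    (hψ : ∀ (X' X Y : C) (b : X' ⟶ X) (w : Bar K n X Y),
      ψ X' Y (Bar.lmul n b w) = signMap K p _ _ b ≫ ψ X Y w) (X Y : C) :
    toBar p (ofBar ψ) X Y = ψ X Y := by
  refine congrFun (Bar.hom_ext_word (f := toBar p (ofBar ψ) X) (g := ψ X) fun Z m a => ?_) Y
  rw [toBar_word, ofBar_eval, ← hψ, Bar.lmul_word, Category.comp_id]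

/-- The extension `(w, c) ↦ ψ(w) c` of a linear map on strings. -/
noncomputable def rightExt {n : ℕ} (ψ : ∀ X Y : C, Bar K n X Y →ₗ[K] (X ⟶ Y)) (X Y : C) :
    Bar K (n + 1) X Y →ₗ[K] (X ⟶ Y) :=
  Bar.snocLift n fun Z => Linear.comp X Z Y ∘ₗ ψ X Z

theorem rightExt_snoc {n : ℕ} (ψ : ∀ X Y : C, Bar K n X Y →ₗ[K] (X ⟶ Y)) {X Y Z : C}
    (w : Bar K n X Z) (c : Z ⟶ Y) : rightExt ψ X Y (Bar.snoc n w c) = ψ X Z w ≫ c :=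
  Bar.snocLift_snoc n _ w c

theorem rightExt_rmul {n : ℕ} (ψ : ∀ X Y : C, Bar K n X Y →ₗ[K] (X ⟶ Y)) {X Y Y' : C}
    (w : Bar K (n + 1) X Y) (c : Y ⟶ Y') :
    rightExt ψ X Y' (Bar.rmul (n + 1) c w) = rightExt ψ X Y w ≫ c := by
  induction w using Bar.induction_snoc with
  | add w w' h h' => simp only [map_add, h, h', Preadditive.add_comp]
  | snoc Z w b => rw [Bar.rmul_snoc, rightExt_snoc, rightExt_snoc, Category.assoc]

theorem rightExt_lmul {n : ℕ} {p : ZMod 2} {ψ : ∀ X Y : C, Bar K n X Y →ₗ[K] (X ⟶ Y)}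
    (hψ : ∀ (X' X Y : C) (b : X' ⟶ X) (w : Bar K n X Y),
      ψ X' Y (Bar.lmul n b w) = signMap K p _ _ b ≫ ψ X Y w) (X' X Y : C) (b : X' ⟶ X)
    (w : Bar K (n + 1) X Y) :
    rightExt ψ X' Y (Bar.lmul (n + 1) b w) = signMap K p _ _ b ≫ rightExt ψ X Y w := by
  induction w using Bar.induction_snoc with
  | add w w' h h' => simp only [map_add, h, h', Preadditive.comp_add]
  | snoc Z w c => rw [Bar.lmul_snoc, rightExt_snoc, rightExt_snoc, hψ, Category.assoc]

theorem comp_eqToHom_toBar {n : ℕ} (p : ZMod 2) (φ : Cochain K C n) {X Y Y' : C} (h : Y = Y')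
    (w : Bar K n X Y) :
    toBar p φ X Y' (Bar.rmul n (eqToHom h) w) = toBar p φ X Y w ≫ eqToHom h := by
  subst h
  simp

theorem coboundary_eval (p : ZMod 2) {n : ℕ} (φ : Cochain K C n) (Z : Fin (n + 2) → C)
    (a : ∀ i : Fin (n + 1), Z i.castSucc ⟶ Z i.succ) :
    Cochain.eval K C (coboundary K C p n φ) Z a =
      Cochain.eval K C (cofaceZero K C p n φ) Z a +
        ∑ i : Fin n, ((-1 : K) ^ (i.val + 1)) • Cochain.eval K C (cofaceInner K C n i φ) Z a +
        ((-1 : K) ^ (n + 1)) • Cochain.eval K C (cofaceLast K C n φ) Z a := by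
  simp only [coboundary, Cochain.eval, LinearMap.add_apply, LinearMap.sum_apply,
    LinearMap.smul_apply, Pi.add_apply, Pi.smul_apply, Finset.sum_apply]

/-- The Hochschild coboundary in terms of strings. -/
theorem toBar_coboundary (p : ZMod 2) {n : ℕ} (φ : Cochain K C n) (X Y : C)
    (w : Bar K (n + 1) X Y) :
    toBar p (coboundary K C p n φ) X Y w = toBar p φ X Y (Bar.diff K n X Y w) +
      ((-1 : K) ^ (n + 1)) • rightExt (toBar p φ) X Y w := by
  refine LinearMap.congr_fun (congrFun (Bar.hom_ext_word
    (f := fun Y => toBar p (coboundary K C p n φ) X Y)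
    (g := fun Y => toBar p φ X Y ∘ₗ Bar.diff K n X Y +
      ((-1 : K) ^ (n + 1)) • rightExt (toBar p φ) X Y) fun Z m a => ?_) Y) w
  rw [toBar_word, coboundary_eval, LinearMap.add_apply, LinearMap.comp_apply,
    LinearMap.smul_apply, Bar.diff, LinearMap.sum_apply, Finset.sum_range_succ', Finset.sum_range,
    map_add, map_sum, Preadditive.comp_add, Preadditive.comp_add, Preadditive.comp_sum]
  have h₀ : toBar p φ X (Z (Fin.last (n + 1))) (Bar.face 0 n (Bar.word K Z m a)) =
      signMap K p _ _ m ≫ Cochain.eval K C (cofaceZero K C p n φ) Z a := by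
    have e : Cochain.eval K C (cofaceZero K C p n φ) Z a =
      signMap K p _ _ (firstArrow a) ≫ Cochain.eval K C φ (tailObj Z) (tailArrow a) :=
        Cochain.lift_eval K C _ _ _ _ φ Z a
    refine Eq.trans ?_ (congrArg (fun b => signMap K p X (Z 0) m ≫ b) e.symm)
    refine (congrArg (toBar p φ X (Z (Fin.last (n + 1))))
      ((Bar.face_zero_cons _ _).trans (Bar.lmul_word m (tailObj Z) (firstArrow a)
        (tailArrow a)))).trans ?_
    refine (toBar_word p φ (tailObj Z) (m ≫ firstArrow a) (tailArrow a)).trans ?_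
    exact (congrArg (fun b => b ≫ Cochain.eval K C φ (tailObj Z) (tailArrow a))
      (signMap_comp p m (firstArrow a))).trans (Category.assoc _ _ _)
  have hi : ∀ i : Fin n, toBar p φ X (Z (Fin.last (n + 1)))
      (Bar.face (i.val + 1) n (Bar.word K Z m a)) =
        signMap K p _ _ m ≫ Cochain.eval K C (cofaceInner K C n i φ) Z a := fun i => by
    rw [cofaceInner, Cochain.lift_eval, Bar.face_word, comp_eqToHom_toBar, toBar_word,
      signMap_comp]
    have h : ∀ {X Y : C} (h : X = Y), signMap K p X Y (eqToHom h) = eqToHom h := by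
      rintro X _ rfl
      exact signMap_id p X
    rw [h, Category.assoc, Category.assoc]
  have hl : rightExt (toBar p φ) X (Z (Fin.last (n + 1))) (Bar.word K Z m a) =
      signMap K p _ _ m ≫ Cochain.eval K C (cofaceLast K C n φ) Z a := by
    have e : Cochain.eval K C (cofaceLast K C n φ) Z a =
      (Cochain.eval K C φ (initObj Z) (initArrow a) ≫ lastArrow a : initObj Z 0 ⟶ _) :=
        Cochain.lift_eval K C _ _ _ _ φ Z a
    refine Eq.trans ?_ (congrArg (fun b => signMap K p X (Z 0) m ≫ b) e.symm)
    refine ((congrArg _ (Bar.word_eq_snoc Z m a)).trans (rightExt_snoc (toBar p φ) _ _)).trans ?_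
    exact (congrArg (fun b => b ≫ lastArrow a) (toBar_word p φ (initObj Z) m
      (initArrow a))).trans (Category.assoc _ _ _)
  rw [hl, Linear.comp_smul, LinearMap.smul_apply (_ : K) (Bar.face 0 n), pow_zero, one_smul, h₀,
    add_comm (∑ _, _)]
  congr 2
  refine Finset.sum_congr rfl fun i _ => ?_
  rw [Linear.comp_smul, LinearMap.smul_apply, map_smul, hi]

theorem rightExt_toBar_coboundary (p : ZMod 2) {n : ℕ} (φ : Cochain K C n) (X Y : C)
    (w : Bar K (n + 2) X Y) :
    rightExt (toBar p (coboundary K C p n φ)) X Y w =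
      rightExt (toBar p φ) X Y (Bar.diff K (n + 1) X Y w) := by
  induction w using Bar.induction_snoc with
  | add w w' h h' => simp only [map_add, h, h']
  | snoc Z w c =>
    rw [rightExt_snoc, toBar_coboundary, Bar.diff_succ_snoc, map_add, map_smul, rightExt_snoc,
      rightExt_rmul, Preadditive.add_comp, Linear.smul_comp]

theorem coboundary_coboundary (p : ZMod 2) {n : ℕ} (φ : Cochain K C n) :
    coboundary K C p (n + 1) (coboundary K C p n φ) = 0 := by
  refine ext_toBar p fun X Y w => ?_
  rw [toBar_coboundary, toBar_coboundary, Bar.diff_diff, rightExt_toBar_coboundary, toBar_zero,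
    map_zero, zero_add, pow_succ (-1 : K) (n + 1)]
  simp

/-! ### Parities of cochains -/

theorem toBar_mem_deg {p q : ZMod 2} {n : ℕ} {φ : Cochain K C n} (hφ : φ ∈ cochainPart K C n p)
    {X Y : C} {w : Bar K n X Y} (hw : w ∈ Bar.part Set.univ n q X Y) :
    toBar p φ X Y w ∈ SuperCategory.deg (K := K) X Y (p + q) := by
  refine Bar.part_le_of_word (N := fun Y => (SuperCategory.deg (K := K) X Y (p + q)).comap
    (toBar p φ X Y)) (fun Z m a s ε _ hm ha hq => ?_) Y hw
  rw [Submodule.mem_comap, toBar_word, signMap_of_mem hm, Linear.smul_comp, ← hq, add_left_comm]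
  exact Submodule.smul_mem _ _ (SuperCategory.comp_mem hm (hφ Z a ε ha))

theorem rightExt_toBar_mem_deg {p q : ZMod 2} {n : ℕ} {φ : Cochain K C n}
    (hφ : φ ∈ cochainPart K C n p) {X Y : C} {w : Bar K (n + 1) X Y}
    (hw : w ∈ Bar.part Set.univ (n + 1) q X Y) :
    rightExt (toBar p φ) X Y w ∈ SuperCategory.deg (K := K) X Y (p + q) := by
  refine Bar.part_le_of_snoc (N := (SuperCategory.deg (K := K) X Y (p + q)).comap
    (rightExt (toBar p φ) X Y)) (fun Z _ s t hq w hw c hc => ?_) hw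
  rw [Submodule.mem_comap, rightExt_snoc, ← hq, ← add_assoc]
  exact SuperCategory.comp_mem (toBar_mem_deg hφ hw) hc

theorem word_id_mem_part {n : ℕ} {Z : Fin (n + 1) → C} {a : ∀ i : Fin n, Z i.castSucc ⟶ Z i.succ}
    {ε : Fin n → ZMod 2}
    (ha : ∀ i, a i ∈ SuperCategory.deg (K := K) (Z i.castSucc) (Z i.succ) (ε i)) :
    Bar.word K Z (𝟙 (Z 0)) a ∈ Bar.part Set.univ n (∑ i, ε i) (Z 0) (Z (Fin.last n)) := by
  have h := Bar.word_mem_part (S := Set.univ) (fun _ => Set.mem_univ _) (id_mem_deg (K := K) (Z 0))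
    ha
  rwa [zero_add] at h

theorem coboundary_mem_cochainPart {p : ZMod 2} {n : ℕ} {φ : Cochain K C n}
    (hφ : φ ∈ cochainPart K C n p) : coboundary K C p n φ ∈ cochainPart K C (n + 1) p := by
  intro Z a ε ha
  have hw := word_id_mem_part ha
  rw [eval_eq_toBar p, toBar_coboundary]
  refine add_mem (toBar_mem_deg hφ ?_) (Submodule.smul_mem _ _ (rightExt_toBar_mem_deg hφ hw))
  rw [Bar.diff, LinearMap.sum_apply]
  exact Submodule.sum_mem _ fun i _ => Submodule.smul_mem _ _ (Bar.face_mem_part i hw)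

/-! ### Cochains that vanish on a generating set of objects -/

/-- The cochain `φ` vanishes on the tuples of objects of `S`. -/
def VanishesOn {n : ℕ} (φ : Cochain K C n) (S : Set C) : Prop :=
  ∀ Z a, (∀ i, Z i ∈ S) → Cochain.eval K C φ Z a = 0

variable {S : Set C}

theorem VanishesOn.toBar_eq_zero {n : ℕ} {φ : Cochain K C n} (hφ : φ.VanishesOn S) (p : ZMod 2)
    {q : ZMod 2} {X Y : C} (hY : Y ∈ S) {w : Bar K n X Y} (hw : w ∈ Bar.part S n q X Y) :
    toBar p φ X Y w = 0 := by
  have h := Bar.part_le_of_word (N := fun Y => ⨅ _ : Y ∈ S, LinearMap.ker (toBar p φ X Y))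
    (fun Z m a s ε hZ _ _ _ => by
      refine (Submodule.mem_iInf _).2 fun hl => ?_
      rw [LinearMap.mem_ker, toBar_word, hφ Z a fun i => ?_, Limits.comp_zero]
      cases i using Fin.lastCases with
      | last => exact hl
      | cast i => exact hZ i) Y hw
  exact (Submodule.mem_iInf _).1 h hY

theorem VanishesOn.rightExt_eq_zero {n : ℕ} {φ : Cochain K C n} (hφ : φ.VanishesOn S)
    (p : ZMod 2) {q : ZMod 2} {X Y : C} {w : Bar K (n + 1) X Y}
    (hw : w ∈ Bar.part S (n + 1) q X Y) : rightExt (toBar p φ) X Y w = 0 := by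
  refine Bar.part_le_of_snoc (N := LinearMap.ker (rightExt (toBar p φ) X Y))
    (fun Z hZ s t _ w hw c _ => ?_) hw
  rw [LinearMap.mem_ker, rightExt_snoc, hφ.toBar_eq_zero p hZ hw, Limits.zero_comp]

variable (r : ∀ Z : C, Bar K 1 Z Z)

/-- The contraction of Hochschild cochains dual to the contraction of the bar complex defined
by `r`. -/
noncomputable def contr (p : ZMod 2) {n : ℕ} (φ : Cochain K C (n + 1)) : Cochain K C n :=
  ofBar fun X Y => rightExt (toBar p φ) X Y ∘ₗ Bar.contr r (n + 1) X Y ∘ₗ (Bar.snoc n).flip (𝟙 Y)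

theorem toBar_contr (p : ZMod 2) {n : ℕ} (φ : Cochain K C (n + 1)) {X Y : C} (w : Bar K n X Y) :
    toBar p (contr r p φ) X Y w =
      rightExt (toBar p φ) X Y (Bar.contr r (n + 1) X Y (Bar.snoc n w (𝟙 Y))) := by
  rw [contr, toBar_ofBar]
  · rfl
  · intro X' X Y b w
    simp only [LinearMap.comp_apply, LinearMap.flip_apply]
    rw [← Bar.lmul_snoc, Bar.contr_lmul, rightExt_lmul fun _ _ _ b w => toBar_lmul p φ b w]

theorem rightExt_toBar_contr (p : ZMod 2) {n : ℕ} (φ : Cochain K C (n + 1)) {X Y : C}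
    (w : Bar K (n + 1) X Y) :
    rightExt (toBar p (contr r p φ)) X Y w =
      rightExt (toBar p φ) X Y (Bar.contr r (n + 1) X Y w) := by
  induction w using Bar.induction_snoc with
  | add w w' h h' => simp only [map_add, h, h']
  | snoc Z w c => rw [rightExt_snoc, toBar_contr, ← rightExt_rmul, ← Bar.contr_rmul,
      Bar.rmul_snoc, Category.id_comp]

variable {r}

/-- On a string `w`, a cocycle `φ` that vanishes on `S` takes the value of `h d (w, 1)`, where `h` is the
contraction of the bar complex: it kills `d h (w, 1)`, being a cocycle, and the projection of `(w, 1)`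
to the strings through `S`. -/
theorem VanishesOn.toBar_eq (hr : ∀ Z, Bar.diff K 0 Z Z (r Z) = Bar.of K (𝟙 Z))
    (hrS : ∀ Z, r Z ∈ Bar.part S 1 0 Z Z) {p : ZMod 2} {n : ℕ} {φ : Cochain K C n}
    (hφ : φ.VanishesOn S) (hδ : coboundary K C p n φ = 0) {X Y : C} (w : Bar K n X Y) :
    toBar p φ X Y w = rightExt (toBar p φ) X Y
      (Bar.contr r n X Y (Bar.diff K n X Y (Bar.snoc n w (𝟙 Y)))) := by
  have h := rightExt_toBar_coboundary p φ X Y (Bar.contr r (n + 1) X Y (Bar.snoc n w (𝟙 Y)))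
  have h0 : rightExt (toBar p (coboundary K C p n φ)) X Y
      (Bar.contr r (n + 1) X Y (Bar.snoc n w (𝟙 Y))) = 0 := by
    generalize Bar.contr r (n + 1) X Y (Bar.snoc n w (𝟙 Y)) = x
    induction x using Bar.induction_snoc with
    | add w w' h h' => rw [map_add, h, h', add_zero]
    | snoc Z w c => rw [rightExt_snoc, hδ, toBar_zero, LinearMap.zero_apply, Limits.zero_comp]
  have h1 : rightExt (toBar p φ) X Y (Bar.retract r (n + 1) X Y (Bar.snoc n w (𝟙 Y))) = 0 := by
    have key : ∀ q, Bar.part Set.univ n q X Y ≤ LinearMap.ker (rightExt (toBar p φ) X Y ∘ₗ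
        Bar.retract r (n + 1) X Y ∘ₗ (Bar.snoc n).flip (𝟙 Y)) := fun q w hw =>
      hφ.rightExt_eq_zero p (Bar.retract_mem_part r hrS
        (Bar.snoc_mem_part (Set.mem_univ Y) hw (id_mem_deg Y)))
    exact sup_le (key 0) (key 1) (Bar.mem_sup_part w)
  have h2 := Bar.diff_contr r hr (Bar.snoc n w (𝟙 Y))
  rw [← eq_sub_iff_add_eq] at h2
  rw [h0, h2, map_sub, map_sub, h1, sub_zero, rightExt_snoc, Category.comp_id, eq_comm,
    sub_eq_zero] at h
  exact h

theorem VanishesOn.eq_zero (hr : ∀ Z, Bar.diff K 0 Z Z (r Z) = Bar.of K (𝟙 Z))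
    (hrS : ∀ Z, r Z ∈ Bar.part S 1 0 Z Z) {p : ZMod 2} {φ : Cochain K C 0}
    (hφ : φ.VanishesOn S) (hδ : coboundary K C p 0 φ = 0) : φ = 0 := by
  refine ext_toBar p fun X Y w => ?_
  rw [hφ.toBar_eq hr hrS hδ, toBar_zero]
  simp [Bar.contr]

theorem VanishesOn.coboundary_contr (hr : ∀ Z, Bar.diff K 0 Z Z (r Z) = Bar.of K (𝟙 Z))
    (hrS : ∀ Z, r Z ∈ Bar.part S 1 0 Z Z) {p : ZMod 2} {n : ℕ} {φ : Cochain K C (n + 1)}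
    (hφ : φ.VanishesOn S) (hδ : coboundary K C p (n + 1) φ = 0) :
    coboundary K C p n (contr r p φ) = φ := by
  refine ext_toBar p fun X Y w => ?_
  rw [hφ.toBar_eq hr hrS hδ, toBar_coboundary, toBar_contr, rightExt_toBar_contr,
    Bar.diff_succ_snoc, Bar.rmul_id, map_add, map_add, map_smul, map_smul]

theorem VanishesOn.contr (hrS : ∀ Z, r Z ∈ Bar.part S 1 0 Z Z) {p : ZMod 2} {n : ℕ}
    {φ : Cochain K C (n + 1)} (hφ : φ.VanishesOn S) : (contr r p φ).VanishesOn S := by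
  intro Z a hZ
  rw [eval_eq_toBar p, toBar_contr]
  have key : ∀ q, Bar.part S n q (Z 0) (Z (Fin.last n)) ≤ LinearMap.ker
      (rightExt (toBar p φ) _ _ ∘ₗ Bar.contr r (n + 1) _ _ ∘ₗ (Bar.snoc n).flip (𝟙 _)) :=
    fun q w hw => hφ.rightExt_eq_zero p (Bar.contr_mem_part r hrS
      (Bar.snoc_mem_part (hZ _) hw (id_mem_deg _)))
  exact sup_le (key 0) (key 1) (Bar.word_mem_sup_part _ a fun i => hZ i.castSucc)

theorem contr_mem_cochainPart (hrS : ∀ Z, r Z ∈ Bar.part S 1 0 Z Z) {p : ZMod 2} {n : ℕ}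
    {φ : Cochain K C (n + 1)} (hφ : φ ∈ cochainPart K C (n + 1) p) :
    Cochain.contr r p φ ∈ cochainPart K C n p := by
  intro Z a ε ha
  have h := Bar.snoc_mem_part (Set.mem_univ _) (word_id_mem_part ha) (id_mem_deg _)
  rw [add_zero] at h
  rw [eval_eq_toBar p, toBar_contr]
  exact rightExt_toBar_mem_deg hφ (Bar.contr_mem_part r
    (fun Z => Bar.part_mono (Set.subset_univ S) _ _ _ _ (hrS Z)) h)

end Cochain

end Cochains

/-! ### Restriction of Hochschild cochains along a full inclusion -/

namespace FullInclusion

variable {K : Type u} [Field K]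
  {C : Type u} [Category.{u} C] [Preadditive C] [Linear K C] [SuperCategory K C]
  {E : Type u} [Category.{u} E] [Preadditive E] [Linear K E] [SuperCategory K E]
  (F : FullInclusion K C E)

theorem mapBar_word {n : ℕ} {X : C} (Z : Fin (n + 1) → C) (m : X ⟶ Z 0)
    (a : ∀ i : Fin n, Z i.castSucc ⟶ Z i.succ) :
    F.mapBar n (Bar.word K Z m a) =
      Bar.word K (fun i => F.obj (Z i)) (F.map m) fun i => F.map (a i) := by
  induction n generalizing X with
  | zero => rfl
  | succ n ih =>
    refine (F.mapBar_cons m _).trans (congrArg (Bar.cons K (F.map m)) ?_)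
    exact ih (tailObj Z) (firstArrow a) (tailArrow a)

theorem mapBar_diff {n : ℕ} {X Y : C} (w : Bar K (n + 1) X Y) :
    F.mapBar n (Bar.diff K n X Y w) = Bar.diff K n _ _ (F.mapBar (n + 1) w) := by
  simp only [Bar.diff, LinearMap.sum_apply, LinearMap.smul_apply, map_sum, map_smul, mapBar_face]

/-- The restriction of Hochschild cochains along a full inclusion. -/
noncomputable def res (n : ℕ) : Cochain K E n →ₗ[K] Cochain K C n where
  toFun φ Z := F.map.symm.toLinearMap ∘ₗ φ (fun i => F.obj (Z i)) ∘ₗ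
    PiTensorProduct.map fun _ => F.map.toLinearMap
  map_add' φ ψ := funext fun Z => by
    rw [Pi.add_apply, Pi.add_apply, LinearMap.add_comp, LinearMap.comp_add]
  map_smul' c φ := funext fun Z => by
    rw [Pi.smul_apply, Pi.smul_apply, LinearMap.smul_comp, LinearMap.comp_smul, RingHom.id_apply]

theorem map_res_eval {n : ℕ} (φ : Cochain K E n) (Z : Fin (n + 1) → C)
    (a : ∀ i : Fin n, Z i.castSucc ⟶ Z i.succ) :
    F.map (Cochain.eval K C (F.res n φ) Z a) =
      Cochain.eval K E φ (fun i => F.obj (Z i)) fun i => F.map (a i) := by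
  refine (F.map.apply_symm_apply _).trans ?_
  exact congrArg (φ _) (PiTensorProduct.map_tprod _ _)

theorem map_toBar_res (p : ZMod 2) {n : ℕ} (φ : Cochain K E n) {X Y : C} (w : Bar K n X Y) :
    F.map (Cochain.toBar p (F.res n φ) X Y w) = Cochain.toBar p φ _ _ (F.mapBar n w) := by
  refine LinearMap.congr_fun (congrFun (Bar.hom_ext_word
    (f := fun Y => F.map.toLinearMap ∘ₗ Cochain.toBar p (F.res n φ) X Y)
    (g := fun Y => Cochain.toBar p φ (F.obj X) (F.obj Y) ∘ₗ F.mapBar n) fun Z m a => ?_) Y) w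
  simp only [LinearMap.comp_apply, LinearEquiv.coe_coe]
  rw [Cochain.toBar_word, map_comp, map_signMap, map_res_eval, mapBar_word]
  exact (Cochain.toBar_word p φ (fun i => F.obj (Z i)) (F.map m) fun i => F.map (a i)).symm

theorem map_rightExt_toBar_res (p : ZMod 2) {n : ℕ} (φ : Cochain K E n) {X Y : C}
    (w : Bar K (n + 1) X Y) :
    F.map (Cochain.rightExt (Cochain.toBar p (F.res n φ)) X Y w) =
      Cochain.rightExt (Cochain.toBar p φ) _ _ (F.mapBar (n + 1) w) := by
  induction w using Bar.induction_snoc with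
  | add w w' h h' => simp only [map_add, h, h']
  | snoc Z w c =>
    rw [Cochain.rightExt_snoc, mapBar_snoc, Cochain.rightExt_snoc, map_comp, map_toBar_res]

theorem res_coboundary (p : ZMod 2) {n : ℕ} (φ : Cochain K E n) :
    F.res (n + 1) (coboundary K E p n φ) = coboundary K C p n (F.res n φ) := by
  refine Cochain.ext_toBar p fun X Y w => F.map.injective ?_
  rw [map_toBar_res, Cochain.toBar_coboundary, Cochain.toBar_coboundary, map_add, map_smul,
    map_toBar_res, map_rightExt_toBar_res, mapBar_diff]

theorem res_mem_cochainPart {p : ZMod 2} {n : ℕ} {φ : Cochain K E n}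
    (hφ : φ ∈ cochainPart K E n p) : F.res n φ ∈ cochainPart K C n p := by
  intro Z a ε ha
  have h := hφ (fun i => F.obj (Z i)) (fun i => F.map (a i)) ε fun i => F.map_mem (ha i)
  rw [← map_res_eval] at h
  have h' := F.map_symm_mem h
  rwa [LinearEquiv.symm_apply_apply] at h'

theorem vanishesOn_of_res_eq_zero {n : ℕ} {φ : Cochain K E n} (h : F.res n φ = 0) :
    φ.VanishesOn (Set.range F.obj) := by
  intro Z a hZ
  choose Z' hZ' using hZ
  obtain rfl : (fun i => F.obj (Z' i)) = Z := funext hZ'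
  have h' := F.map_res_eval φ Z' fun i => F.map.symm (a i)
  simp only [LinearEquiv.apply_symm_apply] at h'
  rw [← h', h]
  exact map_zero F.map

open scoped Classical in
/-- The extension of a Hochschild cochain by zero along a full inclusion. -/
noncomputable def extend {n : ℕ} (ψ : Cochain K C n) : Cochain K E n := fun Z =>
  if h : ∃ Z' : Fin (n + 1) → C, (fun i => F.obj (Z' i)) = Z then
    Eq.rec (motive := fun Z _ => Nerve K Z →ₗ[K] (Z 0 ⟶ Z (Fin.last n)))
      (F.map.toLinearMap ∘ₗ ψ h.choose ∘ₗ PiTensorProduct.map fun _ => F.map.symm.toLinearMap)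
      h.choose_spec
  else 0

theorem extend_eval {n : ℕ} (ψ : Cochain K C n) (Z : Fin (n + 1) → C)
    (a : ∀ i : Fin n, F.obj (Z i.castSucc) ⟶ F.obj (Z i.succ)) :
    Cochain.eval K E (F.extend ψ) (fun i => F.obj (Z i)) a =
      F.map (Cochain.eval K C ψ Z fun i => F.map.symm (a i)) := by
  have key : ∀ (Z' : Fin (n + 1) → C) (h : (fun i => F.obj (Z' i)) = fun i => F.obj (Z i)),
      (Eq.rec (motive := fun Z _ => Nerve K Z →ₗ[K] (Z 0 ⟶ Z (Fin.last n)))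
        (F.map.toLinearMap ∘ₗ ψ Z' ∘ₗ PiTensorProduct.map fun _ => F.map.symm.toLinearMap)
        h : Nerve K (fun i => F.obj (Z i)) →ₗ[K] _) =
      F.map.toLinearMap ∘ₗ ψ Z ∘ₗ PiTensorProduct.map fun _ => F.map.symm.toLinearMap := by
    intro Z' h
    obtain rfl : Z' = Z := funext fun i => F.obj_injective (congrFun h i)
    rfl
  have hZ : ∃ Z' : Fin (n + 1) → C, (fun i => F.obj (Z' i)) = fun i => F.obj (Z i) := ⟨Z, rfl⟩
  rw [Cochain.eval, extend, dif_pos hZ, key]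
  exact congrArg (fun x => F.map (ψ Z x)) (PiTensorProduct.map_tprod _ _)

theorem res_extend {n : ℕ} (ψ : Cochain K C n) : F.res n (F.extend ψ) = ψ :=
  Cochain.ext_eval fun Z a => F.map.injective (by
    rw [map_res_eval, extend_eval]
    simp only [LinearEquiv.symm_apply_apply])

theorem extend_mem_cochainPart {p : ZMod 2} {n : ℕ} {ψ : Cochain K C n}
    (hψ : ψ ∈ cochainPart K C n p) : F.extend ψ ∈ cochainPart K E n p := by
  intro Z a ε ha
  by_cases h : ∃ Z' : Fin (n + 1) → C, (fun i => F.obj (Z' i)) = Z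
  · obtain ⟨Z, rfl⟩ := h
    rw [extend_eval]
    exact F.map_mem (hψ Z _ ε fun i => F.map_symm_mem (ha i))
  · rw [Cochain.eval, extend, dif_neg h]
    exact zero_mem _

/-- Restriction along a full inclusion whose image generates is an isomorphism on Hochschild
cohomology: it is surjective on cochains, and its kernel, the cochains vanishing on the image, is
acyclic. -/
theorem nonempty_hochschildCohomologyEquiv (hF : Generates K (Set.range F.obj)) (n : ℕ)
    (p : ZMod 2) :
    Nonempty (HochschildCohomology K E n p ≃ₗ[K] HochschildCohomology K C n p) := by
  choose r hrS hr using hF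
  refine nonempty_subquotientEquiv (F.res n) (fun φ hφ => ⟨F.res_mem_cochainPart hφ.1, ?_⟩) ?_
    (fun φ hφ hφB => ?_) fun ψ hψ => ?_
  · rw [SetLike.mem_coe, LinearMap.mem_ker, ← res_coboundary, LinearMap.mem_ker.1 hφ.2, map_zero]
  · intro φ hφ
    cases n with
    | zero => exact ((Submodule.mem_bot K).1 hφ).symm ▸ (map_zero (F.res 0)).symm ▸ zero_mem _
    | succ n =>
      obtain ⟨χ, hχ, rfl⟩ := hφ
      exact ⟨F.res n χ, F.res_mem_cochainPart hχ, (F.res_coboundary p χ).symm⟩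
  · have hδ := LinearMap.mem_ker.1 hφ.2
    cases n with
    | zero =>
      exact (Submodule.mem_bot K).2 ((F.vanishesOn_of_res_eq_zero
        ((Submodule.mem_bot K).1 hφB)).eq_zero hr hrS hδ)
    | succ n =>
      obtain ⟨ψ, hψ, hψφ⟩ := hφB
      -- Modulo the coboundary of an extension of `ψ`, the cocycle `φ` vanishes on the image.
      have hv : (φ - coboundary K E p n (F.extend ψ)).VanishesOn (Set.range F.obj) := by
        refine F.vanishesOn_of_res_eq_zero ?_
        rw [map_sub, res_coboundary, res_extend, hψφ, sub_self]
      have hc : coboundary K E p (n + 1) (φ - coboundary K E p n (F.extend ψ)) = 0 := by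
        rw [map_sub, hδ, Cochain.coboundary_coboundary, sub_zero]
      have hψ' := F.extend_mem_cochainPart hψ
      refine ⟨F.extend ψ + Cochain.contr r p (φ - coboundary K E p n (F.extend ψ)),
        add_mem hψ' (Cochain.contr_mem_cochainPart hrS
          (sub_mem hφ.1 (Cochain.coboundary_mem_cochainPart hψ'))), ?_⟩
      rw [map_add, hv.coboundary_contr hr hrS hc, add_sub_cancel]
  · have hψ' := F.extend_mem_cochainPart hψ.1
    -- The coboundary of an extension of the cocycle `ψ` vanishes on the image.
    have hv : (coboundary K E p n (F.extend ψ)).VanishesOn (Set.range F.obj) := by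
      refine F.vanishesOn_of_res_eq_zero ?_
      rw [res_coboundary, res_extend, LinearMap.mem_ker.1 hψ.2]
    have hc := Cochain.coboundary_coboundary p (F.extend ψ)
    have hw : (Cochain.contr r p (coboundary K E p n (F.extend ψ))).VanishesOn
      (Set.range F.obj) := hv.contr hrS
    refine ⟨F.extend ψ - Cochain.contr r p (coboundary K E p n (F.extend ψ)),
      ⟨sub_mem hψ' (Cochain.contr_mem_cochainPart hrS
        (Cochain.coboundary_mem_cochainPart hψ')), ?_⟩, ?_⟩
    · rw [SetLike.mem_coe, LinearMap.mem_ker, map_sub, hv.coboundary_contr hr hrS hc, sub_self]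
    · have h0 : F.res n (Cochain.contr r p (coboundary K E p n (F.extend ψ))) = 0 :=
        Cochain.ext_eval fun Z a => F.map.injective (by
          rw [map_res_eval, hw _ _ fun i => Set.mem_range_self (Z i)]
          exact (map_zero F.map).symm)
      rw [map_sub, res_extend, h0, sub_zero, sub_self]
      exact zero_mem _

end FullInclusion

/-! ### Morphisms of all parities between graded modules -/

section AllHom

variable {K : Type u} [Field K] {C : Type u} [Category.{u} C] [Preadditive C] [Linear K C]
  [SuperCategory K C]

namespace GrMod

variable (K) in
/-- The representable graded module `C(X, -)`. -/
abbrev rep (X : C) : GrMod K C where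
  obj Y := X ⟶ Y
  gr Y i := SuperCategory.deg (K := K) X Y i
  isCompl Y := SuperCategory.isCompl X Y
  act {Y Z} := (Linear.comp X Y Z).flip
  act_id Y f := Category.comp_id f
  act_comp f g m := (Category.assoc m f g).symm
  act_mem hf hm := by
    rw [add_comm]
    exact SuperCategory.comp_mem hm hf

/-- The identification `ππM = M`. -/
abbrev parityParityHom (M : GrMod K C) : (parity K C).obj ((parity K C).obj M) ⟶ M :=
  (parityParity K C).hom.app M

/-- The natural transformations of all parities from `M` to `N`, as pairs of an even one and an odd
one; the odd ones are the even natural transformations from `M` to the parity change of `N`. -/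
abbrev AllHom (M N : GrMod K C) : Type u := (M ⟶ N) × (M ⟶ (parity K C).obj N)

namespace AllHom

variable {M N P Q : GrMod K C}

variable (M) in
/-- The identity, which is even. -/
def id : AllHom M M := (𝟙 M, 0)

/-- Composition of natural transformations of all parities; two odd ones compose to an even one
via `ππ = id`. -/
def comp (f : AllHom M N) (g : AllHom N P) : AllHom M P :=
  (f.1 ≫ g.1 + f.2 ≫ (parity K C).map g.2 ≫ parityParityHom P,
    f.1 ≫ g.2 + f.2 ≫ (parity K C).map g.1)

theorem parity_map_add {M N : GrMod K C} (f g : M ⟶ N) :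
    (parity K C).map (f + g) = (parity K C).map f + (parity K C).map g := rfl

theorem parity_map_smul {M N : GrMod K C} (c : K) (f : M ⟶ N) :
    (parity K C).map (c • f) = c • (parity K C).map f := rfl

theorem id_comp (f : AllHom M N) : comp (id M) f = f := by
  refine Prod.ext ?_ ?_ <;> simp [comp, id]

theorem comp_id (f : AllHom M N) : comp f (id N) = f := by
  have h : (parity K C).map (0 : N ⟶ (parity K C).obj N) = 0 := rfl
  refine Prod.ext ?_ ?_ <;> simp [comp, id, h]

theorem comp_assoc (f : AllHom M N) (g : AllHom N P) (h : AllHom P Q) :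
    comp (comp f g) h = comp f (comp g h) := by
  have h₁ : parityParityHom P ≫ h.1 =
    (parity K C).map ((parity K C).map h.1) ≫ parityParityHom Q := rfl
  have h₂ : parityParityHom P ≫ h.2 = (parity K C).map ((parity K C).map h.2) ≫
    (parity K C).map (parityParityHom Q) := rfl
  refine Prod.ext ?_ ?_
  · simp only [comp, Preadditive.add_comp, Preadditive.comp_add, Category.assoc, parity_map_add,
      Functor.map_comp, h₁]
    abel
  · simp only [comp, Preadditive.add_comp, Preadditive.comp_add, Category.assoc, parity_map_add,
      Functor.map_comp, h₂]
    abel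

theorem add_comp (f f' : AllHom M N) (g : AllHom N P) :
    comp (f + f') g = comp f g + comp f' g := by
  refine Prod.ext ?_ ?_ <;> simp only [comp, Prod.fst_add, Prod.snd_add, Preadditive.add_comp] <;>
    abel

theorem comp_add (f : AllHom M N) (g g' : AllHom N P) :
    comp f (g + g') = comp f g + comp f g' := by
  refine Prod.ext ?_ ?_ <;> simp only [comp, Prod.fst_add, Prod.snd_add, Preadditive.add_comp,
    Preadditive.comp_add, parity_map_add] <;> abel

theorem smul_comp (c : K) (f : AllHom M N) (g : AllHom N P) :
    comp (c • f) g = c • comp f g := by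
  refine Prod.ext ?_ ?_ <;> simp only [comp, Prod.smul_fst, Prod.smul_snd, Linear.smul_comp,
    smul_add]

theorem comp_smul (c : K) (f : AllHom M N) (g : AllHom N P) :
    comp f (c • g) = c • comp f g := by
  refine Prod.ext ?_ ?_ <;> simp only [comp, Prod.smul_fst, Prod.smul_snd, Linear.smul_comp,
    Linear.comp_smul, parity_map_smul, smul_add]

variable (M N) in
/-- The natural transformations of parity `q`. -/
def deg (q : ZMod 2) : Submodule K (AllHom M N) :=
  if q = 0 then LinearMap.range (LinearMap.inl K (M ⟶ N) (M ⟶ (parity K C).obj N))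
  else LinearMap.range (LinearMap.inr K (M ⟶ N) (M ⟶ (parity K C).obj N))

theorem mk_zero_mem (f : M ⟶ N) : ((f, 0) : AllHom M N) ∈ deg M N 0 := by
  rw [deg, if_pos rfl]
  exact ⟨f, rfl⟩

theorem zero_mk_mem (f : M ⟶ (parity K C).obj N) : ((0, f) : AllHom M N) ∈ deg M N 1 := by
  rw [deg, if_neg (by decide)]
  exact ⟨f, rfl⟩

theorem exists_of_mem_deg {q : ZMod 2} {f : AllHom M N} (hf : f ∈ deg M N q) :
    (q = 0 ∧ ∃ g, f = (g, 0)) ∨ (q = 1 ∧ ∃ g, f = (0, g)) := by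
  rw [deg] at hf
  split_ifs at hf with h
  · obtain ⟨g, rfl⟩ := hf
    exact Or.inl ⟨h, g, rfl⟩
  · obtain ⟨g, rfl⟩ := hf
    have : ∀ q : ZMod 2, q ≠ 0 → q = 1 := by decide
    exact Or.inr ⟨this q h, g, rfl⟩

theorem isCompl_deg : IsCompl (deg M N 0) (deg M N 1) := by
  rw [deg, deg, if_pos rfl, if_neg (by decide)]
  exact LinearMap.isCompl_range_inl_inr

theorem comp_mem {q s : ZMod 2} {f : AllHom M N} {g : AllHom N P} (hf : f ∈ deg M N q)
    (hg : g ∈ deg N P s) : comp f g ∈ deg M P (q + s) := by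
  have h : (parity K C).map (0 : N ⟶ (parity K C).obj P) = 0 := rfl
  have h' : (parity K C).map (0 : N ⟶ P) = 0 := rfl
  rcases exists_of_mem_deg hf with ⟨rfl, f, rfl⟩ | ⟨rfl, f, rfl⟩ <;>
  rcases exists_of_mem_deg hg with ⟨rfl, g, rfl⟩ | ⟨rfl, g, rfl⟩
  · simpa [comp, h] using mk_zero_mem (f ≫ g)
  · simpa [comp, h'] using zero_mk_mem (f ≫ g)
  · simpa [comp, h] using zero_mk_mem (f ≫ (parity K C).map g)
  · have h₁ : (1 + 1 : ZMod 2) = 0 := by decide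
    rw [h₁]
    simpa [comp, h'] using mk_zero_mem (f ≫ (parity K C).map g ≫ parityParityHom P)

end AllHom

/-! ### The superadditive category of a family of graded modules -/

/-- The index set of a family `J` of graded modules, as the set of objects of a superadditive
category: the morphisms from `s` to `t` are the natural transformations of all parities from `J t`
to `J s`. -/
@[nolint unusedArguments]
def Family {ι : Type u} (_ : ι → GrMod K C) : Type u := ι

variable {ι : Type u} (J : ι → GrMod K C)

/-- A member of the family, as an object. -/
def Family.of (i : ι) : Family J := i

instance : Category.{u} (Family J) where
  Hom s t := AllHom (J t) (J s)
  id s := AllHom.id (J s)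
  comp f g := AllHom.comp g f
  id_comp f := AllHom.comp_id f
  comp_id f := AllHom.id_comp f
  assoc f g h := (AllHom.comp_assoc h g f).symm

instance : Preadditive (Family J) where
  homGroup s t := inferInstanceAs (AddCommGroup (AllHom (J t) (J s)))
  add_comp _ _ _ f f' g := AllHom.comp_add g f f'
  comp_add _ _ _ f g g' := AllHom.add_comp g g' f

instance : Linear K (Family J) where
  homModule s t := inferInstanceAs (Module K (AllHom (J t) (J s)))
  smul_comp _ _ _ c f g := AllHom.comp_smul c g f
  comp_smul _ _ _ f c g := AllHom.smul_comp c g f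

instance : SuperCategory K (Family J) where
  deg s t q := AllHom.deg (J t) (J s) q
  isCompl _ _ := AllHom.isCompl_deg
  comp_mem hf hg := by
    rw [add_comm]
    exact AllHom.comp_mem hg hf

/-! ### The Yoneda lemma -/

variable {M N : GrMod K C}

/-- The even natural transformation from a representable module given by an even element. -/
def ofElement {X : C} (m : M.obj X) (hm : m ∈ M.gr X 0) : rep K X ⟶ M :=
  ⟨fun _ => M.act.flip m, fun _ _ g f => M.act_comp f g m, fun Y i f hf => by
    have h := M.act_mem hf hm
    rwa [add_zero] at h⟩

theorem ofElement_id {X : C} (m : M.obj X) (hm : m ∈ M.gr X 0) :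
    (ofElement m hm).1 X (𝟙 X) = m := M.act_id X m

theorem hom_rep_apply {X Y : C} (η : rep K X ⟶ M) (f : X ⟶ Y) :
    η.1 Y f = M.act f (η.1 X (𝟙 X)) := by
  have h := η.2.1 X Y f (𝟙 X)
  exact (congrArg (η.1 Y) (Category.id_comp f).symm).trans h

theorem hom_rep_eq_zero {X : C} {η : rep K X ⟶ M} (h : η.1 X (𝟙 X) = 0) : η = 0 :=
  Subtype.ext (funext fun Y => LinearMap.ext fun f => by
    rw [hom_rep_apply, h, map_zero]
    rfl)

/-- An odd natural transformation as a family of linear maps. -/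
def oddApp (η : M ⟶ (parity K C).obj N) (X : C) : M.obj X →ₗ[K] N.obj X := η.1 X

theorem oddApp_mem (η : M ⟶ (parity K C).obj N) {X : C} {i : ZMod 2} {m : M.obj X}
    (hm : m ∈ M.gr X i) : oddApp η X m ∈ N.gr X (i + 1) := η.2.2 X i m hm

/-- The value of a natural transformation of any parity. -/
def AllHom.app (X : C) : AllHom M N →ₗ[K] M.obj X →ₗ[K] N.obj X where
  toFun f := f.1.1 X + oddApp f.2 X
  map_add' f g := by
    have h₁ : (f + g).1.1 X = f.1.1 X + g.1.1 X := rfl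
    have h₂ : oddApp (f + g).2 X = oddApp f.2 X + oddApp g.2 X := rfl
    rw [h₁, h₂, add_add_add_comm]
  map_smul' c f := by
    have h₁ : (c • f).1.1 X = c • f.1.1 X := rfl
    have h₂ : oddApp (c • f).2 X = c • oddApp f.2 X := rfl
    rw [h₁, h₂, ← smul_add, RingHom.id_apply]

theorem AllHom.app_comp {P : GrMod K C} (f : AllHom M N) (g : AllHom N P) (X : C) (m : M.obj X) :
    app X (comp f g) m = app X g (app X f m) := by
  have h : app X (comp f g) m = (g.1.1 X (f.1.1 X m) + oddApp g.2 X (oddApp f.2 X m)) +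
    (oddApp g.2 X (f.1.1 X m) + g.1.1 X (oddApp f.2 X m)) := rfl
  have h' : app X g (app X f m) = g.1.1 X (f.1.1 X m + oddApp f.2 X m) +
    oddApp g.2 X (f.1.1 X m + oddApp f.2 X m) := rfl
  rw [h, h', map_add, map_add]
  abel

/-- The Yoneda lemma: natural transformations of all parities from the representable module of `X`
to `M` are elements of `M(X)`. -/
noncomputable def yoneda (X : C) (M : GrMod K C) : AllHom (rep K X) M ≃ₗ[K] M.obj X := by
  refine LinearEquiv.ofBijective
    { toFun := fun f => AllHom.app X f (𝟙 X)
      map_add' := fun f g => by rw [map_add, LinearMap.add_apply]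
      map_smul' := fun c f => by rw [map_smul, LinearMap.smul_apply, RingHom.id_apply] } ⟨?_, ?_⟩
  · rw [← LinearMap.ker_eq_bot, LinearMap.ker_eq_bot']
    intro f hf
    have h : f.1.1 X (𝟙 X) + oddApp f.2 X (𝟙 X) = 0 := hf
    have h₀ : f.1.1 X (𝟙 X) ∈ M.gr X 0 := f.1.2.2 X 0 _ (id_mem_deg X)
    have h₁ : oddApp f.2 X (𝟙 X) ∈ M.gr X 1 := oddApp_mem f.2 (id_mem_deg X)
    have h₂ : f.1.1 X (𝟙 X) = 0 := Submodule.disjoint_def.1 (M.isCompl X).disjoint _ h₀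
      (by rw [eq_neg_of_add_eq_zero_left h]; exact neg_mem h₁)
    rw [h₂, zero_add] at h
    exact Prod.ext (hom_rep_eq_zero h₂) (hom_rep_eq_zero h)
  · intro m
    obtain ⟨m₀, hm₀, m₁, hm₁, rfl⟩ := Submodule.mem_sup.1
      ((M.isCompl X).sup_eq_top.symm ▸ Submodule.mem_top : m ∈ M.gr X 0 ⊔ M.gr X 1)
    exact ⟨(ofElement m₀ hm₀, ofElement (M := (parity K C).obj M) m₁ hm₁),
      congrArg₂ (· + ·) (M.act_id X m₀) (M.act_id X m₁)⟩

theorem yoneda_comp {X : C} (f : AllHom (rep K X) M) (g : AllHom M N) :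
    yoneda X N (AllHom.comp f g) = AllHom.app X g (yoneda X M f) :=
  AllHom.app_comp f g X (𝟙 X)

theorem app_rep {X Y : C} (f : AllHom (rep K X) M) (m : X ⟶ Y) :
    AllHom.app Y f m = M.act m (yoneda X M f) := by
  have h₁ := hom_rep_apply f.1 m
  have h₂ := hom_rep_apply f.2 m
  have h : AllHom.app Y f m = f.1.1 Y m + oddApp f.2 Y m := rfl
  have h' : yoneda X M f = f.1.1 X (𝟙 X) + oddApp f.2 X (𝟙 X) := rfl
  rw [h, h', map_add]
  exact congrArg₂ (· + ·) h₁ h₂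

theorem yoneda_symm_mem {X : C} {q : ZMod 2} {m : M.obj X} (hm : m ∈ M.gr X q) :
    (yoneda X M).symm m ∈ AllHom.deg (rep K X) M q := by
  have hq : ∀ q : ZMod 2, q = 0 ∨ q = 1 := by decide
  rcases hq q with rfl | rfl
  · have h : (yoneda X M).symm m = (ofElement m hm, 0) := by
      rw [LinearEquiv.symm_apply_eq]
      exact ((add_zero _).symm.trans (congrArg₂ (· + ·) (M.act_id X m).symm rfl))
    rw [h]
    exact AllHom.mk_zero_mem _
  · have h : (yoneda X M).symm m = (0, ofElement (M := (parity K C).obj M) m hm) := by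
      rw [LinearEquiv.symm_apply_eq]
      exact ((zero_add _).symm.trans (congrArg₂ (· + ·) rfl (M.act_id X m).symm))
    rw [h]
    exact AllHom.zero_mk_mem _

end GrMod

end AllHom

/-! ### Factoring the identity of a representable module -/

section Trace

variable {K : Type u} [Field K] {C : Type u} [Category.{u} C] [Preadditive C] [Linear K C]
  [SuperCategory K C] {D : Type u} [Category.{u} D] [Preadditive D] [Linear K D]
  [SuperCategory K D]

namespace GrMod

variable {M N P : GrMod K C}

theorem AllHom.app_act (f : AllHom M N) {X Y : C} (a : X ⟶ Y) (m : M.obj X) :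
    AllHom.app Y f (M.act a m) = N.act a (AllHom.app X f m) := by
  have h₁ := f.1.2.1 X Y a m
  have h₂ := f.2.2.1 X Y a m
  have h : AllHom.app Y f (M.act a m) = f.1.1 Y (M.act a m) + oddApp f.2 Y (M.act a m) := rfl
  have h' : AllHom.app X f m = f.1.1 X m + oddApp f.2 X m := rfl
  rw [h, h', map_add]
  exact congrArg₂ (· + ·) h₁ h₂

theorem AllHom.app_mem {q i : ZMod 2} {f : AllHom M N} (hf : f ∈ AllHom.deg M N q) {X : C}
    {m : M.obj X} (hm : m ∈ M.gr X i) : AllHom.app X f m ∈ N.gr X (i + q) := by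
  rcases AllHom.exists_of_mem_deg hf with ⟨rfl, f, rfl⟩ | ⟨rfl, f, rfl⟩
  · have h : AllHom.app X ((f, 0) : AllHom M N) m = f.1 X m := add_zero (f.1 X m)
    rw [h, add_zero]
    exact f.2.2 X i m hm
  · have h : AllHom.app X ((0, f) : AllHom M N) m = oddApp f X m := zero_add (oddApp f X m)
    rw [h]
    exact oddApp_mem f hm

theorem exists_add_eq (M : GrMod K C) {X : C} (m : M.obj X) :
    ∃ m₀ ∈ M.gr X 0, ∃ m₁ ∈ M.gr X 1, m₀ + m₁ = m :=
  Submodule.mem_sup.1 ((M.isCompl X).sup_eq_top.symm ▸ Submodule.mem_top)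

/-- The quotient of a graded module by the graded submodule with components `N X i`. -/
def quotient (M : GrMod K C) (N : ∀ X, ZMod 2 → Submodule K (M.obj X))
    (hN : ∀ X i, N X i ≤ M.gr X i)
    (hact : ∀ {X Y : C} (a : X ⟶ Y), N X 0 ⊔ N X 1 ≤ (N Y 0 ⊔ N Y 1).comap (M.act a)) :
    GrMod K C where
  obj X := M.obj X ⧸ (N X 0 ⊔ N X 1)
  gr X i := (M.gr X i).map (N X 0 ⊔ N X 1).mkQ
  isCompl X := by
    refine ⟨?_, ?_⟩
    · rw [Submodule.disjoint_def]
      rintro _ ⟨x, hx, rfl⟩ ⟨y, hy, hyx⟩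
      have h : x - y ∈ N X 0 ⊔ N X 1 := (Submodule.Quotient.eq _).1 hyx.symm
      obtain ⟨u, hu, v, hv, huv⟩ := Submodule.mem_sup.1 h
      -- Compare the even components in `u + v = x - y`.
      have h0 : x - u = 0 := Submodule.disjoint_def.1 (M.isCompl X).disjoint _
        (sub_mem hx (hN X 0 hu)) (by
          have h' : x = u + (v + y) := by rw [← add_assoc, huv, sub_add_cancel]
          rw [h', add_sub_cancel_left]
          exact add_mem (hN X 1 hv) hy)
      rw [sub_eq_zero.1 h0]
      exact (Submodule.Quotient.mk_eq_zero _).2 (Submodule.mem_sup_left hu)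
    · rw [codisjoint_iff, ← Submodule.map_sup, (M.isCompl X).sup_eq_top, Submodule.map_top,
        Submodule.range_mkQ]
  act {X Y} :=
    { toFun := fun a => Submodule.mapQ _ _ (M.act a) (hact a)
      map_add' := fun a b => by
        ext x
        simp
      map_smul' := fun c a => by
        ext x
        simp }
  act_id X m := by
    obtain ⟨m, rfl⟩ := Submodule.mkQ_surjective _ m
    exact congrArg (Submodule.mkQ _) (M.act_id X m)
  act_comp a b m := by
    obtain ⟨m, rfl⟩ := Submodule.mkQ_surjective _ m
    exact congrArg (Submodule.mkQ _) (M.act_comp a b m)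
  act_mem := by
    rintro X Y i j a _ ha ⟨m, hm, rfl⟩
    exact ⟨M.act a m, M.act_mem ha hm, rfl⟩

/-- The projection onto a quotient of a graded module. -/
def quotientMk (M : GrMod K C) (N : ∀ X, ZMod 2 → Submodule K (M.obj X))
    (hN : ∀ X i, N X i ≤ M.gr X i)
    (hact : ∀ {X Y : C} (a : X ⟶ Y), N X 0 ⊔ N X 1 ≤ (N Y 0 ⊔ N Y 1).comap (M.act a)) :
    M ⟶ M.quotient N hN hact :=
  ⟨fun X => (N X 0 ⊔ N X 1).mkQ, fun _ _ _ _ => rfl, fun _ _ m hm => ⟨m, hm, rfl⟩⟩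

section TraceSubmodule

variable {κ : Type*} (Q : κ → GrMod K C)

/-- The endomorphisms of `P` that are sums of composites `uv` of homogeneous natural
transformations of equal parity through the modules `Q k`. -/
def through (P : GrMod K C) : Submodule K (AllHom P P) :=
  Submodule.span K {x | ∃ k q, ∃ u ∈ AllHom.deg P (Q k) q, ∃ v ∈ AllHom.deg (Q k) P q,
    x = AllHom.comp u v}

variable (M) in
/-- The part of parity `i` of the trace of the modules `Q k` in `M`, the sum of the images of all
homogeneous natural transformations from the `Q k` to `M`. -/
def trace (X : C) (i : ZMod 2) : Submodule K (M.obj X) :=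
  Submodule.span K {y | ∃ k q, ∃ v ∈ AllHom.deg (Q k) M q, ∃ x ∈ (Q k).gr X (i + q),
    y = AllHom.app X v x}

theorem trace_le (X : C) (i : ZMod 2) : trace M Q X i ≤ M.gr X i := by
  refine Submodule.span_le.2 ?_
  rintro _ ⟨k, q, v, hv, x, hx, rfl⟩
  have h := AllHom.app_mem hv hx
  have hq : ∀ i q : ZMod 2, i + q + q = i := by decide
  rwa [hq] at h

theorem app_mem_trace {k : κ} {q : ZMod 2} {v : AllHom (Q k) M} (hv : v ∈ AllHom.deg (Q k) M q)
    (X : C) (x : (Q k).obj X) : AllHom.app X v x ∈ trace M Q X 0 ⊔ trace M Q X 1 := by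
  have hx : ∀ i, ∀ x ∈ (Q k).gr X i, AllHom.app X v x ∈ trace M Q X 0 ⊔ trace M Q X 1 := by
    intro i x hx
    have h : AllHom.app X v x ∈ trace M Q X (i + q) :=
      Submodule.subset_span ⟨k, q, v, hv, x, by
        have hq : ∀ i q : ZMod 2, i + q + q = i := by decide
        rwa [hq], rfl⟩
    have h01 : ∀ i : ZMod 2, i = 0 ∨ i = 1 := by decide
    rcases h01 (i + q) with hi | hi <;> rw [hi] at h
    · exact Submodule.mem_sup_left h
    · exact Submodule.mem_sup_right h
  obtain ⟨x₀, h₀, x₁, h₁, rfl⟩ := (Q k).exists_add_eq x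
  rw [map_add]
  exact add_mem (hx 0 x₀ h₀) (hx 1 x₁ h₁)

theorem act_mem_trace {X Y : C} (a : X ⟶ Y) :
    trace M Q X 0 ⊔ trace M Q X 1 ≤ (trace M Q Y 0 ⊔ trace M Q Y 1).comap (M.act a) := by
  have h : ∀ i, trace M Q X i ≤ (trace M Q Y 0 ⊔ trace M Q Y 1).comap (M.act a) := fun i => by
    refine Submodule.span_le.2 ?_
    rintro _ ⟨k, q, v, hv, x, -, rfl⟩
    have h := app_mem_trace Q hv Y ((Q k).act a x)
    rwa [AllHom.app_act] at h
  exact sup_le (h 0) (h 1)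

/-- If the trace of the modules `Q k` is all of the representable module of `X`, then it contains the
element `𝟙 X`. By the Yoneda lemma, an expression of `𝟙 X` by values of natural transformations
`Q k → rep K X` is a factorisation of the identity through the `Q k`. -/
theorem id_mem_through_of_trace {X : C}
    (h : quotientMk (rep K X) (trace (rep K X) Q) (trace_le Q) (act_mem_trace Q) = 0) :
    AllHom.id (rep K X) ∈ through Q (rep K X) := by
  have h1 : (𝟙 X : (rep K X).obj X) ∈ trace (rep K X) Q X 0 ⊔ trace (rep K X) Q X 1 := by
    rw [← Submodule.Quotient.mk_eq_zero]
    exact LinearMap.congr_fun (congrFun (congrArg Subtype.val h) X) (𝟙 X)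
  have h2 : (𝟙 X : (rep K X).obj X) ∈ trace (rep K X) Q X 0 := by
    obtain ⟨u, hu, v, hv, huv⟩ := Submodule.mem_sup.1 h1
    have h0 : v = 0 := Submodule.disjoint_def.1 ((rep K X).isCompl X).disjoint _ (by
      rw [eq_sub_of_add_eq' huv]
      exact sub_mem (id_mem_deg X) (trace_le Q X 0 hu)) (trace_le Q X 1 hv)
    rwa [← huv, h0, add_zero]
  have h3 : trace (rep K X) Q X 0 ≤
      (through Q (rep K X)).map (yoneda X (rep K X)).toLinearMap := by
    refine Submodule.span_le.2 ?_
    rintro _ ⟨k, q, v, hv, x, hx, rfl⟩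
    rw [zero_add] at hx
    refine ⟨AllHom.comp ((yoneda X (Q k)).symm x) v,
      Submodule.subset_span ⟨k, q, _, yoneda_symm_mem hx, v, hv, rfl⟩, ?_⟩
    rw [LinearEquiv.coe_coe, yoneda_comp, LinearEquiv.apply_symm_apply]
  obtain ⟨f, hf, hfX⟩ := h3 h2
  have hid : yoneda X (rep K X) (AllHom.id (rep K X)) = 𝟙 X := add_zero (𝟙 X)
  rwa [← (yoneda X (rep K X)).injective (hfX.trans hid.symm)]

end TraceSubmodule

end GrMod

/-! ### Even functors and morphisms of all parities -/

open GrMod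

/-- Under a graded Morita equivalence, the identity of a representable module is a sum of composites
through the images of the representable modules: these images generate, so a nonzero quotient of a
representable module receives a nonzero map from one of them. -/
theorem id_mem_through (F : GrMod K C ⥤ GrMod K D) [F.Additive] (G : GrMod K D ⥤ GrMod K C)
    [G.Additive] (e : parity K C ⋙ F ≅ F ⋙ parity K D) (η : F ⋙ G ≅ 𝟭 (GrMod K C))
    (ε : G ⋙ F ≅ 𝟭 (GrMod K D)) (Y : D) :
    AllHom.id (rep K Y) ∈ through (fun X => F.obj (rep K X)) (rep K Y) := by
  have : F.Faithful := Functor.Faithful.of_comp_iso η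
  have : G.Faithful := Functor.Faithful.of_comp_iso ε
  set Q : C → GrMod K D := fun X => F.obj (rep K X) with hQ
  refine id_mem_through_of_trace Q (G.map_injective ?_)
  set q := quotientMk (rep K Y) (trace (rep K Y) Q) (trace_le Q) (act_mem_trace Q) with hq
  have hv : ∀ (X : C) (v : Q X ⟶ rep K Y), v ≫ q = 0 := fun X v =>
    Subtype.ext (funext fun Z => LinearMap.ext fun x => (Submodule.Quotient.mk_eq_zero _).2 (by
      have h := app_mem_trace Q (AllHom.mk_zero_mem v) Z x
      have h' : AllHom.app Z ((v, 0) : AllHom (Q X) (rep K Y)) x = v.1 Z x := add_zero (v.1 Z x)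
      rwa [h'] at h))
  have hv' : ∀ (X : C) (v : Q X ⟶ (parity K D).obj (rep K Y)), v ≫ (parity K D).map q = 0 :=
    fun X v => Subtype.ext (funext fun Z => LinearMap.ext fun x =>
      (Submodule.Quotient.mk_eq_zero _).2 (by
        have h := app_mem_trace Q (AllHom.zero_mk_mem v) Z x
        have h' : AllHom.app Z ((0, v) : AllHom (Q X) (rep K Y)) x = oddApp v Z x :=
          zero_add (oddApp v Z x)
        rwa [h'] at h))
  have hε : F.map (G.map q) ≫ ε.hom.app _ = ε.hom.app _ ≫ q := ε.hom.naturality q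
  have h₀ : ∀ (X : C) (f : rep K X ⟶ G.obj (rep K Y)), f ≫ G.map q = 0 := fun X f => by
    refine F.map_injective ?_
    rw [← cancel_mono (ε.hom.app _), F.map_comp, F.map_zero, Limits.zero_comp]
    refine (Category.assoc _ _ _).trans ?_
    rw [hε, ← Category.assoc]
    exact hv X _
  have h₁ : ∀ (X : C) (f : rep K X ⟶ (parity K C).obj (G.obj (rep K Y))),
      f ≫ (parity K C).map (G.map q) = 0 := fun X f => by
    refine F.map_injective ?_
    have he : F.map ((parity K C).map (G.map q)) ≫ e.hom.app _ =
      e.hom.app _ ≫ (parity K D).map (F.map (G.map q)) := e.hom.naturality (G.map q)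
    have hπ : (parity K D).map (F.map (G.map q)) ≫ (parity K D).map (ε.hom.app _) =
        (parity K D).map (ε.hom.app _) ≫ (parity K D).map q := by
      rw [← Functor.map_comp, hε, Functor.map_comp]
    rw [← cancel_mono (e.hom.app _), ← cancel_mono ((parity K D).map (ε.hom.app _)), F.map_comp,
      F.map_zero, Limits.zero_comp, Limits.zero_comp, Category.assoc (F.map f), he, Category.assoc,
      Category.assoc]
    refine (congrArg (fun b => F.map f ≫ e.hom.app _ ≫ b) hπ).trans ?_
    have h := hv' X ((F.map f ≫ e.hom.app _) ≫ (parity K D).map (ε.hom.app _))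
    simpa only [Category.assoc] using h
  rw [G.map_zero]
  refine Subtype.ext (funext fun X => LinearMap.ext fun x => ?_)
  obtain ⟨x₀, hx₀, x₁, hx₁, rfl⟩ := (G.obj (rep K Y)).exists_add_eq x
  have k₀ : (G.map q).1 X x₀ = 0 := by
    have h := LinearMap.congr_fun (congrFun (congrArg Subtype.val (h₀ X (ofElement x₀ hx₀))) X)
      (𝟙 X)
    rw [← ofElement_id x₀ hx₀]
    exact h
  have k₁ : (G.map q).1 X x₁ = 0 := by
    have h := LinearMap.congr_fun (congrFun (congrArg Subtype.val (h₁ X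
      (ofElement (M := (parity K C).obj (G.obj (rep K Y))) x₁ hx₁))) X) (𝟙 X)
    have h' := ofElement_id (M := (parity K C).obj (G.obj (rep K Y))) x₁ hx₁
    exact (congrArg ((G.map q).1 X) h').symm.trans h
  rw [map_add, k₀, k₁, add_zero]
  rfl

end Trace

/-! ### The category joining two graded Morita equivalent categories -/

section Join

variable {K : Type u} [Field K] {C : Type u} [Category.{u} C] [Preadditive C] [Linear K C]
  [SuperCategory K C] {D : Type u} [Category.{u} D] [Preadditive D] [Linear K D]
  [SuperCategory K D]

namespace GrMod

section MapAll

variable (F : GrMod K C ⥤ GrMod K D) (e : parity K C ⋙ F ≅ F ⋙ parity K D)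

/-- The action of an even functor on natural transformations of all parities. -/
def mapAll {M N : GrMod K C} (f : AllHom M N) : AllHom (F.obj M) (F.obj N) :=
  (F.map f.1, F.map f.2 ≫ e.hom.app N)

theorem mapAll_mem {M N : GrMod K C} [F.Additive] {q : ZMod 2} {f : AllHom M N}
    (hf : f ∈ AllHom.deg M N q) : mapAll F e f ∈ AllHom.deg (F.obj M) (F.obj N) q := by
  rcases AllHom.exists_of_mem_deg hf with ⟨rfl, f, rfl⟩ | ⟨rfl, f, rfl⟩
  · simpa [mapAll] using AllHom.mk_zero_mem (F.map f)
  · simpa [mapAll] using AllHom.zero_mk_mem (F.map f ≫ e.hom.app N)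

theorem mapAll_id [F.Additive] (M : GrMod K C) :
    mapAll F e (AllHom.id M) = AllHom.id (F.obj M) := by
  refine Prod.ext ?_ ?_ <;> simp [mapAll, AllHom.id]

theorem mapAll_comp [F.Additive] (he : ∀ M : GrMod K C,
    e.hom.app ((parity K C).obj M) ≫ (parity K D).map (e.hom.app M) ≫
      (parityParity K D).hom.app (F.obj M) = F.map ((parityParity K C).hom.app M))
    {M N P : GrMod K C} (f : AllHom M N) (g : AllHom N P) :
    mapAll F e (AllHom.comp f g) = AllHom.comp (mapAll F e f) (mapAll F e g) := by
  have hn : ∀ {A B : GrMod K C} (h : A ⟶ B), F.map ((parity K C).map h) ≫ e.hom.app B =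
    e.hom.app A ≫ (parity K D).map (F.map h) := fun h => e.hom.naturality h
  refine Prod.ext ?_ ?_
  · have h : F.map ((parity K C).map g.2) ≫ F.map (parityParityHom P) = e.hom.app N ≫
        (parity K D).map (F.map g.2 ≫ e.hom.app P) ≫ parityParityHom (F.obj P) := by
      rw [← he P, ← Category.assoc, hn, Functor.map_comp]
      simp only [Category.assoc]
    simp only [mapAll, AllHom.comp, F.map_add, F.map_comp, Category.assoc]
    rw [h]
  · simp only [mapAll, AllHom.comp, F.map_add, F.map_comp, Category.assoc, Preadditive.add_comp,
      hn]

/-- An even `K`-linear equivalence is bijective on natural transformations of all parities. -/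
noncomputable def mapAllEquiv [F.Additive] [F.Linear K] [F.Full] [F.Faithful] (M N : GrMod K C) :
    AllHom M N ≃ₗ[K] AllHom (F.obj M) (F.obj N) :=
  LinearEquiv.ofBijective
    { toFun := mapAll F e
      map_add' := fun f g => by
        refine Prod.ext ?_ ?_ <;> simp [mapAll]
      map_smul' := fun c f => by
        refine Prod.ext ?_ ?_ <;> simp [mapAll] }
    ⟨fun f g h => Prod.ext (F.map_injective (congrArg Prod.fst h)) (F.map_injective
        ((cancel_mono (e.hom.app N)).1 (congrArg Prod.snd h))), fun f => by
      obtain ⟨a, ha⟩ := F.map_surjective f.1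
      obtain ⟨b, hb⟩ := F.map_surjective (f.2 ≫ e.inv.app N)
      exact ⟨(a, b), Prod.ext ha (by simp [mapAll, hb])⟩⟩

theorem mapAllEquiv_apply [F.Additive] [F.Linear K] [F.Full] [F.Faithful] {M N : GrMod K C}
    (f : AllHom M N) : mapAllEquiv F e M N f = mapAll F e f := rfl

end MapAll

variable {κ : Type u}

theorem id_mem_through_self (Q : κ → GrMod K C) (k : κ) :
    AllHom.id (Q k) ∈ through Q (Q k) :=
  Submodule.subset_span ⟨k, 0, _, AllHom.mk_zero_mem (𝟙 _), _, AllHom.mk_zero_mem (𝟙 _),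
    (AllHom.id_comp _).symm⟩

/-- Factorisations of an identity are preserved by even equivalences, up to isomorphism of the
modules through which it factors. -/
theorem id_mem_through_map (F : GrMod K C ⥤ GrMod K D) [F.Additive] [F.Linear K] [F.Full]
    [F.Faithful] (e : parity K C ⋙ F ≅ F ⋙ parity K D) (he : ∀ M : GrMod K C,
      e.hom.app ((parity K C).obj M) ≫ (parity K D).map (e.hom.app M) ≫
        (parityParity K D).hom.app (F.obj M) = F.map ((parityParity K C).hom.app M))
    {Q : κ → GrMod K C} {Q' : κ → GrMod K D} (i : ∀ k, F.obj (Q k) ≅ Q' k) {P : GrMod K C}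
    (h : AllHom.id P ∈ through Q P) : AllHom.id (F.obj P) ∈ through Q' (F.obj P) := by
  have key : through Q P ≤ (through Q' (F.obj P)).comap (mapAllEquiv F e P P).toLinearMap := by
    refine Submodule.span_le.2 ?_
    rintro _ ⟨k, q, u, hu, v, hv, rfl⟩
    have hi : AllHom.comp ((i k).hom, 0) ((i k).inv, 0) = AllHom.id (F.obj (Q k)) := by
      refine Prod.ext ?_ ?_ <;> simp [AllHom.comp, AllHom.id]
    refine Submodule.subset_span ⟨k, q, AllHom.comp (mapAll F e u) ((i k).hom, 0), ?_,
      AllHom.comp ((i k).inv, 0) (mapAll F e v), ?_, ?_⟩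
    · have h := AllHom.comp_mem (mapAll_mem F e hu) (AllHom.mk_zero_mem (i k).hom)
      rwa [add_zero] at h
    · have h := AllHom.comp_mem (AllHom.mk_zero_mem (i k).inv) (mapAll_mem F e hv)
      rwa [zero_add] at h
    · rw [AllHom.comp_assoc, ← AllHom.comp_assoc _ _ (mapAll F e v), hi, AllHom.id_comp,
        LinearEquiv.coe_coe, mapAllEquiv_apply, mapAll_comp F e he]
  have h' := key h
  rwa [Submodule.mem_comap, LinearEquiv.coe_coe, mapAllEquiv_apply, mapAll_id] at h'

/-- In the category of a family of graded modules, the members through which all identities factor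
generate. -/
theorem generates_range {ι : Type u} (J : ι → GrMod K C) (g : κ → Family J)
    (h : ∀ z, AllHom.id (J z) ∈ through (fun k => J (g k)) (J z)) :
    Generates K (Set.range g) := by
  intro z
  have key : through (fun k => J (g k)) (J z) ≤
      (Bar.part (K := K) (Set.range g) 1 0 z z).map
        ((Bar.of K).symm.toLinearMap ∘ₗ Bar.diff K 0 z z) := by
    refine Submodule.span_le.2 ?_
    rintro _ ⟨k, q, u, hu, v, hv, rfl⟩
    let u' : g k ⟶ z := u
    let v' : z ⟶ g k := v
    have hu' : u' ∈ SuperCategory.deg (K := K) (g k) z q := hu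
    have hv' : v' ∈ SuperCategory.deg (K := K) z (g k) q := hv
    have hq : ∀ q : ZMod 2, q + q = 0 := by decide
    refine ⟨Bar.cons K v' (Bar.of K u'), ?_, ?_⟩
    · have hr := Bar.cons_mem_part (Set.mem_range_self k) hv' (Bar.of_mem_part (S := Set.range g) hu')
      rwa [hq] at hr
    · rw [LinearMap.comp_apply, Bar.diff_zero_cons, Bar.lmul_of]
      exact (Bar.of K).symm_apply_apply _
  obtain ⟨r, hr, hrz⟩ := key (h z)
  have hrz' : (Bar.of K).symm (Bar.diff K 0 z z r) = 𝟙 z := hrz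
  exact ⟨r, hr, (LinearEquiv.symm_apply_eq _).1 hrz'⟩

/-- The contravariant Yoneda embedding into natural transformations of all parities. -/
noncomputable def repEquiv (X Y : C) : (X ⟶ Y) ≃ₗ[K] AllHom (rep K Y) (rep K X) :=
  (yoneda Y (rep K X)).symm

theorem repEquiv_id (X : C) : repEquiv X X (𝟙 X) = AllHom.id (rep K X) :=
  (LinearEquiv.symm_apply_eq _).2 (add_zero (𝟙 X)).symm

theorem repEquiv_comp {X Y Z : C} (f : X ⟶ Y) (g : Y ⟶ Z) :
    repEquiv (K := K) X Z (f ≫ g) = AllHom.comp (repEquiv Y Z g) (repEquiv X Y f) := by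
  refine (LinearEquiv.symm_apply_eq _).2 ?_
  rw [yoneda_comp, repEquiv, repEquiv, LinearEquiv.apply_symm_apply, app_rep,
    LinearEquiv.apply_symm_apply]
  rfl

theorem repEquiv_mem {X Y : C} {q : ZMod 2} {f : X ⟶ Y}
    (hf : f ∈ SuperCategory.deg (K := K) X Y q) :
    repEquiv X Y f ∈ AllHom.deg (rep K Y) (rep K X) q :=
  yoneda_symm_mem hf

end GrMod

open GrMod

/-- Graded Morita equivalent categories embed fully in a common superadditive category, and each
of them generates it: the category of the modules `F(C(X, -))` and `D(Y, -)`. -/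
theorem GradedMoritaEquivalent.exists_fullInclusion (h : GradedMoritaEquivalent K C D) :
    ∃ (E : Type u) (_ : Category.{u} E) (_ : Preadditive E) (_ : Linear K E)
      (_ : SuperCategory K E) (I : FullInclusion K C E) (I' : FullInclusion K D E),
      Generates K (Set.range I.obj) ∧ Generates K (Set.range I'.obj) := by
  obtain ⟨F, G, hF, hF', ⟨e, he⟩, hG, hG', ⟨e', -⟩, ⟨η⟩, ⟨ε⟩⟩ := h
  have : F.IsEquivalence := (CategoryTheory.Equivalence.mk F G η.symm ε).isEquivalence_functor
  let J : C ⊕ D → GrMod K D := Sum.elim (fun X => F.obj (rep K X)) fun Y => rep K Y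
  let I : FullInclusion K C (Family J) :=
    { obj := fun X => Family.of J (Sum.inl X)
      obj_injective := Sum.inl_injective
      map := fun {X Y} => (repEquiv X Y).trans (mapAllEquiv F e (rep K Y) (rep K X))
      map_id := fun X => (congrArg (mapAll F e) (repEquiv_id X)).trans (mapAll_id F e _)
      map_comp := fun f g => (congrArg (mapAll F e) (repEquiv_comp f g)).trans
        (mapAll_comp F e he _ _)
      map_mem := fun hf => mapAll_mem F e (repEquiv_mem hf) }
  let I' : FullInclusion K D (Family J) :=
    { obj := fun Y => Family.of J (Sum.inr Y)
      obj_injective := Sum.inr_injective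
      map := fun {X Y} => repEquiv X Y
      map_id := fun X => repEquiv_id X
      map_comp := fun f g => repEquiv_comp f g
      map_mem := fun hf => repEquiv_mem hf }
  refine ⟨Family J, inferInstance, inferInstance, inferInstance, inferInstance, I, I',
    generates_range J I.obj ?_, generates_range J I'.obj ?_⟩
  · rintro (X | Y)
    · exact id_mem_through_self (fun X => F.obj (rep K X)) X
    · exact id_mem_through F G e η ε Y
  · rintro (X | Y)
    · exact id_mem_through_map F e he (fun Y => ε.app (rep K Y)) (id_mem_through G F e' ε η X)
    · exact id_mem_through_self (fun Y => rep K Y) Y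

end Join

end SuperHochschild

theorem mainTheorem1 (K : Type u) [Field K]
    (C : Type u) [Category.{u} C] [Preadditive C] [Linear K C] [SuperHochschild.SuperCategory K C]
    (D : Type u) [Category.{u} D] [Preadditive D] [Linear K D] [SuperHochschild.SuperCategory K D]
    (hCD : SuperHochschild.GradedMoritaEquivalent K C D) :
    (∀ (n : ℕ) (p : ZMod 2), Nonempty
      (SuperHochschild.HochschildHomology K C n p ≃ₗ[K]
        SuperHochschild.HochschildHomology K D n p)) ∧
    (∀ (n : ℕ) (p : ZMod 2), Nonempty
      (SuperHochschild.HochschildCohomology K C n p ≃ₗ[K]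
        SuperHochschild.HochschildCohomology K D n p)) ∧
    (∀ (n : ℕ) (p : ZMod 2), Nonempty
      (SuperHochschild.CyclicHomology K C n p ≃ₗ[K]
        SuperHochschild.CyclicHomology K D n p)) ∧
    (∀ (n : ℕ) (p : ZMod 2), Nonempty
      (SuperHochschild.CyclicCohomology K C n p ≃ₗ[K]
        SuperHochschild.CyclicCohomology K D n p)) := by
  obtain ⟨E, _, _, _, _, I, I', hI, hI'⟩ := hCD.exists_fullInclusion
  have hC : ∀ (n : ℕ) (p : ZMod 2), Nonempty
      (SuperHochschild.CyclicHomology K C n p ≃ₗ[K] SuperHochschild.CyclicHomology K D n p) := by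
    intro n p
    obtain ⟨a⟩ := I.nonempty_cyclicHomologyEquiv hI n p
    obtain ⟨b⟩ := I'.nonempty_cyclicHomologyEquiv hI' n p
    exact ⟨a.trans b.symm⟩
  refine ⟨fun n p => ?_, fun n p => ?_, hC, fun n p => ?_⟩
  · obtain ⟨a⟩ := I.nonempty_hochschildHomologyEquiv hI n p
    obtain ⟨b⟩ := I'.nonempty_hochschildHomologyEquiv hI' n p
    exact ⟨a.trans b.symm⟩
  · obtain ⟨a⟩ := I.nonempty_hochschildCohomologyEquiv hI n p
    obtain ⟨b⟩ := I'.nonempty_hochschildCohomologyEquiv hI' n p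
    exact ⟨a.symm.trans b⟩
  · obtain ⟨a⟩ := SuperHochschild.nonempty_cyclicCohomologyEquiv K C n p
    obtain ⟨b⟩ := SuperHochschild.nonempty_cyclicCohomologyEquiv K D n p
    obtain ⟨c⟩ := hC n p
    exact ⟨a.trans (c.symm.dualMap.trans b.symm)⟩
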